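/- For $a\ge 0$, $\sigma\ge 1$, $r\in\mathbb R$ let $\mathcal X^r_{a,\sigma}=\mathcal X^r_{a,\sigma}(\mathbb R^3)$ be the space of (scalar or vector valued) tempered distributions $f$ on $\mathbb R^3$ with $\widehat f\in L^1_{\rm loc}(\mathbb R^3)$ and $$\|f\|_{\mathcal X^r_{a,\sigma}}=\int_{\mathbb R^3}|\xi|^r e^{a|\xi|^{1/\sigma}}|\widehat f(\xi)|\,d\xi<\infty ,\qquad \widehat f(\xi)=\int_{\mathbb R^3} e^{-i\xi\cdot x}f(x)\,dx ,$$ and for $T>0$, $1\le p<\infty$ write $C_T(X)=C([0,T];X)$, $L^p_T(X)=L^p([0,T];X)$, $\|u\|_{L^\infty_T(X)}=\sup_{t\in[0,T]}\|u(t)\|_X$. A mild solution on $[0,T]$ of the fractional Boussinesq system $$u_t+(-\Delta)^\alpha u+u\cdot\nabla u+\nabla p=\theta e_3,\quad \theta_t+(-\Delta)^\beta\theta+u\cdot\nabla\theta=0,\quad \operatorname{div}u=0,\quad (u,\theta)(0)=(u_0,\theta_0)$$ is a pair $(u,\theta)$ with $\operatorname{div}u(t)=0$ and, for all $t\in[0,T]$,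 $$u(t)=e^{-t(-\Delta)^\alpha}u_0-\int_0^t e^{-(t-\tau)(-\Delta)^\alpha}\mathbb P(u\cdot\nabla u)\,d\tau+\int_0^t e^{-(t-\tau)(-\Delta)^\alpha}\mathbb P(\theta e_3)\,d\tau,$$ $$\theta(t)=e^{-t(-\Delta)^\beta}\theta_0-\int_0^t e^{-(t-\tau)(-\Delta)^\beta}(u\cdot\nabla\theta)\,d\tau ,$$ where $\mathbb P$ is the Leray projector and $e^{-t(-\Delta)^\gamma}$ is the Fourier multiplier with symbol $e^{-t|\xi|^{2\gamma}}$. **Theorem 1.2.** Let $(a,s,\sigma)\in\{(0,\infty)\times[-1,0)\times(1,\infty)\}\cup\{[0,\infty)\times\{0\}\times[1,\infty)\}$. There are constants $C_2,\delta>0$, depending only on $a,s,\sigma$, such that the following holds for all $\alpha,\beta\ge\frac12$ and all $(u_0,\theta_0)\in\mathcal X^s_{a,\sigma}$ with $\operatorname{div}u_0=0$, where in the case $\alpha=\frac12$ or $\beta=\frac12$ it is also assumed that $\|(u_0,\theta_0)\|_{\mathcal X^s_{a,\sigma}}:=\|u_0\|_{\mathcal X^s_{a,\sigma}}+\|\theta_0\|_{\mathcal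 X^s_{a,\sigma}}<\delta$. There exist $T>0$ and $C_1>0$ and a mild solution $$(u,\theta)\in[C_T(\mathcal X^s_{a,\sigma})\cap L^1_T(\mathcal X^{s+2\alpha}_{a,\sigma})]\times[C_T(\mathcal X^s_{a,\sigma})\cap L^1_T(\mathcal X^{s+2\beta}_{a,\sigma})]$$ on $[0,T]$ with $$N(u,\theta):=\|u\|_{L^\infty_T(\mathcal X^s_{a,\sigma})}+\|u\|_{L^1_T(\mathcal X^{s+2\alpha}_{a,\sigma})}+\|\theta\|_{L^\infty_T(\mathcal X^s_{a,\sigma})}+\|\theta\|_{L^1_T(\mathcal X^{s+2\beta}_{a,\sigma})}<C_1,$$ and $(u,\theta)$ is the only mild solution on $[0,T]$ in this space with $N<C_1$. Moreover $$N(u,\theta)\le C_2\,\|(u_0,\theta_0)\|_{\mathcal X^s_{a,\sigma}},$$ and for every real $p\ge1$ $$(u,\theta)\in L^p_T(\mathcal X^{s+2\alpha/p}_{a,\sigma})\times L^p_T(\mathcal X^{s+2\beta/p}_{a,\sigma}).$$ Here distributions may be complex valued; if $u_0$ and $\theta_0$ are real, then so are $u(t)$ and $\theta(t)$ for all $t\in[0,T]$.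 -/

import Mathlib

open MeasureTheory Set
open scoped SchwartzMap FourierTransform LineDeriv ENNReal

noncomputable section

namespace Boussinesq

/-- The physical (and frequency) space `ℝ³` with its Euclidean norm. -/
abbrev R3 := EuclideanSpace ℝ (Fin 3)

/-- The value space `ℂ³` of (complexified) vector fields, with its Hermitian norm. -/
abbrev C3 := EuclideanSpace ℂ (Fin 3)

section Distributions

set_option linter.unusedSectionVars false

variable {F : Type*} [NormedAddCommGroup F] [NormedSpace ℂ F] [CompleteSpace F]

/-- The tempered distribution `f` is the locally integrable function `h`. Integrability of `h`
against every Schwartz function is part of the notion; for a locally integrable function whose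
weighted norm (see `xNorm`) is finite it is automatic. -/
def IsFunction (f : 𝓢'(R3, F)) (h : R3 → F) : Prop :=
  LocallyIntegrable h volume ∧
    ∀ φ : 𝓢(R3, ℂ), Integrable (fun x => φ x • h x) volume ∧ f φ = ∫ x, φ x • h x

/-- `f̂ = g` is a locally integrable function, where `f̂(ξ) = ∫ e^{-i ξ·x} f(x) dx`.
Mathlib's transform is `𝓕 f (η) = ∫ e^{-2π i η·x} f(x) dx = f̂(2π η)`. -/
def HasFourier (f : 𝓢'(R3, F)) (g : R3 → F) : Prop :=
  IsFunction (𝓕 f) (fun η => g ((2 * Real.pi) • η))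

theorem IsFunction.ae_eq {f : 𝓢'(R3, F)} {h h' : R3 → F} (hh : IsFunction f h)
    (hh' : IsFunction f h') : h =ᵐ[volume] h' := by
  refine ae_eq_of_integral_contDiff_smul_eq hh.1 hh'.1 fun g g_smooth g_cpt => ?_
  have hg₁ : HasCompactSupport (Complex.ofRealCLM ∘ g) := g_cpt.comp_left rfl
  have hg₂ : ContDiff ℝ ((⊤ : ℕ∞) : WithTop ℕ∞) (Complex.ofRealCLM ∘ g) := by fun_prop
  have h1 := (hh.2 (hg₁.toSchwartzMap hg₂)).2
  have h2 := (hh'.2 (hg₁.toSchwartzMap hg₂)).2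
  simpa using h1.symm.trans h2

theorem two_pi_ne : (2 * Real.pi) ≠ 0 := by positivity

theorem quasi_smul {r : ℝ} (hr : r ≠ 0) :
    Measure.QuasiMeasurePreserving (fun x : R3 => r • x) volume volume := by
  refine ⟨by fun_prop, ?_⟩
  rw [Measure.map_addHaar_smul volume hr]
  exact Measure.smul_absolutelyContinuous

theorem HasFourier.ae_eq {f : 𝓢'(R3, F)} {g g' : R3 → F} (hg : HasFourier f g)
    (hg' : HasFourier f g') : g =ᵐ[volume] g' := by
  have h := IsFunction.ae_eq hg hg'
  filter_upwards [(quasi_smul (inv_ne_zero two_pi_ne)).ae h] with x hx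
  simpa only [smul_inv_smul₀ two_pi_ne] using hx

theorem HasFourier.aestronglyMeasurable {f : 𝓢'(R3, F)} {g : R3 → F} (hg : HasFourier f g) :
    AEStronglyMeasurable g volume := by
  have h := hg.1.aestronglyMeasurable.comp_quasiMeasurePreserving
    (quasi_smul (inv_ne_zero two_pi_ne))
  simpa only [Function.comp_def, smul_inv_smul₀ two_pi_ne] using h

theorem HasFourier.add {f f' : 𝓢'(R3, F)} {g g' : R3 → F} (hg : HasFourier f g)
    (hg' : HasFourier f' g') : HasFourier (f + f') (g + g') := by
  refine ⟨hg.1.add hg'.1, fun φ => ?_⟩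
  obtain ⟨i1, e1⟩ := hg.2 φ
  obtain ⟨i2, e2⟩ := hg'.2 φ
  refine ⟨by simpa [smul_add] using Integrable.fun_add i1 i2, ?_⟩
  have : 𝓕 (f + f') φ = 𝓕 f φ + 𝓕 f' φ := rfl
  rw [this, e1, e2, ← integral_add i1 i2]
  simp [smul_add]

theorem HasFourier.smul {f : 𝓢'(R3, F)} {g : R3 → F} (c : ℂ) (hg : HasFourier f g) :
    HasFourier (c • f) (c • g) := by
  refine ⟨hg.1.smul c, fun φ => ?_⟩
  obtain ⟨i1, e1⟩ := hg.2 φ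
  have hc : (fun x => φ x • (c • g) ((2 * Real.pi) • x))
      = fun x => c • φ x • g ((2 * Real.pi) • x) := by
    funext x; simp [smul_comm c]
  have : 𝓕 (c • f) φ = c • 𝓕 f φ := rfl
  refine ⟨by rw [hc]; exact i1.smul c, ?_⟩
  rw [this, e1, hc, integral_smul]

theorem HasFourier.zero : HasFourier (0 : 𝓢'(R3, F)) 0 := by
  refine ⟨by simpa using (locallyIntegrable_zero : LocallyIntegrable (fun _ : R3 => (0 : F)) volume),
    fun φ => ⟨by simp, ?_⟩⟩
  change (0 : F) = _
  simp

/-- The weight `|ξ|^s e^{a |ξ|^{1/σ}}`. -/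
def weight (a σ s : ℝ) (ξ : R3) : ℝ := ‖ξ‖ ^ s * Real.exp (a * ‖ξ‖ ^ (1 / σ))

/-- The Lei-Lin-Gevrey norm `∫ |ξ|^s e^{a |ξ|^{1/σ}} |f̂(ξ)| dξ ∈ [0, ∞]`, equal to `∞` if `f̂` is
not a locally integrable function (the infimum is over at most one function up to null sets). -/
def xNorm (a σ s : ℝ) (f : 𝓢'(R3, F)) : ℝ≥0∞ :=
  ⨅ (g : R3 → F) (_ : HasFourier f g), ∫⁻ ξ, ENNReal.ofReal (weight a σ s ξ) * ‖g ξ‖ₑ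

theorem HasFourier.xNorm_eq {f : 𝓢'(R3, F)} {g : R3 → F} (hg : HasFourier f g) (a σ s : ℝ) :
    xNorm a σ s f = ∫⁻ ξ, ENNReal.ofReal (weight a σ s ξ) * ‖g ξ‖ₑ := by
  refine le_antisymm (iInf₂_le g hg) (le_iInf₂ fun g' hg' => le_of_eq ?_)
  refine lintegral_congr_ae ?_
  filter_upwards [hg.ae_eq hg'] with ξ hξ
  rw [hξ]

theorem exists_hasFourier {a σ s : ℝ} {f : 𝓢'(R3, F)} (hf : xNorm a σ s f < ∞) :
    ∃ g, HasFourier f g := by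
  by_contra! h
  simp [xNorm, h] at hf

theorem xNorm_zero (a σ s : ℝ) : xNorm a σ s (0 : 𝓢'(R3, F)) = 0 := by
  simp [HasFourier.zero.xNorm_eq]

theorem measurable_weight (a σ s : ℝ) : Measurable (weight a σ s) := by
  unfold weight; fun_prop

theorem xNorm_add_le (a σ s : ℝ) (f f' : 𝓢'(R3, F)) :
    xNorm a σ s (f + f') ≤ xNorm a σ s f + xNorm a σ s f' := by
  by_cases hf : xNorm a σ s f < ∞
  swap
  · simp [not_lt_top_iff.mp hf]
  by_cases hf' : xNorm a σ s f' < ∞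
  swap
  · simp [not_lt_top_iff.mp hf']
  obtain ⟨g, hg⟩ := exists_hasFourier hf
  obtain ⟨g', hg'⟩ := exists_hasFourier hf'
  rw [hg.xNorm_eq, hg'.xNorm_eq, (hg.add hg').xNorm_eq]
  rw [← lintegral_add_left' (μ := volume) (f := fun ξ => ENNReal.ofReal (weight a σ s ξ) * ‖g ξ‖ₑ) ((measurable_weight a σ s).ennreal_ofReal.aemeasurable.mul hg.aestronglyMeasurable.enorm)]
  refine lintegral_mono fun ξ => ?_
  rw [← mul_add]
  gcongr
  exact enorm_add_le _ _

theorem xNorm_smul (a σ s : ℝ) (c : ℂ) {f : 𝓢'(R3, F)} (hf : xNorm a σ s f < ∞) :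
    xNorm a σ s (c • f) = ‖c‖ₑ * xNorm a σ s f := by
  obtain ⟨g, hg⟩ := exists_hasFourier hf
  rw [hg.xNorm_eq, (hg.smul c).xNorm_eq, ← lintegral_const_mul' _ _ enorm_ne_top]
  refine lintegral_congr fun ξ => ?_
  simp only [Pi.smul_apply, enorm_smul]
  ring

theorem eq_zero_of_xNorm_eq_zero {a σ s : ℝ} {f : 𝓢'(R3, F)} (hf : xNorm a σ s f = 0) :
    f = 0 := by
  obtain ⟨g, hg⟩ := exists_hasFourier (hf.trans_lt ENNReal.zero_lt_top)
  rw [hg.xNorm_eq, lintegral_eq_zero_iff' (f := fun ξ => ENNReal.ofReal (weight a σ s ξ) * ‖g ξ‖ₑ)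
    ((measurable_weight a σ s).ennreal_ofReal.aemeasurable.mul hg.aestronglyMeasurable.enorm)] at hf
  have h0 : ∀ᵐ ξ : R3, ξ ≠ 0 := by
    simp [ae_iff]
  have hg0 : ∀ᵐ ξ : R3, g ξ = 0 := by
    filter_upwards [hf, h0] with ξ hξ hne
    have hw : 0 < weight a σ s ξ := by
      have := norm_pos_iff.mpr hne
      unfold weight; positivity
    simpa [hw.not_ge] using hξ
  have hg1 := (quasi_smul two_pi_ne).ae hg0
  have hF : 𝓕 f = 0 := by
    ext φ
    rw [(hg.2 φ).2]
    have : (fun x => φ x • g ((2 * Real.pi) • x)) =ᵐ[volume] 0 := by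
      filter_upwards [hg1] with x hx
      simp [hx]
    rw [integral_congr_ae this]
    simp
  have := congrArg (fun h => 𝓕⁻ h) hF
  simp only [FourierTransform.fourierInv_fourier_eq] at this
  rw [this]
  ext φ
  rfl

end Distributions

section Spaces

variable (F : Type*) [NormedAddCommGroup F] [NormedSpace ℂ F] [CompleteSpace F]

/-- The tempered distributions with locally integrable Fourier transform and finite
Lei-Lin-Gevrey norm, as a subspace of `𝓢'`. -/
def leiLinGevreySubmodule (a σ s : ℝ) : Submodule ℂ 𝓢'(R3, F) where
  carrier := {f | xNorm a σ s f < ∞}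
  add_mem' hf hg := (xNorm_add_le a σ s _ _).trans_lt (ENNReal.add_lt_top.mpr ⟨hf, hg⟩)
  zero_mem' := by simp [xNorm_zero]
  smul_mem' c f hf := by
    have hf' : xNorm a σ s f < ∞ := hf
    change xNorm a σ s (c • f) < ∞
    rw [xNorm_smul a σ s c hf']
    exact ENNReal.mul_lt_top enorm_lt_top hf'

/-- The Lei-Lin-Gevrey space `X^s_{a,σ}(ℝ³)` of `F`-valued distributions. It carries the topology of
the Lei-Lin-Gevrey norm, not the one of `𝓢'`. -/
def LeiLinGevrey (a σ s : ℝ) : Type _ := leiLinGevreySubmodule F a σ s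

instance (a σ s : ℝ) : AddCommGroup (LeiLinGevrey F a σ s) :=
  inferInstanceAs (AddCommGroup (leiLinGevreySubmodule F a σ s))

instance (a σ s : ℝ) : Module ℂ (LeiLinGevrey F a σ s) :=
  inferInstanceAs (Module ℂ (leiLinGevreySubmodule F a σ s))

variable {F}

/-- The distribution underlying an element of a Lei-Lin-Gevrey space. -/
def LeiLinGevrey.toDist {a σ s : ℝ} (f : LeiLinGevrey F a σ s) : 𝓢'(R3, F) := f.1

variable (F)

instance (a σ s : ℝ) : Norm (LeiLinGevrey F a σ s) := ⟨fun f => (xNorm a σ s f.toDist).toReal⟩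

theorem leiLinGevrey_core (a σ s : ℝ) : NormedSpace.Core ℂ (LeiLinGevrey F a σ s) where
  norm_nonneg _ := ENNReal.toReal_nonneg
  norm_smul c f := by
    change (xNorm a σ s (c • f.toDist)).toReal = ‖c‖ * (xNorm a σ s f.toDist).toReal
    rw [xNorm_smul a σ s c (show xNorm a σ s f.toDist < ⊤ from f.2), ENNReal.toReal_mul]
    simp
  norm_triangle f g := by
    change (xNorm a σ s (f.toDist + g.toDist)).toReal
      ≤ (xNorm a σ s f.toDist).toReal + (xNorm a σ s g.toDist).toReal
    have hf : xNorm a σ s f.toDist < ∞ := f.2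
    have hg : xNorm a σ s g.toDist < ∞ := g.2
    rw [← ENNReal.toReal_add hf.ne hg.ne]
    exact ENNReal.toReal_mono (ENNReal.add_lt_top.mpr ⟨hf, hg⟩).ne (xNorm_add_le a σ s _ _)
  norm_eq_zero_iff f := by
    have hf : xNorm a σ s f.toDist < ∞ := f.2
    constructor
    · intro h
      have h' : xNorm a σ s f.toDist = 0 :=
        ((ENNReal.toReal_eq_zero_iff _).mp h).resolve_right hf.ne
      exact Subtype.ext (eq_zero_of_xNorm_eq_zero h')
    · rintro rfl
      change (xNorm a σ s (0 : 𝓢'(R3, F))).toReal = 0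
      simp [xNorm_zero]

instance (a σ s : ℝ) : NormedAddCommGroup (LeiLinGevrey F a σ s) :=
  NormedAddCommGroup.ofCore (leiLinGevrey_core F a σ s)

instance (a σ s : ℝ) : NormedSpace ℂ (LeiLinGevrey F a σ s) :=
  NormedSpace.ofCore (leiLinGevrey_core F a σ s)

variable {F}

/-- `u ∈ C([0,T]; X^s_{a,σ})`. -/
def MemC (a σ s T : ℝ) (u : ℝ → 𝓢'(R3, F)) : Prop :=
  ∃ v : ℝ → LeiLinGevrey F a σ s,
    ContinuousOn v (Icc 0 T) ∧ ∀ t ∈ Icc 0 T, (v t).toDist = u t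

/-- `u ∈ L^p([0,T]; X^s_{a,σ})`, for `1 ≤ p < ∞` (as usual, `u(t) ∈ X^s_{a,σ}` is required for
almost every `t`). -/
def MemLpTime (a σ s p T : ℝ) (u : ℝ → 𝓢'(R3, F)) : Prop :=
  ∃ v : ℝ → LeiLinGevrey F a σ s,
    MeasureTheory.MemLp v (ENNReal.ofReal p) (volume.restrict (Icc 0 T)) ∧
      ∀ᵐ t ∂(volume.restrict (Icc 0 T)), (v t).toDist = u t

/-- `‖u‖_{L^∞_T(X^s_{a,σ})} = sup_{t ∈ [0,T]} ‖u(t)‖_{X^s_{a,σ}}`. -/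
def supNorm (a σ s T : ℝ) (u : ℝ → 𝓢'(R3, F)) : ℝ≥0∞ := ⨆ t ∈ Icc 0 T, xNorm a σ s (u t)

/-- `‖u‖_{L^1_T(X^s_{a,σ})} = ∫_0^T ‖u(t)‖_{X^s_{a,σ}} dt`. -/
def oneNorm (a σ s T : ℝ) (u : ℝ → 𝓢'(R3, F)) : ℝ≥0∞ := ∫⁻ t in Icc 0 T, xNorm a σ s (u t)

end Spaces

section Operators

variable {F G : Type*} [NormedAddCommGroup F] [NormedSpace ℂ F] [CompleteSpace F]
  [NormedAddCommGroup G] [NormedSpace ℂ G] [CompleteSpace G]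

open Classical in
/-- The Fourier multiplier with symbol `m`: the distribution `g` with `ĝ(ξ) = m(ξ) f̂(ξ)`, where
`f̂` and `ĝ` are locally integrable functions (and `0` if there is no such `g`). -/
def fourierMultiplier (m : R3 → F → G) (f : 𝓢'(R3, F)) : 𝓢'(R3, G) :=
  if h : ∃ g : 𝓢'(R3, G), ∃ k : R3 → F, HasFourier f k ∧ HasFourier g (fun ξ => m ξ (k ξ))
  then h.choose else 0

/-- The fractional heat semigroup `e^{-t(-Δ)^γ}`, with symbol `e^{-t|ξ|^{2γ}}`. -/
def heat (γ t : ℝ) (f : 𝓢'(R3, F)) : 𝓢'(R3, F) :=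
  fourierMultiplier (fun ξ v => (Real.exp (-t * ‖ξ‖ ^ (2 * γ)) : ℂ) • v) f

/-- The Leray projector, with symbol `v ↦ v - (ξ·v) ξ / |ξ|²`. -/
def leray (f : 𝓢'(R3, C3)) : 𝓢'(R3, C3) :=
  fourierMultiplier (fun ξ v =>
    v - ((∑ j, (ξ j : ℂ) * v j) / (‖ξ‖ ^ 2 : ℝ)) • (WithLp.toLp 2 fun j => (ξ j : ℂ) : C3)) f

/-- The `j`-th standard basis vector of `ℝ³`. -/
def basisVec (j : Fin 3) : R3 := EuclideanSpace.single j (1 : ℝ)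

/-- `div u = 0` in the sense of distributions. -/
def IsDivFree (u : 𝓢'(R3, C3)) : Prop :=
  ∀ φ : 𝓢(R3, ℂ), ∑ j, (∂_{basisVec j} u φ) j = 0

/-- `N = u·∇w = ∑ⱼ uⱼ ∂ⱼw`, a pointwise product of functions: `u` and all `∂ⱼw` (distributional
derivatives) are functions, and `N` is the function `∑ⱼ uⱼ ∂ⱼw`. -/
def IsAdvection (u : 𝓢'(R3, C3)) (w N : 𝓢'(R3, F)) : Prop :=
  ∃ (U : R3 → C3) (W : Fin 3 → R3 → F), IsFunction u U ∧
    (∀ j, IsFunction (∂_{basisVec j} w) (W j)) ∧ IsFunction N (fun x => ∑ j, U x j • W j x)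

open Classical in
/-- The distribution `u·∇w` (and `0` if it is not defined). -/
def advection (u : 𝓢'(R3, C3)) (w : 𝓢'(R3, F)) : 𝓢'(R3, F) :=
  if h : ∃ N, IsAdvection u w N then h.choose else 0

/-- `u·∇w` is defined, with locally integrable Fourier transform. -/
def AdvectionDefined (u : 𝓢'(R3, C3)) (w : 𝓢'(R3, F)) : Prop :=
  ∃ N, IsAdvection u w N ∧ ∃ g, HasFourier N g

/-- The buoyancy force `θ e₃`. -/
def buoyancy (θ : 𝓢'(R3, ℂ)) : 𝓢'(R3, C3) :=
  PointwiseConvergenceCLM.postcomp 𝓢(R3, ℂ)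
    (ContinuousLinearMap.toSpanSingleton ℂ (EuclideanSpace.single 2 1 : C3)) θ

/-- A scalar distribution is real. -/
def IsRealScalar (f : 𝓢'(R3, ℂ)) : Prop :=
  ∀ φ : 𝓢(R3, ℂ), (∀ x, (φ x).im = 0) → (f φ).im = 0

/-- A vector distribution is real. -/
def IsRealVector (f : 𝓢'(R3, C3)) : Prop :=
  ∀ φ : 𝓢(R3, ℂ), (∀ x, (φ x).im = 0) → ∀ j, (f φ j).im = 0

end Operators

/-- `(u, θ)` is a mild solution on `[0,T]` of the Boussinesq system with data `(u₀, θ₀)`: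
`div u = 0`, the products `u·∇u` and `u·∇θ` are defined at almost every time, and Duhamel's
formulas
`u(t) = e^{-t(-Δ)^α} u₀ - ∫₀ᵗ e^{-(t-τ)(-Δ)^α} ℙ(u·∇u) dτ + ∫₀ᵗ e^{-(t-τ)(-Δ)^α} ℙ(θe₃) dτ`,
`θ(t) = e^{-t(-Δ)^β} θ₀ - ∫₀ᵗ e^{-(t-τ)(-Δ)^β} (u·∇θ) dτ`
hold for all `t ∈ [0,T]`, the integrals being integrals of `𝓢'`-valued functions
(absolutely convergent when tested with Schwartz functions). -/
structure IsMildSolution (α β T : ℝ) (u₀ : 𝓢'(R3, C3)) (θ₀ : 𝓢'(R3, ℂ))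
    (u : ℝ → 𝓢'(R3, C3)) (θ : ℝ → 𝓢'(R3, ℂ)) : Prop where
  divFree : ∀ t ∈ Icc 0 T, IsDivFree (u t)
  advection_u : ∀ᵐ t ∂(volume.restrict (Icc 0 T)), AdvectionDefined (u t) (u t)
  advection_θ : ∀ᵐ t ∂(volume.restrict (Icc 0 T)), AdvectionDefined (u t) (θ t)
  integrable_u : ∀ t ∈ Icc 0 T, ∀ φ : 𝓢(R3, ℂ), IntervalIntegrable
    (fun τ => heat α (t - τ) (leray (advection (u τ) (u τ))) φ) volume 0 t
  integrable_force : ∀ t ∈ Icc 0 T, ∀ φ : 𝓢(R3, ℂ), IntervalIntegrable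
    (fun τ => heat α (t - τ) (leray (buoyancy (θ τ))) φ) volume 0 t
  integrable_θ : ∀ t ∈ Icc 0 T, ∀ φ : 𝓢(R3, ℂ), IntervalIntegrable
    (fun τ => heat β (t - τ) (advection (u τ) (θ τ)) φ) volume 0 t
  duhamel_u : ∀ t ∈ Icc 0 T, ∀ φ : 𝓢(R3, ℂ),
    u t φ = heat α t u₀ φ
      - (∫ τ in (0 : ℝ)..t, heat α (t - τ) (leray (advection (u τ) (u τ))) φ)
      + ∫ τ in (0 : ℝ)..t, heat α (t - τ) (leray (buoyancy (θ τ))) φ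
  duhamel_θ : ∀ t ∈ Icc 0 T, ∀ φ : 𝓢(R3, ℂ),
    θ t φ = heat β t θ₀ φ
      - ∫ τ in (0 : ℝ)..t, heat β (t - τ) (advection (u τ) (θ τ)) φ

/-- `(u, θ) ∈ [C_T(X^s_{a,σ}) ∩ L^1_T(X^{s+2α}_{a,σ})] × [C_T(X^s_{a,σ}) ∩ L^1_T(X^{s+2β}_{a,σ})]`. -/
def MemSolutionSpace (a σ s α β T : ℝ) (u : ℝ → 𝓢'(R3, C3)) (θ : ℝ → 𝓢'(R3, ℂ)) : Prop :=
  (MemC a σ s T u ∧ MemLpTime a σ (s + 2 * α) 1 T u) ∧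
    (MemC a σ s T θ ∧ MemLpTime a σ (s + 2 * β) 1 T θ)

/-- `‖u‖_{L^∞_T(X^s)} + ‖u‖_{L^1_T(X^{s+2α})} + ‖θ‖_{L^∞_T(X^s)} + ‖θ‖_{L^1_T(X^{s+2β})}`. -/
def solutionNorm (a σ s α β T : ℝ) (u : ℝ → 𝓢'(R3, C3)) (θ : ℝ → 𝓢'(R3, ℂ)) : ℝ≥0∞ :=
  supNorm a σ s T u + oneNorm a σ (s + 2 * α) T u
    + supNorm a σ s T θ + oneNorm a σ (s + 2 * β) T θ

end Boussinesq

end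

/-!
The theorem is a fixed point argument carried out on the Fourier side, where every object of the
mild formulation is an honest function: the heat semigroup multiplies by `e^{-t|ξ|^{2γ}}`, the Leray
projector applies an orthogonal projection of `ℂ³` at each frequency, and, for divergence free `u`,
the transport term `u·∇w = ∇·(u w)` becomes the convolution
`(2π)⁻³ ∫ (i ξ·û(ξ-η)) ŵ(η) dη` (`HasFourier.advection`).

Two properties of the weight `|ξ|^s e^{a|ξ|^{1/σ}}` are used (`WeightBounds`,
`Admissible.exists_weight_le`). It is bounded below, so the elements of `X^s` have integrable
transforms; they are bounded continuous functions, and their products make sense. And the weight of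
order `s + 1` obeys a Leibniz rule: for `s = 0` this is subadditivity, and for `s < 0` the factor
`|η|^{-s}` lost at the smaller frequency `η` is absorbed by the exponential, because
`|ξ+η|^{1/σ} ≤ |ξ|^{1/σ} + |η|^{1/σ}/σ` for `|η| ≤ |ξ|`, and `σ > 1`. It yields the product estimate
`‖u·∇w‖_s ≤ K (‖u‖_{s+1} ‖w‖_s + ‖u‖_s ‖w‖_{s+1})` (`WeightBounds.freqNorm_convAdvection_le`).

Duhamel's operator maps `X^s × L¹([0,T]; X^s)` into `C([0,T]; X^s) ∩ L¹([0,T]; X^{s+2γ})` with norm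
at most two (`energy_duhamel_le`), and Young's inequality `y ≤ ε y^{2γ} + M` (`YoungBound`) bounds
the `L¹([0,T]; X^{s+1})` norm by `ε + M T` times the energy. For `α, β > 1/2` both `ε` and `T` may
be taken small after the size of the data is known; in the critical case `ε = 1`, and the smallness
of the data takes its place. Either way the forces depend on the state in a Lipschitz manner with
constant `1/8` (`Small`, `WeightBounds.forceDiff_le_of_small`), which gives uniqueness, the bound by
the data with constant `4`, and, by Banach's theorem in a weighted `L¹` space of forces, existence.

What remains is the dictionary between distributions and their transforms. Competitors in the
uniqueness statement have jointly measurable transforms, obtained as limits of averages over small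
balls (`WeightBounds.exists_jointly_measurable`); continuity in time follows from dominated
convergence in frequency; the `L^p` regularity is interpolation between the orders `s` and `s + 2γ`.
A distribution is real iff its transform satisfies `f̂(-ξ) = conj f̂(ξ)`, a symmetry preserved by
the system, so the solution with real data is real by uniqueness.
-/

noncomputable section

namespace Boussinesq

/-! ### The Gevrey weights -/

/-- Subadditivity of a concave power, with a gain on the smaller argument. -/
theorem rpow_add_le_add_mul_rpow {x y p : ℝ} (hy : 0 < y) (hyx : y ≤ x) (hp0 : 0 ≤ p)
    (hp1 : p ≤ 1) : (x + y) ^ p ≤ x ^ p + p * y ^ p := by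
  have hx : 0 < x := hy.trans_le hyx
  have hz0 : 0 ≤ y / x := by positivity
  have hz1 : y / x ≤ 1 := (div_le_one hx).mpr hyx
  have h1 : (1 + y / x) ^ p ≤ 1 + p * (y / x) :=
    rpow_one_add_le_one_add_mul_self (by linarith) hp0 hp1
  have h2 : y / x ≤ (y / x) ^ p := by
    simpa using Real.rpow_le_rpow_of_exponent_ge' hz0 hz1 hp0 hp1
  have h3 : x + y = x * (1 + y / x) := by field_simp
  calc (x + y) ^ p = x ^ p * (1 + y / x) ^ p := by
        rw [h3, Real.mul_rpow hx.le (by linarith)]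
    _ ≤ x ^ p * (1 + p * (y / x) ^ p) := by gcongr; exact h1.trans (by gcongr)
    _ = x ^ p + p * (x ^ p * (y / x) ^ p) := by ring
    _ = x ^ p + p * y ^ p := by
        rw [← Real.mul_rpow hx.le hz0, mul_div_cancel₀ _ hx.ne']

/-- The admissible range of the parameters `(a, s, σ)`. -/
def Admissible (a s σ : ℝ) : Prop :=
  (0 < a ∧ (-1 ≤ s ∧ s < 0) ∧ 1 < σ) ∨ (0 ≤ a ∧ s = 0 ∧ 1 ≤ σ)

/-- The gain `1 - 1/σ` in the exponential pays for the singular power `y ^ s`. -/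
theorem Admissible.exists_exp_le {a s σ : ℝ} (h : Admissible a s σ) :
    ∃ C : ℝ, 1 ≤ C ∧ ∀ y : ℝ, 0 < y →
      Real.exp (a * (1 / σ * y ^ (1 / σ))) ≤ C * (y ^ s * Real.exp (a * y ^ (1 / σ))) := by
  rcases h with ⟨ha, ⟨-, hs⟩, hσ⟩ | ⟨ha, rfl, hσ⟩
  · set p := 1 / σ with hp
    have hσ0 : 0 < σ := by linarith
    have hp0 : 0 < p := by positivity
    have hp1 : p < 1 := by rw [hp, div_lt_one hσ0]; exact hσ
    set m := -s / p with hm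
    have hm0 : 0 < m := div_pos (by linarith) hp0
    set c := a * (1 - p) with hc
    have hc0 : 0 < c := mul_pos ha (by linarith)
    refine ⟨max 1 ((m / c) ^ m), le_max_left _ _, fun y hy => ?_⟩
    have hyp : 0 < y ^ p := by positivity
    -- `z ≤ e^z` with `z = c y^p / m`, raised to the power `m = -s/p`, bounds `y^{-s}`
    have h1 : y ^ p ≤ m / c * Real.exp (c * y ^ p / m) := by
      have := Real.add_one_le_exp (c * y ^ p / m)
      have h2 : c * y ^ p / m ≤ Real.exp (c * y ^ p / m) := by linarith
      calc y ^ p = m / c * (c * y ^ p / m) := by field_simp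
        _ ≤ _ := by gcongr
    have h2 : y ^ (-s) ≤ (m / c) ^ m * Real.exp (c * y ^ p) := by
      have h3 : y ^ (-s) = (y ^ p) ^ m := by
        rw [← Real.rpow_mul hy.le]; congr 1; rw [hm]; field_simp
      rw [h3]
      calc (y ^ p) ^ m ≤ (m / c * Real.exp (c * y ^ p / m)) ^ m := by gcongr
        _ = (m / c) ^ m * Real.exp (c * y ^ p) := by
          rw [Real.mul_rpow (by positivity) (Real.exp_pos _).le, ← Real.exp_mul]
          congr 2; field_simp
    have h4 : y ^ (-s) ≤ max 1 ((m / c) ^ m) * Real.exp (c * y ^ p) :=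
      h2.trans (by gcongr; exact le_max_right _ _)
    have h5 : y ^ s * y ^ (-s) = 1 := by rw [← Real.rpow_add hy]; simp
    calc Real.exp (a * (p * y ^ p)) = y ^ s * y ^ (-s) * Real.exp (a * (p * y ^ p)) := by
          rw [h5, one_mul]
      _ ≤ y ^ s * (max 1 ((m / c) ^ m) * Real.exp (c * y ^ p)) * Real.exp (a * (p * y ^ p)) := by
          gcongr
      _ = max 1 ((m / c) ^ m) * (y ^ s * (Real.exp (c * y ^ p) * Real.exp (a * (p * y ^ p)))) := by
          ring
      _ = _ := by rw [← Real.exp_add]; congr 3; rw [hc]; ring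
  · refine ⟨1, le_rfl, fun y hy => ?_⟩
    rw [Real.rpow_zero, one_mul, one_mul]
    have hp1 : 1 / σ ≤ 1 := by rw [div_le_one (by linarith)]; exact hσ
    have : 0 < y ^ (1 / σ) := by positivity
    gcongr
    nlinarith

theorem weight_nonneg (a σ s : ℝ) (ξ : R3) : 0 ≤ weight a σ s ξ := by
  unfold weight; positivity

theorem weight_pos (a σ s : ℝ) {ξ : R3} (h : ξ ≠ 0) : 0 < weight a σ s ξ := by
  have := norm_pos_iff.mpr h
  unfold weight; positivity

theorem weight_add (a σ s r : ℝ) {ξ : R3} (h : ξ ≠ 0) :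
    weight a σ (s + r) ξ = ‖ξ‖ ^ r * weight a σ s ξ := by
  have := norm_pos_iff.mpr h
  unfold weight
  rw [Real.rpow_add this]; ring

/-- The weight estimate when the second frequency is the smaller one. -/
theorem weight_add_le_of_norm_le {a s σ C : ℝ} (h : Admissible a s σ)
    (hC : ∀ y : ℝ, 0 < y →
      Real.exp (a * (1 / σ * y ^ (1 / σ))) ≤ C * (y ^ s * Real.exp (a * y ^ (1 / σ))))
    {x y : R3} (hy : y ≠ 0) (hyx : ‖y‖ ≤ ‖x‖) :
    weight a σ (s + 1) (x + y) ≤ 2 * C * (weight a σ (s + 1) x * weight a σ s y) := by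
  have hy0 : 0 < ‖y‖ := norm_pos_iff.mpr hy
  have ha : 0 ≤ a := by rcases h with h | h <;> linarith [h.1]
  have hs : 0 ≤ s + 1 := by rcases h with h | h <;> linarith [h.2.1]
  have hs' : s + 1 ≤ 1 := by rcases h with h | h <;> linarith [h.2.1]
  have hσ : 1 ≤ σ := by rcases h with h | h <;> linarith [h.2.2]
  have hp0 : 0 ≤ 1 / σ := by positivity
  have hp1 : 1 / σ ≤ 1 := by rw [div_le_one (by linarith)]; exact hσ
  have h1 : ‖x + y‖ ^ (s + 1) ≤ 2 * ‖x‖ ^ (s + 1) := by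
    have h2 : ‖x + y‖ ≤ 2 * ‖x‖ := (norm_add_le x y).trans (by linarith)
    calc ‖x + y‖ ^ (s + 1) ≤ (2 * ‖x‖) ^ (s + 1) := by gcongr
      _ = 2 ^ (s + 1) * ‖x‖ ^ (s + 1) := Real.mul_rpow (by norm_num) (norm_nonneg _)
      _ ≤ 2 ^ (1 : ℝ) * ‖x‖ ^ (s + 1) := by
        gcongr
        exact one_le_two
      _ = _ := by simp
  have h2 : ‖x + y‖ ^ (1 / σ) ≤ ‖x‖ ^ (1 / σ) + 1 / σ * ‖y‖ ^ (1 / σ) :=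
    (Real.rpow_le_rpow (norm_nonneg _) (norm_add_le x y) hp0).trans
      (rpow_add_le_add_mul_rpow hy0 hyx hp0 hp1)
  unfold weight
  calc ‖x + y‖ ^ (s + 1) * Real.exp (a * ‖x + y‖ ^ (1 / σ))
      ≤ 2 * ‖x‖ ^ (s + 1) * Real.exp (a * (‖x‖ ^ (1 / σ) + 1 / σ * ‖y‖ ^ (1 / σ))) := by gcongr
    _ = 2 * ‖x‖ ^ (s + 1) * Real.exp (a * ‖x‖ ^ (1 / σ))
          * Real.exp (a * (1 / σ * ‖y‖ ^ (1 / σ))) := by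
        rw [mul_add, Real.exp_add]; ring
    _ ≤ 2 * ‖x‖ ^ (s + 1) * Real.exp (a * ‖x‖ ^ (1 / σ))
          * (C * (‖y‖ ^ s * Real.exp (a * ‖y‖ ^ (1 / σ)))) := by
        gcongr; exact hC _ hy0
    _ = _ := by ring

/-- The two weight inequalities behind the theorem: `X^s` controls `L¹` of the transform, and the
weight of order `s + 1` obeys a Leibniz rule. -/
theorem Admissible.exists_weight_le {a s σ : ℝ} (h : Admissible a s σ) :
    ∃ K : ℝ, 1 ≤ K ∧ (∀ x : R3, x ≠ 0 → 1 ≤ K * weight a σ s x) ∧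
      ∀ x y : R3, x ≠ 0 → y ≠ 0 → weight a σ (s + 1) (x + y) ≤
        K * (weight a σ (s + 1) x * weight a σ s y + weight a σ s x * weight a σ (s + 1) y) := by
  obtain ⟨C, hC1, hC⟩ := h.exists_exp_le
  have ha : 0 ≤ a := by rcases h with h | h <;> linarith [h.1]
  have hσ : 1 ≤ σ := by rcases h with h | h <;> linarith [h.2.2]
  refine ⟨2 * C, by linarith, fun x hx => ?_, fun x y hx hy => ?_⟩
  · have hw := weight_nonneg a σ s x
    have h1 := hC ‖x‖ (norm_pos_iff.mpr hx)
    have h2 : 1 ≤ Real.exp (a * (1 / σ * ‖x‖ ^ (1 / σ))) := Real.one_le_exp (by positivity)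
    have h3 : 1 ≤ C * weight a σ s x := h2.trans h1
    nlinarith
  · have hpos : ∀ (r r' : ℝ) (z z' : R3), 0 ≤ 2 * C * (weight a σ r z * weight a σ r' z') :=
      fun r r' z z' => mul_nonneg (by linarith)
        (mul_nonneg (weight_nonneg _ _ _ _) (weight_nonneg _ _ _ _))
    rcases le_total ‖y‖ ‖x‖ with hyx | hxy
    · refine (weight_add_le_of_norm_le h hC hy hyx).trans ?_
      linarith [hpos s (s + 1) x y]
    · rw [add_comm x y]
      refine (weight_add_le_of_norm_le h hC hx hxy).trans ?_
      linarith [hpos (s + 1) s x y]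

/-! ### Weighted norms of Fourier transforms -/

section FreqNorm

variable {F : Type*} [NormedAddCommGroup F]

/-- The weighted `L¹` norm `∫ |ξ|^r e^{a |ξ|^{1/σ}} |g(ξ)| dξ` of a function of the frequency. -/
def freqNorm (a σ r : ℝ) (g : R3 → F) : ℝ≥0∞ :=
  ∫⁻ ξ, ENNReal.ofReal (weight a σ r ξ) * ‖g ξ‖ₑ

variable {a s σ K r : ℝ}

theorem ae_ne_zero : ∀ᵐ ξ : R3, ξ ≠ 0 := by simp [ae_iff]

theorem measurable_ofReal_weight (a σ r : ℝ) :
    Measurable fun ξ : R3 => ENNReal.ofReal (weight a σ r ξ) :=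
  (measurable_weight a σ r).ennreal_ofReal

theorem measurable_weight_mul_enorm (a σ r : ℝ) {g : R3 → F} (hg : StronglyMeasurable g) :
    Measurable fun ξ => ENNReal.ofReal (weight a σ r ξ) * ‖g ξ‖ₑ :=
  (measurable_ofReal_weight a σ r).mul hg.enorm

theorem freqNorm_congr {g g' : R3 → F} (h : g =ᵐ[volume] g') :
    freqNorm a σ r g = freqNorm a σ r g' := by
  refine lintegral_congr_ae ?_
  filter_upwards [h] with ξ hξ
  rw [hξ]

theorem freqNorm_mono_ae {G : Type*} [NormedAddCommGroup G] {g : R3 → F} {g' : R3 → G}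
    (h : ∀ᵐ ξ, ‖g ξ‖ₑ ≤ ‖g' ξ‖ₑ) : freqNorm a σ r g ≤ freqNorm a σ r g' := by
  refine lintegral_mono_ae ?_
  filter_upwards [h] with ξ hξ
  gcongr

theorem freqNorm_zero : freqNorm a σ r (0 : R3 → F) = 0 := by simp [freqNorm]

theorem freqNorm_add_le {g g' : R3 → F} (hg : StronglyMeasurable g) :
    freqNorm a σ r (g + g') ≤ freqNorm a σ r g + freqNorm a σ r g' := by
  unfold freqNorm
  rw [← lintegral_add_left (measurable_weight_mul_enorm a σ r hg)]
  refine lintegral_mono fun ξ => ?_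
  rw [← mul_add]
  gcongr
  exact enorm_add_le _ _

theorem freqNorm_sub_le {g g' : R3 → F} (hg : StronglyMeasurable g) :
    freqNorm a σ r (g - g') ≤ freqNorm a σ r g + freqNorm a σ r g' := by
  unfold freqNorm
  rw [← lintegral_add_left (measurable_weight_mul_enorm a σ r hg)]
  refine lintegral_mono fun ξ => ?_
  rw [← mul_add]
  gcongr
  exact enorm_sub_le

theorem ae_eq_of_freqNorm_sub_eq_zero {g g' : R3 → F} (hg : StronglyMeasurable g)
    (hg' : StronglyMeasurable g') (h : freqNorm a σ r (g - g') = 0) : g =ᵐ[volume] g' := by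
  unfold freqNorm at h
  rw [lintegral_eq_zero_iff (measurable_weight_mul_enorm a σ r (hg.sub hg'))] at h
  filter_upwards [h, ae_ne_zero] with ξ hξ hne
  have hw := weight_pos a σ r hne
  simpa [hw.not_ge, sub_eq_zero] using hξ

/-- The inequalities for the weights of orders `s` and `s + 1` used in the estimates. -/
structure WeightBounds (a s σ K : ℝ) : Prop where
  one_le : 1 ≤ K
  lower : ∀ x : R3, x ≠ 0 → 1 ≤ K * weight a σ s x
  leibniz : ∀ x y : R3, x ≠ 0 → y ≠ 0 → weight a σ (s + 1) (x + y) ≤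
    K * (weight a σ (s + 1) x * weight a σ s y + weight a σ s x * weight a σ (s + 1) y)

theorem WeightBounds.lintegral_enorm_le (hK : WeightBounds a s σ K) (g : R3 → F) :
    ∫⁻ ξ, ‖g ξ‖ₑ ≤ ENNReal.ofReal K * freqNorm a σ s g := by
  unfold freqNorm
  rw [← lintegral_const_mul' _ _ ENNReal.ofReal_ne_top]
  refine lintegral_mono_ae ?_
  filter_upwards [ae_ne_zero] with ξ hξ
  rw [← mul_assoc, ← ENNReal.ofReal_mul (zero_le_one.trans hK.one_le)]
  have : (1 : ℝ≥0∞) ≤ ENNReal.ofReal (K * weight a σ s ξ) := by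
    simpa using ENNReal.ofReal_le_ofReal (hK.lower ξ hξ)
  calc ‖g ξ‖ₑ = 1 * ‖g ξ‖ₑ := (one_mul _).symm
    _ ≤ _ := by gcongr

theorem WeightBounds.integrable (hK : WeightBounds a s σ K) {g : R3 → F}
    (hg : AEStronglyMeasurable g) (h : freqNorm a σ s g < ∞) : Integrable g :=
  ⟨hg, (hK.lintegral_enorm_le g).trans_lt (ENNReal.mul_lt_top ENNReal.ofReal_lt_top h)⟩

/-- Young's inequality `y ≤ ε y^{2γ} + M`, integrated. -/
theorem freqNorm_add_one_le {γ ε M : ℝ} (hε : 0 ≤ ε) (hM : 0 ≤ M)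
    (hy : ∀ y : ℝ, 0 < y → y ≤ ε * y ^ (2 * γ) + M) {g : R3 → F} (hg : StronglyMeasurable g) :
    freqNorm a σ (s + 1) g ≤ ENNReal.ofReal ε * freqNorm a σ (s + 2 * γ) g
      + ENNReal.ofReal M * freqNorm a σ s g := by
  unfold freqNorm
  rw [← lintegral_const_mul' _ _ ENNReal.ofReal_ne_top,
    ← lintegral_const_mul' _ _ ENNReal.ofReal_ne_top,
    ← lintegral_add_left ((measurable_weight_mul_enorm a σ _ hg).const_mul _)]
  refine lintegral_mono_ae ?_
  filter_upwards [ae_ne_zero] with ξ hξ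
  rw [← mul_assoc, ← mul_assoc, ← add_mul, ← ENNReal.ofReal_mul hε, ← ENNReal.ofReal_mul hM,
    ← ENNReal.ofReal_add (mul_nonneg hε (weight_nonneg _ _ _ _))
      (mul_nonneg hM (weight_nonneg _ _ _ _))]
  gcongr
  rw [weight_add _ _ _ _ hξ, weight_add _ _ _ _ hξ, Real.rpow_one]
  have := weight_nonneg a σ s ξ
  nlinarith [hy ‖ξ‖ (norm_pos_iff.mpr hξ)]

end FreqNorm

/-! ### The Leray symbol and the transport term in frequency -/

/-- The real frequency `ξ` as a complex vector. -/
def cvec (ξ : R3) : C3 := WithLp.toLp 2 fun j => (ξ j : ℂ)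

/-- The bilinear (not Hermitian) product `ξ · v` with a real frequency. -/
def dotC (ξ : R3) (v : C3) : ℂ := ∑ j, (ξ j : ℂ) * v j

/-- The symbol `v ↦ v - (ξ·v) ξ / |ξ|²` of the Leray projector. -/
def leraySymbol (ξ : R3) (v : C3) : C3 := v - (dotC ξ v / (‖ξ‖ ^ 2 : ℝ)) • cvec ξ

theorem norm_cvec (ξ : R3) : ‖cvec ξ‖ = ‖ξ‖ := by
  simp [cvec, EuclideanSpace.norm_eq]

theorem dotC_eq_inner (ξ : R3) (v : C3) : dotC ξ v = inner ℂ (cvec ξ) v := by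
  simp [dotC, cvec, PiLp.inner_apply, mul_comm]

theorem norm_dotC_le (ξ : R3) (v : C3) : ‖dotC ξ v‖ ≤ ‖ξ‖ * ‖v‖ := by
  rw [dotC_eq_inner, ← norm_cvec]
  exact norm_inner_le_norm _ _

theorem dotC_add (ξ : R3) (v w : C3) : dotC ξ (v + w) = dotC ξ v + dotC ξ w := by
  simp [dotC_eq_inner]

theorem dotC_sub (ξ : R3) (v w : C3) : dotC ξ (v - w) = dotC ξ v - dotC ξ w := by
  simp [dotC_eq_inner]

theorem dotC_smul (ξ : R3) (c : ℂ) (v : C3) : dotC ξ (c • v) = c * dotC ξ v := by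
  simp [dotC_eq_inner]

theorem dotC_sub_left (ξ η : R3) (v : C3) : dotC (ξ - η) v = dotC ξ v - dotC η v := by
  simp [dotC, sub_mul]

theorem leraySymbol_eq (ξ : R3) (v : C3) :
    leraySymbol ξ v = v - (ℂ ∙ cvec ξ).starProjection v := by
  rw [Submodule.starProjection_singleton, leraySymbol, dotC_eq_inner, norm_cvec]
  rfl

theorem norm_leraySymbol_le (ξ : R3) (v : C3) : ‖leraySymbol ξ v‖ ≤ ‖v‖ := by
  rw [leraySymbol_eq, ← Submodule.starProjection_orthogonal_val]
  exact Submodule.norm_starProjection_apply_le _ _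

theorem leraySymbol_sub (ξ : R3) (v w : C3) :
    leraySymbol ξ (v - w) = leraySymbol ξ v - leraySymbol ξ w := by
  simp only [leraySymbol_eq, map_sub]
  abel

theorem dotC_leraySymbol (ξ : R3) (v : C3) : dotC ξ (leraySymbol ξ v) = 0 := by
  rw [dotC_eq_inner, leraySymbol_eq, ← Submodule.starProjection_orthogonal_val]
  exact Submodule.inner_right_of_mem_orthogonal (Submodule.mem_span_singleton_self _)
    (Submodule.starProjection_apply_mem _ _)

theorem continuous_cvec : Continuous cvec := by unfold cvec; fun_prop

theorem continuous_dotC : Continuous fun p : R3 × C3 => dotC p.1 p.2 := by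
  unfold dotC; fun_prop

theorem measurable_leraySymbol : Measurable fun p : R3 × C3 => leraySymbol p.1 p.2 := by
  have h1 := continuous_dotC.measurable
  have h2 := continuous_cvec.measurable
  unfold leraySymbol
  fun_prop

section Advection

variable {F : Type*} [NormedAddCommGroup F] [NormedSpace ℂ F]

/-- The Fourier transform of `u·∇w = ∇·(u w)` for divergence free `u`, in terms of the transforms
`U`, `W`: the function `(2π)⁻³ ∫ (i ξ·U(ξ-η)) W(η) dη`. -/
def convAdvection (U : R3 → C3) (W : R3 → F) (ξ : R3) : F :=
  ((((2 * Real.pi) ^ 3)⁻¹ : ℝ) : ℂ) • ∫ η, (Complex.I * dotC ξ (U (ξ - η))) • W η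

theorem stronglyMeasurable_convAdvection {α : Type*} [MeasurableSpace α] {U : α → R3 → C3}
    {W : α → R3 → F} (hU : StronglyMeasurable (Function.uncurry U))
    (hW : StronglyMeasurable (Function.uncurry W)) :
    StronglyMeasurable (Function.uncurry fun t ξ => convAdvection (U t) (W t) ξ) := by
  unfold convAdvection Function.uncurry
  refine StronglyMeasurable.const_smul ?_ _
  refine StronglyMeasurable.integral_prod_right'
    (f := fun q : (α × R3) × R3 =>
      (Complex.I * dotC q.1.2 (U q.1.1 (q.1.2 - q.2))) • W q.1.1 q.2) ?_
  have h1 : StronglyMeasurable fun q : (α × R3) × R3 => U q.1.1 (q.1.2 - q.2) :=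
    hU.comp_measurable (g := fun q : (α × R3) × R3 => (q.1.1, q.1.2 - q.2)) (by fun_prop)
  have h2 : StronglyMeasurable fun q : (α × R3) × R3 => W q.1.1 q.2 :=
    hW.comp_measurable (g := fun q : (α × R3) × R3 => (q.1.1, q.2)) (by fun_prop)
  have h3 : StronglyMeasurable fun q : (α × R3) × R3 => dotC q.1.2 (U q.1.1 (q.1.2 - q.2)) :=
    continuous_dotC.comp_stronglyMeasurable
      ((by fun_prop : Measurable fun q : (α × R3) × R3 => q.1.2).stronglyMeasurable.prodMk h1)
  exact (stronglyMeasurable_const.mul h3).smul h2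

theorem enorm_convAdvection_le (U : R3 → C3) (W : R3 → F) (ξ : R3) :
    ‖convAdvection U W ξ‖ₑ ≤ ENNReal.ofReal ‖ξ‖ * ∫⁻ η, ‖U (ξ - η)‖ₑ * ‖W η‖ₑ := by
  have h1 : ‖((((2 * Real.pi) ^ 3)⁻¹ : ℝ) : ℂ)‖ₑ ≤ 1 := by
    rw [← ofReal_norm, ENNReal.ofReal_le_one, Complex.norm_real, Real.norm_of_nonneg
      (by positivity)]
    refine inv_le_one_of_one_le₀ (one_le_pow₀ ?_)
    linarith [Real.pi_gt_three]
  unfold convAdvection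
  rw [enorm_smul]
  calc _ ≤ 1 * ∫⁻ η, ‖(Complex.I * dotC ξ (U (ξ - η))) • W η‖ₑ := by
        gcongr; exact enorm_integral_le_lintegral_enorm _
    _ ≤ ∫⁻ η, ENNReal.ofReal ‖ξ‖ * (‖U (ξ - η)‖ₑ * ‖W η‖ₑ) := by
        rw [one_mul]
        refine lintegral_mono fun η => ?_
        have : ‖Complex.I‖ₑ = 1 := by simp [← ofReal_norm]
        rw [enorm_smul, enorm_mul, ← mul_assoc, this, one_mul]
        gcongr
        rw [← ofReal_norm, ← ofReal_norm,
          ← ENNReal.ofReal_mul (norm_nonneg _)]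
        exact ENNReal.ofReal_le_ofReal (norm_dotC_le _ _)
    _ = _ := lintegral_const_mul' _ _ ENNReal.ofReal_ne_top

/-- Tonelli's theorem for the convolution of two nonnegative functions. -/
theorem lintegral_lintegral_conv {f g : R3 → ℝ≥0∞} (hf : Measurable f) (hg : Measurable g) :
    ∫⁻ ξ, ∫⁻ η, f (ξ - η) * g η = (∫⁻ ξ, f ξ) * ∫⁻ η, g η := by
  rw [lintegral_lintegral_swap (by fun_prop)]
  have : ∀ η, ∫⁻ ξ, f (ξ - η) * g η = (∫⁻ ξ, f ξ) * g η := fun η => by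
    rw [lintegral_mul_const _ (by fun_prop), lintegral_sub_right_eq_self f η]
  simp_rw [this]
  exact lintegral_const_mul _ hg

variable {a s σ K : ℝ}

/-- The product estimate in the Lei-Lin-Gevrey spaces. -/
theorem WeightBounds.freqNorm_convAdvection_le (hK : WeightBounds a s σ K) {U : R3 → C3}
    {W : R3 → F} (hU : StronglyMeasurable U) (hW : StronglyMeasurable W) :
    freqNorm a σ s (convAdvection U W) ≤ ENNReal.ofReal K *
      (freqNorm a σ (s + 1) U * freqNorm a σ s W + freqNorm a σ s U * freqNorm a σ (s + 1) W) := by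
  set w : ℝ → R3 → ℝ≥0∞ := fun r ξ => ENNReal.ofReal (weight a σ r ξ) with hw
  have hwm : ∀ r, Measurable (w r) := fun r => measurable_ofReal_weight a σ r
  have hUm := hU.enorm
  have hWm := hW.enorm
  have hUr : ∀ r, Measurable fun ξ => w r ξ * ‖U ξ‖ₑ := fun r => (hwm r).mul hUm
  have hWr : ∀ r, Measurable fun ξ => w r ξ * ‖W ξ‖ₑ := fun r => (hwm r).mul hWm
  calc freqNorm a σ s (convAdvection U W)
      ≤ ∫⁻ ξ, ∫⁻ η, ENNReal.ofReal K *
        ((w (s + 1) (ξ - η) * ‖U (ξ - η)‖ₑ) * (w s η * ‖W η‖ₑ)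
          + (w s (ξ - η) * ‖U (ξ - η)‖ₑ) * (w (s + 1) η * ‖W η‖ₑ)) := by
        refine lintegral_mono_ae ?_
        filter_upwards [ae_ne_zero] with ξ hξ
        -- the derivative raises the order of the weight from `s` to `s + 1`
        calc ENNReal.ofReal (weight a σ s ξ) * ‖convAdvection U W ξ‖ₑ
            ≤ ENNReal.ofReal (weight a σ s ξ) *
              (ENNReal.ofReal ‖ξ‖ * ∫⁻ η, ‖U (ξ - η)‖ₑ * ‖W η‖ₑ) := by
              gcongr; exact enorm_convAdvection_le U W ξ
          _ = w (s + 1) ξ * ∫⁻ η, ‖U (ξ - η)‖ₑ * ‖W η‖ₑ := by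
              rw [← mul_assoc, ← ENNReal.ofReal_mul (weight_nonneg _ _ _ _), hw]
              simp only [weight_add _ _ _ _ hξ, Real.rpow_one, mul_comm]
          _ = ∫⁻ η, w (s + 1) ξ * (‖U (ξ - η)‖ₑ * ‖W η‖ₑ) :=
              (lintegral_const_mul' _ _ ENNReal.ofReal_ne_top).symm
          _ ≤ _ := by
              refine lintegral_mono_ae ?_
              have hne : ∀ᵐ η : R3, ξ - η ≠ 0 := by
                have : ∀ᵐ η : R3, η ≠ ξ := by simp [ae_iff]
                filter_upwards [this] with η hη h0
                exact hη (sub_eq_zero.mp h0).symm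
              filter_upwards [ae_ne_zero, hne] with η hη hη'
              have h1 := hK.leibniz (ξ - η) η hη' hη
              rw [sub_add_cancel] at h1
              have h2 : w (s + 1) ξ ≤ ENNReal.ofReal K *
                  (w (s + 1) (ξ - η) * w s η + w s (ξ - η) * w (s + 1) η) := by
                simp only [hw]
                rw [← ENNReal.ofReal_mul (weight_nonneg _ _ _ _),
                  ← ENNReal.ofReal_mul (weight_nonneg _ _ _ _),
                  ← ENNReal.ofReal_add (mul_nonneg (weight_nonneg _ _ _ _) (weight_nonneg _ _ _ _))
                    (mul_nonneg (weight_nonneg _ _ _ _) (weight_nonneg _ _ _ _)),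
                  ← ENNReal.ofReal_mul (zero_le_one.trans hK.one_le)]
                exact ENNReal.ofReal_le_ofReal h1
              calc w (s + 1) ξ * (‖U (ξ - η)‖ₑ * ‖W η‖ₑ)
                  ≤ (ENNReal.ofReal K *
                  (w (s + 1) (ξ - η) * w s η + w s (ξ - η) * w (s + 1) η))
                    * (‖U (ξ - η)‖ₑ * ‖W η‖ₑ) := by gcongr
                _ = _ := by ring
    _ = ENNReal.ofReal K * ((∫⁻ ξ, ∫⁻ η, (w (s + 1) (ξ - η) * ‖U (ξ - η)‖ₑ) * (w s η * ‖W η‖ₑ))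
          + ∫⁻ ξ, ∫⁻ η, (w s (ξ - η) * ‖U (ξ - η)‖ₑ) * (w (s + 1) η * ‖W η‖ₑ)) := by
        rw [← lintegral_add_left, ← lintegral_const_mul' _ _ ENNReal.ofReal_ne_top]
        · refine lintegral_congr fun ξ => ?_
          rw [lintegral_const_mul' _ _ ENNReal.ofReal_ne_top, lintegral_add_left]
          exact ((hUr (s + 1)).comp (measurable_const_sub ξ)).mul (hWr s)
        · exact Measurable.lintegral_prod_right' (f := fun p : R3 × R3 =>
            (w (s + 1) (p.1 - p.2) * ‖U (p.1 - p.2)‖ₑ) * (w s p.2 * ‖W p.2‖ₑ))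
            (((hUr (s + 1)).comp (by fun_prop)).mul ((hWr s).comp (by fun_prop)))
    _ = _ := by
        rw [lintegral_lintegral_conv (hUr (s + 1)) (hWr s),
          lintegral_lintegral_conv (hUr s) (hWr (s + 1))]
        rfl

/-- The integral defining the transport term converges at almost every frequency. -/
theorem ae_integrable_convAdvection {U : R3 → C3} {W : R3 → F} (hU : Integrable U)
    (hW : Integrable W) :
    ∀ᵐ ξ : R3, Integrable fun η => (Complex.I * dotC ξ (U (ξ - η))) • W η := by
  have h1 : Integrable (fun p : R3 × R3 => ‖U (p.1 - p.2)‖ * ‖W p.2‖) (volume.prod volume) := by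
    simpa [mul_comm] using (hW.norm.convolution_integrand (.mul ℝ ℝ) hU.norm)
  have hUa : AEStronglyMeasurable (fun p : R3 × R3 => U (p.1 - p.2)) (volume.prod volume) :=
    hU.aestronglyMeasurable.comp_quasiMeasurePreserving (quasiMeasurePreserving_sub _ _)
  have hWa : AEStronglyMeasurable (fun p : R3 × R3 => W p.2) (volume.prod volume) :=
    hW.aestronglyMeasurable.comp_snd
  have h2 := hUa.prodMk_left
  filter_upwards [h1.prod_right_ae, h2] with ξ hξ hm
  refine (hξ.const_mul ‖ξ‖).mono' ?_ ?_
  · exact ((continuous_dotC.comp_aestronglyMeasurable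
      (aestronglyMeasurable_const.prodMk hm)).const_mul _).smul hW.aestronglyMeasurable
  · refine Filter.Eventually.of_forall fun η => ?_
    rw [norm_smul, norm_mul, Complex.norm_I, one_mul, ← mul_assoc]
    gcongr
    exact norm_dotC_le _ _

/-- Bilinearity; it needs convergent integrals, hence holds only almost everywhere. -/
theorem convAdvection_sub_ae {U U' : R3 → C3} {W W' : R3 → F} (hU : Integrable U)
    (hU' : Integrable U') (hW : Integrable W) (hW' : Integrable W') :
    convAdvection U W - convAdvection U' W' =ᵐ[volume]
      convAdvection (U - U') W + convAdvection U' (W - W') := by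
  filter_upwards [ae_integrable_convAdvection hU hW, ae_integrable_convAdvection hU' hW',
    ae_integrable_convAdvection hU' hW, ae_integrable_convAdvection (hU.sub hU') hW,
    ae_integrable_convAdvection hU' (hW.sub hW')] with ξ h1 h2 h3 h4 h5
  simp only [Pi.sub_apply, Pi.add_apply, convAdvection] at *
  rw [← smul_sub, ← smul_add, ← integral_sub h1 h2, ← integral_add h4 h5]
  congr 1
  refine integral_congr_ae (Filter.Eventually.of_forall fun η => ?_)
  simp only [dotC_sub, smul_sub, mul_sub, sub_smul]
  abel

end Advection

/-! ### Time-dependent norms and Duhamel's formula in frequency -/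

theorem Ioc_subset_Icc_of_le {t T : ℝ} (h : t ≤ T) : Ioc 0 t ⊆ Icc 0 T :=
  Ioc_subset_Icc_self.trans (Icc_subset_Icc_right h)

section TimeNorm

variable {F : Type*} [NormedAddCommGroup F]

/-- The norm of `L¹([0,T]; X^r)` in terms of the Fourier transforms. -/
def timeNorm (a σ r T : ℝ) (G : ℝ → R3 → F) : ℝ≥0∞ := ∫⁻ t in Icc 0 T, freqNorm a σ r (G t)

/-- The norm of `L^∞([0,T]; X^s) ∩ L¹([0,T]; X^{s+2γ})` in terms of the Fourier transforms. -/
def energy (a σ s γ T : ℝ) (U : ℝ → R3 → F) : ℝ≥0∞ :=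
  (⨆ t ∈ Icc 0 T, freqNorm a σ s (U t)) + timeNorm a σ (s + 2 * γ) T U

variable {a σ s r T γ K : ℝ}

theorem measurable_freqNorm {α : Type*} [MeasurableSpace α] {G : α → R3 → F}
    (hG : StronglyMeasurable (Function.uncurry G)) :
    Measurable fun t => freqNorm a σ r (G t) :=
  Measurable.lintegral_prod_right' (f := fun p : α × R3 =>
    ENNReal.ofReal (weight a σ r p.2) * ‖Function.uncurry G p‖ₑ)
    (((measurable_ofReal_weight a σ r).comp measurable_snd).mul hG.enorm)

theorem stronglyMeasurable_of_uncurry {α : Type*} [MeasurableSpace α] {G : α → R3 → F}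
    (hG : StronglyMeasurable (Function.uncurry G)) (t : α) : StronglyMeasurable (G t) :=
  hG.comp_measurable measurable_prodMk_left

theorem freqNorm_le_energy {U : ℝ → R3 → F} {t : ℝ} (ht : t ∈ Icc 0 T) :
    freqNorm a σ s (U t) ≤ energy a σ s γ T U :=
  (le_iSup₂ (f := fun t (_ : t ∈ Icc 0 T) => freqNorm a σ s (U t)) t ht).trans le_self_add

theorem timeNorm_le_energy {U : ℝ → R3 → F} :
    timeNorm a σ (s + 2 * γ) T U ≤ energy a σ s γ T U := le_add_self

theorem timeNorm_congr {G G' : ℝ → R3 → F} (h : ∀ t ∈ Icc 0 T, G t =ᵐ[volume] G' t) :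
    timeNorm a σ r T G = timeNorm a σ r T G' :=
  setLIntegral_congr_fun measurableSet_Icc fun t ht => freqNorm_congr (h t ht)

theorem energy_congr {G G' : ℝ → R3 → F} (h : ∀ t ∈ Icc 0 T, G t =ᵐ[volume] G' t) :
    energy a σ s γ T G = energy a σ s γ T G' := by
  unfold energy
  rw [timeNorm_congr h]
  congr 1
  exact iSup_congr fun t => iSup_congr fun ht => freqNorm_congr (h t ht)

theorem energy_zero : energy a σ s γ T (0 : ℝ → R3 → F) = 0 := by
  simp [energy, timeNorm, freqNorm_zero]

theorem energy_sub_le {U U' : ℝ → R3 → F} (hU : StronglyMeasurable (Function.uncurry U)) :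
    energy a σ s γ T (U - U') ≤ energy a σ s γ T U + energy a σ s γ T U' := by
  unfold energy
  have h1 : timeNorm a σ (s + 2 * γ) T (U - U') ≤
      timeNorm a σ (s + 2 * γ) T U + timeNorm a σ (s + 2 * γ) T U' := by
    unfold timeNorm
    rw [← lintegral_add_left (measurable_freqNorm hU)]
    exact lintegral_mono fun t => freqNorm_sub_le (stronglyMeasurable_of_uncurry hU t)
  have h2 : (⨆ t ∈ Icc 0 T, freqNorm a σ s ((U - U') t)) ≤
      (⨆ t ∈ Icc 0 T, freqNorm a σ s (U t)) + ⨆ t ∈ Icc 0 T, freqNorm a σ s (U' t) := by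
    refine iSup₂_le fun t ht => (freqNorm_sub_le (stronglyMeasurable_of_uncurry hU t)).trans ?_
    gcongr
    · exact le_iSup₂ (f := fun t (_ : t ∈ Icc 0 T) => freqNorm a σ s (U t)) t ht
    · exact le_iSup₂ (f := fun t (_ : t ∈ Icc 0 T) => freqNorm a σ s (U' t)) t ht
  calc _ ≤ _ := add_le_add h2 h1
    _ = _ := by ring

theorem lintegral_freqNorm_le_energy {U : ℝ → R3 → F} :
    timeNorm a σ s T U ≤ ENNReal.ofReal T * energy a σ s γ T U := by
  calc timeNorm a σ s T U ≤ ∫⁻ _ in Icc 0 T, energy a σ s γ T U :=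
        setLIntegral_mono measurable_const fun t ht => freqNorm_le_energy ht
    _ = _ := by simp [mul_comm]

/-- The `L¹([0,T]; X^{s+1})` norm is small against the energy when `ε` and `T` are. -/
theorem timeNorm_add_one_le (hT : 0 ≤ T) {ε M : ℝ} (hε : 0 ≤ ε) (hM : 0 ≤ M)
    (hy : ∀ y : ℝ, 0 < y → y ≤ ε * y ^ (2 * γ) + M) {U : ℝ → R3 → F}
    (hU : StronglyMeasurable (Function.uncurry U)) :
    timeNorm a σ (s + 1) T U ≤ ENNReal.ofReal (ε + M * T) * energy a σ s γ T U := by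
  calc timeNorm a σ (s + 1) T U
      ≤ ∫⁻ t in Icc 0 T, (ENNReal.ofReal ε * freqNorm a σ (s + 2 * γ) (U t)
        + ENNReal.ofReal M * freqNorm a σ s (U t)) :=
        lintegral_mono fun t => freqNorm_add_one_le hε hM hy (stronglyMeasurable_of_uncurry hU t)
    _ = ENNReal.ofReal ε * timeNorm a σ (s + 2 * γ) T U
        + ENNReal.ofReal M * timeNorm a σ s T U := by
        rw [lintegral_add_left ((measurable_freqNorm hU).const_mul _),
          lintegral_const_mul' _ _ ENNReal.ofReal_ne_top,
          lintegral_const_mul' _ _ ENNReal.ofReal_ne_top]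
        rfl
    _ ≤ ENNReal.ofReal ε * energy a σ s γ T U
        + ENNReal.ofReal M * (ENNReal.ofReal T * energy a σ s γ T U) := by
        gcongr
        · exact timeNorm_le_energy
        · exact lintegral_freqNorm_le_energy
    _ = _ := by
        rw [← mul_assoc, ← add_mul, ← ENNReal.ofReal_mul hM,
          ← ENNReal.ofReal_add hε (mul_nonneg hM hT)]

theorem WeightBounds.integrable_uncurry (hK : WeightBounds a s σ K) {G : ℝ → R3 → F}
    (hG : StronglyMeasurable (Function.uncurry G)) (h : timeNorm a σ s T G < ∞) :
    Integrable (Function.uncurry G) ((volume.restrict (Icc 0 T)).prod volume) := by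
  refine ⟨hG.aestronglyMeasurable, ?_⟩
  unfold HasFiniteIntegral
  rw [lintegral_prod _ hG.enorm.aemeasurable]
  refine lt_of_le_of_lt (lintegral_mono fun t => hK.lintegral_enorm_le (G t)) ?_
  rw [lintegral_const_mul' _ _ ENNReal.ofReal_ne_top]
  exact ENNReal.mul_lt_top ENNReal.ofReal_lt_top h

theorem WeightBounds.ae_integrable (hK : WeightBounds a s σ K) {G : ℝ → R3 → F}
    (hG : StronglyMeasurable (Function.uncurry G)) (h : timeNorm a σ s T G < ∞) :
    ∀ᵐ ξ : R3, IntegrableOn (fun t => G t ξ) (Icc 0 T) :=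
  (hK.integrable_uncurry hG h).prod_left_ae

theorem lintegral_weight_mul_time {G : ℝ → R3 → F}
    (hG : StronglyMeasurable (Function.uncurry G)) :
    ∫⁻ ξ, ENNReal.ofReal (weight a σ s ξ) * ∫⁻ τ in Icc 0 T, ‖G τ ξ‖ₑ = timeNorm a σ s T G := by
  unfold timeNorm freqNorm
  rw [lintegral_lintegral_swap]
  · refine lintegral_congr fun ξ => ?_
    rw [lintegral_const_mul' _ _ ENNReal.ofReal_ne_top]
  · exact (((measurable_ofReal_weight a σ s).comp measurable_snd).mul hG.enorm).aemeasurable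

theorem lintegral_weight_mul_add {g : R3 → F} {G : ℝ → R3 → F} (hg : StronglyMeasurable g)
    (hG : StronglyMeasurable (Function.uncurry G)) :
    ∫⁻ ξ, ENNReal.ofReal (weight a σ s ξ) * (‖g ξ‖ₑ + ∫⁻ τ in Icc 0 T, ‖G τ ξ‖ₑ)
      = freqNorm a σ s g + timeNorm a σ s T G := by
  simp_rw [mul_add]
  rw [lintegral_add_left (measurable_weight_mul_enorm a σ s hg), lintegral_weight_mul_time hG]
  rfl

end TimeNorm

section Duhamel

variable {F : Type*} [NormedAddCommGroup F] [NormedSpace ℂ F]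

/-- The symbol `e^{-t|ξ|^{2γ}}` of the fractional heat semigroup. -/
def heatSymbol (γ t : ℝ) (ξ : R3) : ℝ := Real.exp (-t * ‖ξ‖ ^ (2 * γ))

theorem heatSymbol_pos (γ t : ℝ) (ξ : R3) : 0 < heatSymbol γ t ξ := Real.exp_pos _

theorem heatSymbol_le_one (γ : ℝ) {t : ℝ} (ht : 0 ≤ t) (ξ : R3) : heatSymbol γ t ξ ≤ 1 := by
  unfold heatSymbol
  rw [Real.exp_le_one_iff]
  have : 0 ≤ ‖ξ‖ ^ (2 * γ) := by positivity
  nlinarith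

theorem enorm_heatSymbol (γ t : ℝ) (ξ : R3) :
    ‖(heatSymbol γ t ξ : ℂ)‖ₑ = ENNReal.ofReal (heatSymbol γ t ξ) := by
  rw [← ofReal_norm, Complex.norm_real, Real.norm_of_nonneg (heatSymbol_pos _ _ _).le]

theorem enorm_heatSymbol_smul_le (γ : ℝ) {t : ℝ} (ht : 0 ≤ t) (ξ : R3) (v : F) :
    ‖(heatSymbol γ t ξ : ℂ) • v‖ₑ ≤ ‖v‖ₑ := by
  rw [enorm_smul, enorm_heatSymbol]
  calc _ ≤ 1 * ‖v‖ₑ := by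
        gcongr
        rw [ENNReal.ofReal_le_one]
        exact heatSymbol_le_one γ ht ξ
    _ = _ := one_mul _

theorem measurable_heatSymbol (γ : ℝ) : Measurable fun p : ℝ × R3 => heatSymbol γ p.1 p.2 := by
  unfold heatSymbol
  fun_prop

/-- The right-hand side of Duhamel's formula in frequency, with initial datum `g` and force `G`. -/
def duhamel (γ : ℝ) (g : R3 → F) (G : ℝ → R3 → F) (t : ℝ) (ξ : R3) : F :=
  (heatSymbol γ t ξ : ℂ) • g ξ + ∫ τ in Ioc 0 t, (heatSymbol γ (t - τ) ξ : ℂ) • G τ ξ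

variable {a s σ r T γ K : ℝ} {g : R3 → F} {G G' : ℝ → R3 → F}

theorem stronglyMeasurable_duhamel (hg : StronglyMeasurable g)
    (hG : StronglyMeasurable (Function.uncurry G)) :
    StronglyMeasurable (Function.uncurry (duhamel γ g G)) := by
  have hh : StronglyMeasurable fun p : ℝ × R3 => (heatSymbol γ p.1 p.2 : ℂ) :=
    (Complex.measurable_ofReal.comp (measurable_heatSymbol γ)).stronglyMeasurable
  refine (hh.smul (hg.comp_measurable measurable_snd)).add ?_
  have h1 : ∀ p : ℝ × R3, (∫ τ in Ioc 0 p.1, (heatSymbol γ (p.1 - τ) p.2 : ℂ) • G τ p.2) =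
      ∫ τ, {q : (ℝ × R3) × ℝ | q.2 ∈ Ioc 0 q.1.1}.indicator
        (fun q => (heatSymbol γ (q.1.1 - q.2) q.1.2 : ℂ) • G q.2 q.1.2) (p, τ) := fun p => by
    rw [← integral_indicator measurableSet_Ioc]
    rfl
  simp_rw [h1]
  refine StronglyMeasurable.integral_prod_right' (StronglyMeasurable.indicator ?_ ?_)
  · exact (hh.comp_measurable (g := fun q : (ℝ × R3) × ℝ => (q.1.1 - q.2, q.1.2))
      (by fun_prop)).smul (hG.comp_measurable (g := fun q : (ℝ × R3) × ℝ => (q.2, q.1.2))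
      (by fun_prop))
  · exact (measurableSet_lt measurable_const measurable_snd).inter
      (measurableSet_le measurable_snd (measurable_fst.comp measurable_fst))

theorem enorm_duhamel_le {t : ℝ} (ht : t ∈ Icc 0 T) (ξ : R3) :
    ‖duhamel γ g G t ξ‖ₑ ≤ ‖g ξ‖ₑ + ∫⁻ τ in Icc 0 T, ‖G τ ξ‖ₑ := by
  refine (enorm_add_le _ _).trans (add_le_add (enorm_heatSymbol_smul_le γ ht.1 ξ _) ?_)
  refine (enorm_integral_le_lintegral_enorm _).trans ?_
  calc ∫⁻ τ in Ioc 0 t, ‖(heatSymbol γ (t - τ) ξ : ℂ) • G τ ξ‖ₑ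
      ≤ ∫⁻ τ in Ioc 0 t, ‖G τ ξ‖ₑ := by
        refine lintegral_mono_ae ?_
        filter_upwards [ae_restrict_mem measurableSet_Ioc] with τ hτ
        exact enorm_heatSymbol_smul_le γ (sub_nonneg.mpr hτ.2) ξ _
    _ ≤ _ := lintegral_mono_set (Ioc_subset_Icc_of_le ht.2)

theorem freqNorm_duhamel_le (hg : StronglyMeasurable g)
    (hG : StronglyMeasurable (Function.uncurry G)) {t : ℝ} (ht : t ∈ Icc 0 T) :
    freqNorm a σ s (duhamel γ g G t) ≤ freqNorm a σ s g + timeNorm a σ s T G := by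
  rw [← lintegral_weight_mul_add hg hG]
  unfold freqNorm
  gcongr with ξ
  exact enorm_duhamel_le ht ξ

/-- The heat kernel is integrable in time, uniformly in the frequency. -/
theorem lintegral_exp_decay_le {b : ℝ} (hb : 0 < b) (τ : ℝ) :
    ∫⁻ t in Ioi τ, ENNReal.ofReal (b * Real.exp (-(t - τ) * b)) ≤ 1 := by
  have h1 : ∀ t, b * Real.exp (-(t - τ) * b) = b * Real.exp (τ * b) * Real.exp (-b * t) := by
    intro t
    rw [mul_assoc, ← Real.exp_add]
    congr 2
    ring
  simp_rw [h1]
  rw [← ofReal_integral_eq_lintegral_ofReal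
    ((integrableOn_exp_mul_Ioi (by linarith : -b < 0) τ).const_mul _)
    (Filter.Eventually.of_forall fun t => by positivity), integral_const_mul,
    integral_exp_mul_Ioi (by linarith)]
  refine (ENNReal.ofReal_le_ofReal (le_of_eq ?_)).trans_eq ENNReal.ofReal_one
  rw [neg_mul, neg_div_neg_eq, Real.exp_neg, mul_comm b τ]
  field_simp

/-- Maximal regularity in `L¹`, at a fixed frequency. -/
theorem lintegral_rpow_mul_enorm_duhamel_le (hG : StronglyMeasurable (Function.uncurry G))
    {ξ : R3} (hξ : ξ ≠ 0) :
    ∫⁻ t in Icc 0 T, ENNReal.ofReal (‖ξ‖ ^ (2 * γ)) * ‖duhamel γ g G t ξ‖ₑ ≤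
      ‖g ξ‖ₑ + ∫⁻ τ in Icc 0 T, ‖G τ ξ‖ₑ := by
  have hn := norm_pos_iff.mpr hξ
  set b := ‖ξ‖ ^ (2 * γ) with hb
  have hb0 : 0 < b := by positivity
  have hGξ : Measurable fun τ => ‖G τ ξ‖ₑ :=
    (hG.comp_measurable (measurable_prodMk_right (y := ξ))).enorm
  -- the kernel `b e^{-(t-τ) b}`, `τ < t`, of mass at most one in `t` for each `τ`
  set κ : ℝ → ℝ → ℝ≥0∞ := fun t τ => (Ioi τ).indicator
    (fun t => ENNReal.ofReal (b * Real.exp (-(t - τ) * b))) t with hκ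
  have hκm : Measurable (Function.uncurry κ) := by
    have : Function.uncurry κ = {p : ℝ × ℝ | p.2 < p.1}.indicator
        (fun p => ENNReal.ofReal (b * Real.exp (-(p.1 - p.2) * b))) := rfl
    rw [this]
    exact Measurable.indicator (by fun_prop) (measurableSet_lt measurable_snd measurable_fst)
  have hκ1 : ∀ τ, ∫⁻ t, κ t τ ≤ 1 := fun τ => by
    rw [hκ, lintegral_indicator measurableSet_Ioi]
    exact lintegral_exp_decay_le hb0 τ
  -- the initial datum enters like a force concentrated at time `0`
  have key : ∀ t ∈ Icc 0 T, ENNReal.ofReal b * ‖duhamel γ g G t ξ‖ₑ ≤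
      ENNReal.ofReal (b * Real.exp (-(t - 0) * b)) * ‖g ξ‖ₑ
        + ∫⁻ τ in Icc 0 T, κ t τ * ‖G τ ξ‖ₑ := fun t ht => by
    calc ENNReal.ofReal b * ‖duhamel γ g G t ξ‖ₑ
        ≤ ENNReal.ofReal b * (‖(heatSymbol γ t ξ : ℂ) • g ξ‖ₑ
          + ∫⁻ τ in Ioc 0 t, ‖(heatSymbol γ (t - τ) ξ : ℂ) • G τ ξ‖ₑ) := by
          gcongr
          exact (enorm_add_le _ _).trans (by gcongr; exact enorm_integral_le_lintegral_enorm _)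
      _ = ENNReal.ofReal (b * Real.exp (-(t - 0) * b)) * ‖g ξ‖ₑ
          + ∫⁻ τ in Ioc 0 t, ENNReal.ofReal (b * Real.exp (-(t - τ) * b)) * ‖G τ ξ‖ₑ := by
          rw [mul_add, ← lintegral_const_mul' _ _ ENNReal.ofReal_ne_top]
          simp_rw [enorm_smul, enorm_heatSymbol, ← mul_assoc, ← ENNReal.ofReal_mul hb0.le]
          rw [sub_zero]
          rfl
      _ ≤ _ := by
          refine add_le_add le_rfl ?_
          rw [← setLIntegral_congr Ioo_ae_eq_Ioc]
          calc ∫⁻ τ in Ioo 0 t, ENNReal.ofReal (b * Real.exp (-(t - τ) * b)) * ‖G τ ξ‖ₑ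
              = ∫⁻ τ in Ioo 0 t, κ t τ * ‖G τ ξ‖ₑ := by
                refine setLIntegral_congr_fun measurableSet_Ioo fun τ hτ => ?_
                simp only [hκ]
                rw [indicator_of_mem (show t ∈ Ioi τ from hτ.2)]
            _ ≤ _ := lintegral_mono_set
              (Ioo_subset_Ioc_self.trans (Ioc_subset_Icc_of_le ht.2))
  calc ∫⁻ t in Icc 0 T, ENNReal.ofReal b * ‖duhamel γ g G t ξ‖ₑ
      ≤ ∫⁻ t in Icc 0 T, (ENNReal.ofReal (b * Real.exp (-(t - 0) * b)) * ‖g ξ‖ₑ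
        + ∫⁻ τ in Icc 0 T, κ t τ * ‖G τ ξ‖ₑ) := by
        refine lintegral_mono_ae ?_
        filter_upwards [ae_restrict_mem measurableSet_Icc] with t ht using key t ht
    _ = (∫⁻ t in Icc 0 T, ENNReal.ofReal (b * Real.exp (-(t - 0) * b))) * ‖g ξ‖ₑ
        + ∫⁻ τ in Icc 0 T, (∫⁻ t in Icc 0 T, κ t τ) * ‖G τ ξ‖ₑ := by
        rw [lintegral_add_left (by fun_prop), lintegral_mul_const _ (by fun_prop),
          lintegral_lintegral_swap (hκm.mul (hGξ.comp measurable_snd)).aemeasurable]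
        congr 1
        refine lintegral_congr fun τ => ?_
        exact lintegral_mul_const _ (hκm.comp (measurable_prodMk_right (y := τ)))
    _ ≤ 1 * ‖g ξ‖ₑ + ∫⁻ τ in Icc 0 T, 1 * ‖G τ ξ‖ₑ := by
        gcongr with τ
        · rw [← setLIntegral_congr Ioc_ae_eq_Icc]
          exact (lintegral_mono_set fun t ht => ht.1).trans (lintegral_exp_decay_le hb0 0)
        · exact (setLIntegral_le_lintegral _ _).trans (hκ1 τ)
    _ = _ := by simp

theorem timeNorm_duhamel_le (hg : StronglyMeasurable g)
    (hG : StronglyMeasurable (Function.uncurry G)) :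
    timeNorm a σ (s + 2 * γ) T (duhamel γ g G) ≤ freqNorm a σ s g + timeNorm a σ s T G := by
  rw [← lintegral_weight_mul_add hg hG]
  unfold timeNorm freqNorm
  rw [lintegral_lintegral_swap]
  · refine lintegral_mono_ae ?_
    filter_upwards [ae_ne_zero] with ξ hξ
    have h1 : ∀ t, ENNReal.ofReal (weight a σ (s + 2 * γ) ξ) * ‖duhamel γ g G t ξ‖ₑ =
        ENNReal.ofReal (weight a σ s ξ) *
          (ENNReal.ofReal (‖ξ‖ ^ (2 * γ)) * ‖duhamel γ g G t ξ‖ₑ) := fun t => by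
      rw [weight_add _ _ _ _ hξ, ← mul_assoc, ← ENNReal.ofReal_mul (weight_nonneg _ _ _ _),
        mul_comm (weight a σ s ξ)]
    simp_rw [h1]
    rw [lintegral_const_mul' _ _ ENNReal.ofReal_ne_top]
    gcongr
    exact lintegral_rpow_mul_enorm_duhamel_le hG hξ
  · exact (((measurable_ofReal_weight a σ _).comp measurable_snd).mul
      (stronglyMeasurable_duhamel hg hG).enorm).aemeasurable

/-- Duhamel's operator is bounded from data and forces to the energy space. -/
theorem energy_duhamel_le (hg : StronglyMeasurable g)
    (hG : StronglyMeasurable (Function.uncurry G)) :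
    energy a σ s γ T (duhamel γ g G) ≤ 2 * (freqNorm a σ s g + timeNorm a σ s T G) := by
  rw [two_mul]
  exact add_le_add (iSup₂_le fun t ht => freqNorm_duhamel_le hg hG ht) (timeNorm_duhamel_le hg hG)

theorem integrableOn_heatSymbol_smul {ξ : R3} (h : IntegrableOn (fun τ => G τ ξ) (Icc 0 T)) {t : ℝ}
    (ht : t ∈ Icc 0 T) :
    IntegrableOn (fun τ => (heatSymbol γ (t - τ) ξ : ℂ) • G τ ξ) (Ioc 0 t) := by
  have h1 : IntegrableOn (fun τ => G τ ξ) (Ioc 0 t) :=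
    h.mono_set (Ioc_subset_Icc_of_le ht.2)
  refine Integrable.mono h1 ?_ ?_
  · refine AEStronglyMeasurable.smul ?_ h1.aestronglyMeasurable
    have : Measurable fun τ => (heatSymbol γ (t - τ) ξ : ℂ) :=
      Complex.measurable_ofReal.comp ((measurable_heatSymbol γ).comp
        (by fun_prop : Measurable fun τ : ℝ => (t - τ, ξ)))
    exact this.aestronglyMeasurable
  · filter_upwards [ae_restrict_mem measurableSet_Ioc] with τ hτ
    rw [← enorm_le_iff_norm_le]
    exact enorm_heatSymbol_smul_le γ (sub_nonneg.mpr hτ.2) ξ _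

theorem WeightBounds.duhamel_sub_ae (hK : WeightBounds a s σ K)
    (hG : StronglyMeasurable (Function.uncurry G)) (hG' : StronglyMeasurable (Function.uncurry G'))
    (h : timeNorm a σ s T G < ∞) (h' : timeNorm a σ s T G' < ∞) {t : ℝ} (ht : t ∈ Icc 0 T) :
    duhamel γ g G t - duhamel γ g G' t =ᵐ[volume] duhamel γ 0 (G - G') t := by
  filter_upwards [hK.ae_integrable hG h, hK.ae_integrable hG' h'] with ξ h1 h2
  simp only [Pi.sub_apply, duhamel, Pi.zero_apply, smul_zero, zero_add, smul_sub]
  rw [integral_sub (integrableOn_heatSymbol_smul h1 ht) (integrableOn_heatSymbol_smul h2 ht)]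
  abel

/-- For equal data, the difference of two solutions is controlled by that of the forces. -/
theorem WeightBounds.energy_duhamel_sub_le (hK : WeightBounds a s σ K)
    (hG : StronglyMeasurable (Function.uncurry G)) (hG' : StronglyMeasurable (Function.uncurry G'))
    (h : timeNorm a σ s T G < ∞) (h' : timeNorm a σ s T G' < ∞) :
    energy a σ s γ T (duhamel γ g G - duhamel γ g G') ≤ 2 * timeNorm a σ s T (G - G') := by
  rw [energy_congr (G := duhamel γ g G - duhamel γ g G') (G' := duhamel γ 0 (G - G'))
    fun t ht => hK.duhamel_sub_ae hG hG' h h' ht]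
  refine (energy_duhamel_le (g := (0 : R3 → F)) (G := G - G') stronglyMeasurable_const
    (hG.sub hG')).trans_eq ?_
  rw [freqNorm_zero, zero_add]

/-- Duhamel's integral only depends on the force up to null sets of space-time. -/
theorem duhamel_congr_ae {t : ℝ} (ht : t ∈ Icc 0 T)
    (h : ∀ᵐ ξ : R3, ∀ᵐ τ ∂(volume.restrict (Icc 0 T)), G τ ξ = G' τ ξ) :
    duhamel γ g G t =ᵐ[volume] duhamel γ g G' t := by
  filter_upwards [h] with ξ hξ
  unfold duhamel
  congr 1
  refine integral_congr_ae ?_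
  have : ∀ᵐ τ ∂(volume.restrict (Ioc 0 t)), G τ ξ = G' τ ξ :=
    ae_restrict_of_ae_restrict_of_subset (Ioc_subset_Icc_of_le ht.2) hξ
  filter_upwards [this] with τ hτ
  rw [hτ]

end Duhamel

/-! ### The system in frequency: contraction estimates -/

section

/-- Young's inequality `y ≤ ε y^{2γ} + M`, which bounds the order `s + 1` by the orders `s + 2γ`
and `s`. -/
structure YoungBound (γ ε M : ℝ) : Prop where
  eps_nonneg : 0 ≤ ε
  const_nonneg : 0 ≤ M
  le : ∀ y : ℝ, 0 < y → y ≤ ε * y ^ (2 * γ) + M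

/-- The force in the equation of the velocity, in frequency. -/
def forceU (U : R3 → C3) (Θ : R3 → ℂ) (ξ : R3) : C3 :=
  -leraySymbol ξ (convAdvection U U ξ) + leraySymbol ξ (Θ ξ • (EuclideanSpace.single 2 1 : C3))

/-- The force in the equation of the temperature, in frequency. -/
def forceΘ (U : R3 → C3) (Θ : R3 → ℂ) (ξ : R3) : ℂ := -convAdvection U Θ ξ

theorem stronglyMeasurable_leraySymbol {α : Type*} [MeasurableSpace α] {f : α × R3 → C3}
    (hf : StronglyMeasurable f) : StronglyMeasurable fun p : α × R3 => leraySymbol p.2 (f p) :=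
  (measurable_leraySymbol.comp (measurable_snd.prodMk hf.measurable)).stronglyMeasurable

section

variable {α : Type*} [MeasurableSpace α] {U : α → R3 → C3} {Θ : α → R3 → ℂ}

theorem stronglyMeasurable_forceU (hU : StronglyMeasurable (Function.uncurry U))
    (hΘ : StronglyMeasurable (Function.uncurry Θ)) :
    StronglyMeasurable (Function.uncurry fun t => forceU (U t) (Θ t)) :=
  (stronglyMeasurable_leraySymbol (stronglyMeasurable_convAdvection hU hU)).neg.add
    (stronglyMeasurable_leraySymbol (hΘ.smul_const _))

theorem stronglyMeasurable_forceΘ (hU : StronglyMeasurable (Function.uncurry U))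
    (hΘ : StronglyMeasurable (Function.uncurry Θ)) :
    StronglyMeasurable (Function.uncurry fun t => forceΘ (U t) (Θ t)) :=
  (stronglyMeasurable_convAdvection hU hΘ).neg

end

variable {a s σ K T ε M α β γ γ' : ℝ}

section

variable {F : Type*} [NormedAddCommGroup F] [NormedSpace ℂ F]

theorem WeightBounds.timeNorm_convAdvection_le (hK : WeightBounds a s σ K) (hT : 0 ≤ T)
    (hγ : YoungBound γ ε M) (hγ' : YoungBound γ' ε M) {U : ℝ → R3 → C3} {W : ℝ → R3 → F}
    (hU : StronglyMeasurable (Function.uncurry U)) (hW : StronglyMeasurable (Function.uncurry W)) :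
    timeNorm a σ s T (fun t => convAdvection (U t) (W t)) ≤
      ENNReal.ofReal (2 * K * (ε + M * T)) * (energy a σ s γ T U * energy a σ s γ' T W) := by
  set EU := energy a σ s γ T U
  set EW := energy a σ s γ' T W
  have hκ : 0 ≤ ε + M * T := add_nonneg hγ.eps_nonneg (mul_nonneg hγ.const_nonneg hT)
  calc timeNorm a σ s T (fun t => convAdvection (U t) (W t))
      ≤ ∫⁻ t in Icc 0 T, ENNReal.ofReal K * (freqNorm a σ (s + 1) (U t) * EW
        + EU * freqNorm a σ (s + 1) (W t)) := by
        refine setLIntegral_mono' measurableSet_Icc fun t ht => ?_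
        refine (hK.freqNorm_convAdvection_le (stronglyMeasurable_of_uncurry hU t)
          (stronglyMeasurable_of_uncurry hW t)).trans ?_
        gcongr
        · exact freqNorm_le_energy ht
        · exact freqNorm_le_energy ht
    _ = ENNReal.ofReal K * (timeNorm a σ (s + 1) T U * EW + EU * timeNorm a σ (s + 1) T W) := by
        rw [lintegral_const_mul' _ _ ENNReal.ofReal_ne_top,
          lintegral_add_left ((measurable_freqNorm hU).mul_const _),
          lintegral_mul_const _ (measurable_freqNorm hU),
          lintegral_const_mul _ (measurable_freqNorm hW)]
        rfl
    _ ≤ ENNReal.ofReal K * ((ENNReal.ofReal (ε + M * T) * EU) * EW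
          + EU * (ENNReal.ofReal (ε + M * T) * EW)) := by
        gcongr
        · exact timeNorm_add_one_le hT hγ.eps_nonneg hγ.const_nonneg hγ.le hU
        · exact timeNorm_add_one_le hT hγ'.eps_nonneg hγ'.const_nonneg hγ'.le hW
    _ = _ := by
        rw [ENNReal.ofReal_mul (mul_nonneg zero_le_two (zero_le_one.trans hK.one_le)),
          ENNReal.ofReal_mul zero_le_two, ENNReal.ofReal_ofNat]
        ring

omit [NormedSpace ℂ F] in
theorem WeightBounds.integrable_of_energy (hK : WeightBounds a s σ K) {U : ℝ → R3 → F}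
    (hU : StronglyMeasurable (Function.uncurry U)) (h : energy a σ s γ T U < ∞) {t : ℝ}
    (ht : t ∈ Icc 0 T) : Integrable (U t) :=
  hK.integrable (stronglyMeasurable_of_uncurry hU t).aestronglyMeasurable
    ((freqNorm_le_energy ht).trans_lt h)

/-- The difference of two transport terms, in `L¹([0,T]; X^s)`. -/
theorem WeightBounds.timeNorm_convAdvection_sub_le (hK : WeightBounds a s σ K) (hT : 0 ≤ T)
    (hγ : YoungBound γ ε M) (hγ' : YoungBound γ' ε M) {U U' : ℝ → R3 → C3} {W W' : ℝ → R3 → F}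
    (hU : StronglyMeasurable (Function.uncurry U)) (hU' : StronglyMeasurable (Function.uncurry U'))
    (hW : StronglyMeasurable (Function.uncurry W)) (hW' : StronglyMeasurable (Function.uncurry W'))
    (eU : energy a σ s γ T U < ∞) (eU' : energy a σ s γ T U' < ∞) (eW : energy a σ s γ' T W < ∞)
    (eW' : energy a σ s γ' T W' < ∞) :
    timeNorm a σ s T (fun t => convAdvection (U t) (W t) - convAdvection (U' t) (W' t)) ≤
      ENNReal.ofReal (2 * K * (ε + M * T)) * (energy a σ s γ T (U - U') * energy a σ s γ' T W
        + energy a σ s γ T U' * energy a σ s γ' T (W - W')) := by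
  have h1 := hU.sub hU'
  have h2 := hW.sub hW'
  have m1 := stronglyMeasurable_convAdvection (U := U - U') h1 hW
  rw [timeNorm_congr (G' := fun t => convAdvection (U t - U' t) (W t)
      + convAdvection (U' t) (W t - W' t)) fun t ht => convAdvection_sub_ae
      (hK.integrable_of_energy hU eU ht) (hK.integrable_of_energy hU' eU' ht)
      (hK.integrable_of_energy hW eW ht) (hK.integrable_of_energy hW' eW' ht)]
  calc _ ≤ ∫⁻ t in Icc 0 T, (freqNorm a σ s (convAdvection ((U - U') t) (W t))
        + freqNorm a σ s (convAdvection (U' t) ((W - W') t))) :=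
        lintegral_mono fun t => freqNorm_add_le (stronglyMeasurable_of_uncurry m1 t)
    _ = timeNorm a σ s T (fun t => convAdvection ((U - U') t) (W t))
        + timeNorm a σ s T (fun t => convAdvection (U' t) ((W - W') t)) :=
        lintegral_add_left (measurable_freqNorm m1) _
    _ ≤ _ := by
        rw [mul_add]
        exact add_le_add (hK.timeNorm_convAdvection_le hT hγ hγ' h1 hW)
          (hK.timeNorm_convAdvection_le hT hγ hγ' hU' h2)

end

/-- The total norm of a pair (velocity, temperature). -/
def totalEnergy (a σ s α β T : ℝ) (U : ℝ → R3 → C3) (Θ : ℝ → R3 → ℂ) : ℝ≥0∞ :=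
  energy a σ s α T U + energy a σ s β T Θ

/-- The `L¹([0,T]; X^s)` norm of the difference of the forces of two states. -/
def forceDiff (a σ s T : ℝ) (U U' : ℝ → R3 → C3) (Θ Θ' : ℝ → R3 → ℂ) : ℝ≥0∞ :=
  timeNorm a σ s T ((fun t => forceU (U t) (Θ t)) - fun t => forceU (U' t) (Θ' t))
    + timeNorm a σ s T ((fun t => forceΘ (U t) (Θ t)) - fun t => forceΘ (U' t) (Θ' t))

theorem norm_single_two : ‖(EuclideanSpace.single 2 1 : C3)‖ₑ = 1 := by
  simp [← ofReal_norm]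

theorem enorm_leraySymbol_le (ξ : R3) (v : C3) : ‖leraySymbol ξ v‖ₑ ≤ ‖v‖ₑ := by
  rw [enorm_le_iff_norm_le]
  exact norm_leraySymbol_le ξ v

theorem enorm_forceU_sub_le (U U' : R3 → C3) (Θ Θ' : R3 → ℂ) (ξ : R3) :
    ‖forceU U Θ ξ - forceU U' Θ' ξ‖ₑ ≤
      ‖convAdvection U U ξ - convAdvection U' U' ξ‖ₑ + ‖Θ ξ - Θ' ξ‖ₑ := by
  have h : forceU U Θ ξ - forceU U' Θ' ξ =
      -leraySymbol ξ (convAdvection U U ξ - convAdvection U' U' ξ)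
        + leraySymbol ξ ((Θ ξ - Θ' ξ) • (EuclideanSpace.single 2 1 : C3)) := by
    rw [leraySymbol_sub, sub_smul, leraySymbol_sub, forceU, forceU]
    abel
  rw [h]
  refine (enorm_add_le _ _).trans (add_le_add ?_ ?_)
  · rw [enorm_neg]
    exact enorm_leraySymbol_le _ _
  · refine (enorm_leraySymbol_le _ _).trans_eq ?_
    rw [enorm_smul, norm_single_two, mul_one]

/-- The forces are Lipschitz on bounded sets of states: the constant of the transport
terms is proportional to `ε + M T`, that of the buoyancy is `T`. -/
theorem WeightBounds.forceDiff_le (hK : WeightBounds a s σ K) (hT : 0 ≤ T)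
    (hα : YoungBound α ε M) (hβ : YoungBound β ε M) {U U' : ℝ → R3 → C3} {Θ Θ' : ℝ → R3 → ℂ}
    (hU : StronglyMeasurable (Function.uncurry U)) (hU' : StronglyMeasurable (Function.uncurry U'))
    (hΘ : StronglyMeasurable (Function.uncurry Θ)) (hΘ' : StronglyMeasurable (Function.uncurry Θ'))
    (e : totalEnergy a σ s α β T U Θ < ∞) (e' : totalEnergy a σ s α β T U' Θ' < ∞) :
    forceDiff a σ s T U U' Θ Θ' ≤ (ENNReal.ofReal (2 * K * (ε + M * T)) *
      (totalEnergy a σ s α β T U Θ + totalEnergy a σ s α β T U' Θ') + ENNReal.ofReal T)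
        * totalEnergy a σ s α β T (U - U') (Θ - Θ') := by
  set B := ENNReal.ofReal (2 * K * (ε + M * T))
  obtain ⟨eU, eΘ⟩ := ENNReal.add_lt_top.mp e
  obtain ⟨eU', eΘ'⟩ := ENNReal.add_lt_top.mp e'
  have hu : timeNorm a σ s T ((fun t => forceU (U t) (Θ t)) - fun t => forceU (U' t) (Θ' t)) ≤
      B * (energy a σ s α T (U - U') * energy a σ s α T U
        + energy a σ s α T U' * energy a σ s α T (U - U'))
        + ENNReal.ofReal T * energy a σ s β T (Θ - Θ') := by
    have m1 := (stronglyMeasurable_convAdvection hU hU).sub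
      (stronglyMeasurable_convAdvection hU' hU')
    have m1' : StronglyMeasurable (Function.uncurry fun t =>
      convAdvection (U t) (U t) - convAdvection (U' t) (U' t)) := m1
    calc _ ≤ ∫⁻ t in Icc 0 T, (freqNorm a σ s (convAdvection (U t) (U t)
            - convAdvection (U' t) (U' t)) + freqNorm a σ s ((Θ - Θ') t)) := by
          refine lintegral_mono fun t => ?_
          unfold freqNorm
          rw [← lintegral_add_left (measurable_weight_mul_enorm a σ s
            (stronglyMeasurable_of_uncurry m1' t))]
          refine lintegral_mono fun ξ => ?_
          rw [← mul_add]
          gcongr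
          exact enorm_forceU_sub_le _ _ _ _ _
      _ = timeNorm a σ s T (fun t => convAdvection (U t) (U t) - convAdvection (U' t) (U' t))
          + timeNorm a σ s T (Θ - Θ') := lintegral_add_left (measurable_freqNorm m1') _
      _ ≤ _ := add_le_add
          (hK.timeNorm_convAdvection_sub_le hT hα hα hU hU' hU hU' eU eU' eU eU')
          lintegral_freqNorm_le_energy
  have hθ : timeNorm a σ s T ((fun t => forceΘ (U t) (Θ t)) - fun t => forceΘ (U' t) (Θ' t)) ≤
      B * (energy a σ s α T (U - U') * energy a σ s β T Θ
        + energy a σ s α T U' * energy a σ s β T (Θ - Θ')) := by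
    refine le_trans (le_of_eq ?_)
      (hK.timeNorm_convAdvection_sub_le hT hα hβ hU hU' hΘ hΘ' eU eU' eΘ eΘ')
    unfold timeNorm freqNorm
    refine lintegral_congr fun t => lintegral_congr fun ξ => ?_
    simp only [Pi.sub_apply, forceΘ]
    rw [neg_sub_neg, enorm_sub_rev]
  unfold forceDiff totalEnergy
  refine (add_le_add hu hθ).trans ?_
  set du := energy a σ s α T (U - U')
  set dθ := energy a σ s β T (Θ - Θ')
  set x := energy a σ s α T U
  set y := energy a σ s β T Θ
  set x' := energy a σ s α T U'
  set y' := energy a σ s β T Θ'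
  -- the right-hand side is a product of sums; the added terms complete it
  calc _ ≤ B * (du * x + x' * du) + ENNReal.ofReal T * dθ + B * (du * y + x' * dθ)
        + (B * (dθ * x + dθ * y + du * y' + dθ * y') + ENNReal.ofReal T * du) := le_self_add
    _ = _ := by ring

/-- The smallness conditions under which the system is a contraction on states of total norm at
most `C`. -/
structure Small (K ε M T C : ℝ) : Prop where
  time_nonneg : 0 ≤ T
  time_le : T ≤ 1 / 16
  mul_le : 2 * K * (ε + M * T) * C ≤ 1 / 32

section Small

variable {C : ℝ} {U U' : ℝ → R3 → C3} {Θ Θ' : ℝ → R3 → ℂ}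

/-- The contraction estimate. -/
theorem WeightBounds.forceDiff_le_of_small (hK : WeightBounds a s σ K) (hS : Small K ε M T C)
    (hα : YoungBound α ε M) (hβ : YoungBound β ε M)
    (hU : StronglyMeasurable (Function.uncurry U)) (hU' : StronglyMeasurable (Function.uncurry U'))
    (hΘ : StronglyMeasurable (Function.uncurry Θ)) (hΘ' : StronglyMeasurable (Function.uncurry Θ'))
    (e : totalEnergy a σ s α β T U Θ ≤ ENNReal.ofReal C)
    (e' : totalEnergy a σ s α β T U' Θ' ≤ ENNReal.ofReal C) :
    forceDiff a σ s T U U' Θ Θ' ≤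
      ENNReal.ofReal (1 / 8) * totalEnergy a σ s α β T (U - U') (Θ - Θ') := by
  refine (hK.forceDiff_le hS.time_nonneg hα hβ hU hU' hΘ hΘ' (e.trans_lt ENNReal.ofReal_lt_top)
    (e'.trans_lt ENNReal.ofReal_lt_top)).trans ?_
  have hB : 0 ≤ 2 * K * (ε + M * T) := mul_nonneg (by linarith [hK.one_le])
    (add_nonneg hα.eps_nonneg (mul_nonneg hα.const_nonneg hS.time_nonneg))
  gcongr
  calc _ ≤ ENNReal.ofReal (2 * K * (ε + M * T)) * (ENNReal.ofReal C + ENNReal.ofReal C)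
        + ENNReal.ofReal T := by gcongr
    _ = ENNReal.ofReal (2 * K * (ε + M * T) * C) + ENNReal.ofReal (2 * K * (ε + M * T) * C)
        + ENNReal.ofReal T := by rw [mul_add, ENNReal.ofReal_mul hB]
    _ ≤ ENNReal.ofReal (1 / 32) + ENNReal.ofReal (1 / 32) + ENNReal.ofReal (1 / 16) := by
        gcongr
        · exact hS.mul_le
        · exact hS.mul_le
        · exact hS.time_le
    _ = _ := by
        rw [← ENNReal.ofReal_add (by norm_num) (by norm_num),
          ← ENNReal.ofReal_add (by norm_num) (by norm_num)]
        norm_num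

theorem convAdvection_zero {F : Type*} [NormedAddCommGroup F] [NormedSpace ℂ F] :
    convAdvection (0 : R3 → C3) (0 : R3 → F) = 0 := by
  funext ξ
  simp [convAdvection]

theorem leraySymbol_zero (ξ : R3) : leraySymbol ξ 0 = 0 := by simp [leraySymbol_eq]

theorem forceU_zero : forceU 0 0 = 0 := by
  funext ξ
  simp [forceU, convAdvection_zero, leraySymbol_zero]

theorem forceΘ_zero : forceΘ 0 0 = 0 := by
  funext ξ
  simp [forceΘ, convAdvection_zero]

theorem totalEnergy_zero : totalEnergy a σ s α β T 0 0 = 0 := by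
  simp [totalEnergy, energy_zero]

/-- The zero state exerts no force, so bounds for differences include bounds for one state. -/
theorem forceDiff_zero_right : forceDiff a σ s T U 0 Θ 0 =
    timeNorm a σ s T (fun t => forceU (U t) (Θ t))
      + timeNorm a σ s T (fun t => forceΘ (U t) (Θ t)) := by
  unfold forceDiff
  simp only [Pi.zero_apply, forceU_zero, forceΘ_zero]
  congr 2 <;> · funext t ξ; simp

theorem WeightBounds.timeNorm_force_le_of_small (hK : WeightBounds a s σ K)
    (hS : Small K ε M T C) (hα : YoungBound α ε M) (hβ : YoungBound β ε M)
    (hU : StronglyMeasurable (Function.uncurry U)) (hΘ : StronglyMeasurable (Function.uncurry Θ))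
    (e : totalEnergy a σ s α β T U Θ ≤ ENNReal.ofReal C) :
    timeNorm a σ s T (fun t => forceU (U t) (Θ t))
      + timeNorm a σ s T (fun t => forceΘ (U t) (Θ t)) ≤
      ENNReal.ofReal (1 / 8) * totalEnergy a σ s α β T U Θ := by
  have h := hK.forceDiff_le_of_small hS hα hβ hU (U' := 0) stronglyMeasurable_const hΘ (Θ' := 0)
    stronglyMeasurable_const e (by simp [totalEnergy_zero])
  rwa [forceDiff_zero_right, sub_zero, sub_zero] at h

/-- The integral form of the system for the Fourier transforms, with data `g`, `h`. -/
structure IsFourierSolution (α β T : ℝ) (g : R3 → C3) (h : R3 → ℂ) (U : ℝ → R3 → C3)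
    (Θ : ℝ → R3 → ℂ) : Prop where
  meas_u : StronglyMeasurable (Function.uncurry U)
  meas_θ : StronglyMeasurable (Function.uncurry Θ)
  eq_u : ∀ t ∈ Icc 0 T, U t =ᵐ[volume] duhamel α g (fun τ => forceU (U τ) (Θ τ)) t
  eq_θ : ∀ t ∈ Icc 0 T, Θ t =ᵐ[volume] duhamel β h (fun τ => forceΘ (U τ) (Θ τ)) t

variable {g : R3 → C3} {h : R3 → ℂ}

theorem ENNReal.eq_zero_of_le_quarter {x : ℝ≥0∞} (hx : x ≠ ∞)
    (h : x ≤ 2 * (ENNReal.ofReal (1 / 8) * x)) : x = 0 := by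
  lift x to NNReal using hx
  have h2 : ENNReal.ofReal (1 / 8) = ((1 / 8 : NNReal) : ℝ≥0∞) := by
    rw [ENNReal.ofReal]
    congr 1
    ext
    simp
  rw [h2] at h
  norm_cast at h ⊢
  have h' : (x : ℝ) ≤ 2 * (1 / 8 * x) := by exact_mod_cast h
  have := x.coe_nonneg
  ext
  push_cast
  linarith

/-- A state of total norm at most `C` solving the system is determined by its data. -/
theorem WeightBounds.fourierSolution_unique (hK : WeightBounds a s σ K) (hS : Small K ε M T C)
    (hα : YoungBound α ε M) (hβ : YoungBound β ε M)
    (sol : IsFourierSolution α β T g h U Θ) (sol' : IsFourierSolution α β T g h U' Θ')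
    (e : totalEnergy a σ s α β T U Θ ≤ ENNReal.ofReal C)
    (e' : totalEnergy a σ s α β T U' Θ' ≤ ENNReal.ofReal C) :
    ∀ t ∈ Icc 0 T, U t =ᵐ[volume] U' t ∧ Θ t =ᵐ[volume] Θ' t := by
  set d := totalEnergy a σ s α β T (U - U') (Θ - Θ') with hd
  have f1 := hK.forceDiff_le_of_small hS hα hβ sol.meas_u sol'.meas_u sol.meas_θ sol'.meas_θ e e'
  have fin : ∀ {V : ℝ → R3 → C3} {Ψ : ℝ → R3 → ℂ}, IsFourierSolution α β T g h V Ψ →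
      totalEnergy a σ s α β T V Ψ ≤ ENNReal.ofReal C →
      timeNorm a σ s T (fun t => forceU (V t) (Ψ t)) < ∞ ∧
        timeNorm a σ s T (fun t => forceΘ (V t) (Ψ t)) < ∞ := fun s1 e1 =>
    ENNReal.add_lt_top.mp ((hK.timeNorm_force_le_of_small hS hα hβ s1.meas_u s1.meas_θ e1).trans_lt
      (ENNReal.mul_lt_top ENNReal.ofReal_lt_top (e1.trans_lt ENNReal.ofReal_lt_top)))
  obtain ⟨a1, a2⟩ := fin sol e
  obtain ⟨b1, b2⟩ := fin sol' e'
  have hu : energy a σ s α T (U - U') ≤ 2 * timeNorm a σ s T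
      ((fun t => forceU (U t) (Θ t)) - fun t => forceU (U' t) (Θ' t)) := by
    rw [energy_congr (G := U - U') fun t ht => (sol.eq_u t ht).sub (sol'.eq_u t ht)]
    exact hK.energy_duhamel_sub_le (stronglyMeasurable_forceU sol.meas_u sol.meas_θ)
      (stronglyMeasurable_forceU sol'.meas_u sol'.meas_θ) a1 b1
  have hθ : energy a σ s β T (Θ - Θ') ≤ 2 * timeNorm a σ s T
      ((fun t => forceΘ (U t) (Θ t)) - fun t => forceΘ (U' t) (Θ' t)) := by
    rw [energy_congr (G := Θ - Θ') fun t ht => (sol.eq_θ t ht).sub (sol'.eq_θ t ht)]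
    exact hK.energy_duhamel_sub_le (stronglyMeasurable_forceΘ sol.meas_u sol.meas_θ)
      (stronglyMeasurable_forceΘ sol'.meas_u sol'.meas_θ) a2 b2
  have hd1 : d ≤ 2 * (ENNReal.ofReal (1 / 8) * d) := by
    calc d ≤ 2 * forceDiff a σ s T U U' Θ Θ' := by
          rw [forceDiff, mul_add]; exact add_le_add hu hθ
      _ ≤ _ := by gcongr
  have hdt : d ≠ ∞ := by
    refine ne_top_of_le_ne_top (ENNReal.add_ne_top.mpr ⟨(e.trans_lt ENNReal.ofReal_lt_top).ne,
      (e'.trans_lt ENNReal.ofReal_lt_top).ne⟩) ?_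
    calc d ≤ (energy a σ s α T U + energy a σ s α T U')
          + (energy a σ s β T Θ + energy a σ s β T Θ') :=
          add_le_add (energy_sub_le sol.meas_u) (energy_sub_le sol.meas_θ)
      _ = _ := by unfold totalEnergy; ring
  have hd0 : d = 0 := ENNReal.eq_zero_of_le_quarter hdt hd1
  rw [hd, totalEnergy, add_eq_zero] at hd0
  intro t ht
  refine ⟨ae_eq_of_freqNorm_sub_eq_zero (a := a) (σ := σ) (r := s)
    (stronglyMeasurable_of_uncurry sol.meas_u t)
    (stronglyMeasurable_of_uncurry sol'.meas_u t) (le_antisymm ?_ zero_le),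
    ae_eq_of_freqNorm_sub_eq_zero (a := a) (σ := σ) (r := s)
    (stronglyMeasurable_of_uncurry sol.meas_θ t)
    (stronglyMeasurable_of_uncurry sol'.meas_θ t) (le_antisymm ?_ zero_le)⟩
  · exact (freqNorm_le_energy (U := U - U') ht).trans_eq hd0.1
  · exact (freqNorm_le_energy (U := Θ - Θ') ht).trans_eq hd0.2

end Small

end

/-! ### Existence of the fixed point -/

section

/-- Banach's fixed point theorem in `L¹`, for a map defined on strongly measurable functions. -/
theorem exists_ae_fixedPoint {X E : Type*} [MeasurableSpace X] {μ : Measure X}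
    [NormedAddCommGroup E] [CompleteSpace E] (Φ : (X → E) → X → E) {R : ℝ≥0∞} (hR : R ≠ ∞)
    (hm : ∀ f, StronglyMeasurable f → StronglyMeasurable (Φ f))
    (hball : ∀ f, StronglyMeasurable f → eLpNorm f 1 μ ≤ R → eLpNorm (Φ f) 1 μ ≤ R)
    (hcon : ∀ f f', StronglyMeasurable f → StronglyMeasurable f' → eLpNorm f 1 μ ≤ R →
      eLpNorm f' 1 μ ≤ R → eLpNorm (Φ f - Φ f') 1 μ ≤ 2⁻¹ * eLpNorm (f - f') 1 μ) :
    ∃ f, StronglyMeasurable f ∧ eLpNorm f 1 μ ≤ R ∧ Φ f =ᵐ[μ] f := by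
  -- Picard iteration from `0`
  set f : ℕ → X → E := fun n => Φ^[n] 0 with hf
  have hsucc : ∀ n, f (n + 1) = Φ (f n) := fun n => Function.iterate_succ_apply' _ _ _
  have hfm : ∀ n, StronglyMeasurable (f n) := fun n => by
    induction n with
    | zero => exact stronglyMeasurable_const
    | succ n ih => rw [hsucc]; exact hm _ ih
  have hfR : ∀ n, eLpNorm (f n) 1 μ ≤ R := fun n => by
    induction n with
    | zero => simp [hf]
    | succ n ih => rw [hsucc]; exact hball _ (hfm n) ih
  have hdiff : ∀ N n m, eLpNorm (f (n + N) - f (m + N)) 1 μ ≤ 2⁻¹ ^ N * (2 * R) := fun N n m => by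
    induction N with
    | zero =>
      rw [pow_zero, one_mul, two_mul]
      exact (eLpNorm_sub_le (hfm _).aestronglyMeasurable (hfm _).aestronglyMeasurable le_rfl).trans
        (add_le_add (hfR _) (hfR _))
    | succ N ih =>
      rw [← add_assoc, ← add_assoc, hsucc, hsucc, pow_succ', mul_assoc]
      exact (hcon _ _ (hfm _) (hfm _) (hfR _) (hfR _)).trans (by gcongr)
  have hR' : 2 * R + 1 ≠ ∞ := ENNReal.add_ne_top.mpr ⟨ENNReal.mul_ne_top (by simp) hR, by simp⟩
  obtain ⟨f₀, hf₀, hlim⟩ := Lp.cauchy_complete_eLpNorm (p := 1) (μ := μ) (f := f) le_rfl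
    (fun n => ⟨(hfm n).aestronglyMeasurable, (hfR n).trans_lt hR.lt_top⟩)
    -- `+ 1` makes the Cauchy bounds strict
    (B := fun N => 2⁻¹ ^ N * (2 * R + 1)) (by
      rw [ENNReal.tsum_mul_right]
      refine ENNReal.mul_ne_top ?_ hR'
      rw [ENNReal.tsum_geometric, ENNReal.one_sub_inv_two, inv_inv]
      simp) (fun N n m hn hm' => by
      obtain ⟨k, rfl⟩ := Nat.exists_eq_add_of_le' hn
      obtain ⟨l, rfl⟩ := Nat.exists_eq_add_of_le' hm'
      refine (hdiff N k l).trans_lt ?_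
      have h0 : (2⁻¹ : ℝ≥0∞) ^ N ≠ 0 := by simp
      have h1 : (2⁻¹ : ℝ≥0∞) ^ N ≠ ∞ := by simp
      rw [ENNReal.mul_lt_mul_iff_right h0 h1]
      exact ENNReal.lt_add_right (ENNReal.mul_ne_top (by simp) hR) (by simp))
  obtain ⟨φ, hφ, hφe⟩ := hf₀.1
  have hlim' : Filter.Tendsto (fun n => eLpNorm (f n - φ) 1 μ) Filter.atTop (nhds 0) := by
    refine hlim.congr fun n => eLpNorm_congr_ae ?_
    exact (Filter.EventuallyEq.refl _ _).sub hφe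
  have hφR : eLpNorm φ 1 μ ≤ R := by
    have h1 : ∀ n, eLpNorm φ 1 μ ≤ eLpNorm (f n - φ) 1 μ + R := fun n => by
      calc eLpNorm φ 1 μ = eLpNorm (f n - (f n - φ)) 1 μ := by rw [sub_sub_cancel]
        _ ≤ eLpNorm (f n) 1 μ + eLpNorm (f n - φ) 1 μ :=
          eLpNorm_sub_le (hfm n).aestronglyMeasurable ((hfm n).sub hφ).aestronglyMeasurable le_rfl
        _ ≤ R + eLpNorm (f n - φ) 1 μ := by gcongr; exact hfR n
        _ = _ := add_comm _ _
    simpa using ge_of_tendsto' (hlim'.add_const R) h1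
  refine ⟨φ, hφ, hφR, ?_⟩
  have h2 : ∀ n, eLpNorm (Φ φ - φ) 1 μ ≤ 2⁻¹ * eLpNorm (f n - φ) 1 μ
      + eLpNorm (f (n + 1) - φ) 1 μ := fun n => by
    calc eLpNorm (Φ φ - φ) 1 μ = eLpNorm ((Φ φ - Φ (f n)) + (f (n + 1) - φ)) 1 μ := by
          rw [hsucc]; congr 1; abel
      _ ≤ eLpNorm (Φ φ - Φ (f n)) 1 μ + eLpNorm (f (n + 1) - φ) 1 μ :=
          eLpNorm_add_le ((hm _ hφ).sub (hm _ (hfm n))).aestronglyMeasurable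
            ((hfm _).sub hφ).aestronglyMeasurable le_rfl
      _ ≤ _ := by
          gcongr
          rw [eLpNorm_sub_comm (f n)]
          exact hcon _ _ hφ (hfm n) hφR (hfR n)
  have h3 : Filter.Tendsto (fun n => 2⁻¹ * eLpNorm (f n - φ) 1 μ
      + eLpNorm (f (n + 1) - φ) 1 μ) Filter.atTop (nhds 0) := by
    have := (ENNReal.Tendsto.const_mul (a := 2⁻¹) hlim' (Or.inr (by simp))).add
      (hlim'.comp (Filter.tendsto_add_atTop_nat 1))
    simpa using this
  have h4 : eLpNorm (Φ φ - φ) 1 μ = 0 := le_antisymm (ge_of_tendsto' h3 h2) zero_le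
  rw [eLpNorm_eq_zero_iff ((hm _ hφ).sub hφ).aestronglyMeasurable one_ne_zero] at h4
  filter_upwards [h4] with x hx
  exact sub_eq_zero.mp hx

/-- The weighted measure on space-time whose `L¹` space is `L¹([0,T]; X^s)` in frequency. -/
def forceMeasure (a σ s T : ℝ) : Measure (ℝ × R3) :=
  ((volume.restrict (Icc 0 T)).prod volume).withDensity
    fun p => ENNReal.ofReal (weight a σ s p.2)

variable {a s σ K T ε M α β C : ℝ}

theorem eLpNorm_forceMeasure {F : Type*} [NormedAddCommGroup F] {f : ℝ × R3 → F}
    (hf : StronglyMeasurable f) :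
    eLpNorm f 1 (forceMeasure a σ s T) = timeNorm a σ s T (Function.curry f) := by
  have hw : Measurable fun p : ℝ × R3 => ENNReal.ofReal (weight a σ s p.2) :=
    (measurable_ofReal_weight a σ s).comp measurable_snd
  have hm : Measurable ((fun p : ℝ × R3 => ENNReal.ofReal (weight a σ s p.2))
      * fun p => ‖f p‖ₑ) := hw.mul hf.enorm
  rw [eLpNorm_one_eq_lintegral_enorm, forceMeasure, lintegral_withDensity_eq_lintegral_mul _ hw
    hf.enorm, lintegral_prod _ hm.aemeasurable]
  rfl

/-- Almost everywhere for the weighted measure, by slices. -/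
theorem ae_ae_of_forceMeasure {P : ℝ → R3 → Prop}
    (h : ∀ᵐ p ∂(forceMeasure a σ s T), P p.1 p.2) :
    ∀ᵐ ξ : R3, ∀ᵐ t ∂(volume.restrict (Icc 0 T)), P t ξ := by
  have hw : Measurable fun p : ℝ × R3 => ENNReal.ofReal (weight a σ s p.2) :=
    (measurable_ofReal_weight a σ s).comp measurable_snd
  rw [forceMeasure, ae_withDensity_iff hw] at h
  have h1 : ∀ᵐ p ∂(volume : Measure R3).prod (volume.restrict (Icc 0 T)),
      ENNReal.ofReal (weight a σ s p.1) ≠ 0 → P p.2 p.1 := by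
    rw [← Measure.prod_swap] at h
    exact ae_of_ae_map measurable_swap.aemeasurable h
  filter_upwards [Measure.ae_ae_of_ae_prod h1, ae_ne_zero] with ξ hξ hne
  filter_upwards [hξ] with t ht
  exact ht (by simpa using weight_pos a σ s hne)

theorem timeNorm_mono {F G : Type*} [NormedAddCommGroup F] [NormedAddCommGroup G]
    {f : ℝ → R3 → F} {g : ℝ → R3 → G} (h : ∀ t ξ, ‖f t ξ‖ₑ ≤ ‖g t ξ‖ₑ) :
    timeNorm a σ s T f ≤ timeNorm a σ s T g :=
  lintegral_mono fun t => freqNorm_mono_ae (Filter.Eventually.of_forall fun ξ => h t ξ)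

/-- Small data or a short time give a solution of the system in frequency. The unknown of the fixed
point problem is the force, in the Banach space `L¹([0,T]; X^s)`; the state is recovered from it
through Duhamel's formula. -/
theorem WeightBounds.exists_fourierSolution (hK : WeightBounds a s σ K) (hS : Small K ε M T C)
    (hα : YoungBound α ε M) (hβ : YoungBound β ε M) {g : R3 → C3} {h : R3 → ℂ}
    (hg : StronglyMeasurable g) (hh : StronglyMeasurable h)
    (hC : 4 * (freqNorm a σ s g + freqNorm a σ s h) ≤ ENNReal.ofReal C) :
    ∃ (U : ℝ → R3 → C3) (Θ : ℝ → R3 → ℂ), IsFourierSolution α β T g h U Θ ∧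
      totalEnergy a σ s α β T U Θ ≤ 4 * (freqNorm a σ s g + freqNorm a σ s h) := by
  set D := freqNorm a σ s g + freqNorm a σ s h with hD
  have hDtop : D ≠ ∞ := by
    rintro h0
    rw [h0] at hC
    simp at hC
  -- `f` is a pair of forces, `(SU f, SΘ f)` the state it generates, `Φ f` the force of that state
  let fu : (ℝ × R3 → C3 × ℂ) → ℝ → R3 → C3 := fun f t ξ => (f (t, ξ)).1
  let fθ : (ℝ × R3 → C3 × ℂ) → ℝ → R3 → ℂ := fun f t ξ => (f (t, ξ)).2
  let SU : (ℝ × R3 → C3 × ℂ) → ℝ → R3 → C3 := fun f => duhamel α g (fu f)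
  let SΘ : (ℝ × R3 → C3 × ℂ) → ℝ → R3 → ℂ := fun f => duhamel β h (fθ f)
  let Φ : (ℝ × R3 → C3 × ℂ) → ℝ × R3 → C3 × ℂ := fun f p =>
    (forceU (SU f p.1) (SΘ f p.1) p.2, forceΘ (SU f p.1) (SΘ f p.1) p.2)
  have mfu : ∀ f, StronglyMeasurable f → StronglyMeasurable (Function.uncurry (fu f)) :=
    fun f hf => hf.fst
  have mfθ : ∀ f, StronglyMeasurable f → StronglyMeasurable (Function.uncurry (fθ f)) :=
    fun f hf => hf.snd
  have mSU : ∀ f, StronglyMeasurable f → StronglyMeasurable (Function.uncurry (SU f)) :=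
    fun f hf => stronglyMeasurable_duhamel hg (mfu f hf)
  have mSΘ : ∀ f, StronglyMeasurable f → StronglyMeasurable (Function.uncurry (SΘ f)) :=
    fun f hf => stronglyMeasurable_duhamel hh (mfθ f hf)
  have mΦ : ∀ f, StronglyMeasurable f → StronglyMeasurable (Φ f) := fun f hf =>
    (stronglyMeasurable_forceU (mSU f hf) (mSΘ f hf)).prodMk
      (stronglyMeasurable_forceΘ (mSU f hf) (mSΘ f hf))
  have nfu : ∀ f, StronglyMeasurable f →
      timeNorm a σ s T (fu f) ≤ eLpNorm f 1 (forceMeasure a σ s T) := fun f hf => by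
    rw [eLpNorm_forceMeasure hf]
    exact timeNorm_mono fun t ξ => by
      rw [enorm_le_iff_norm_le]; exact norm_fst_le (f (t, ξ))
  have nfθ : ∀ f, StronglyMeasurable f →
      timeNorm a σ s T (fθ f) ≤ eLpNorm f 1 (forceMeasure a σ s T) := fun f hf => by
    rw [eLpNorm_forceMeasure hf]
    exact timeNorm_mono fun t ξ => by
      rw [enorm_le_iff_norm_le]; exact norm_snd_le (f (t, ξ))
  have npair : ∀ f, StronglyMeasurable f → eLpNorm f 1 (forceMeasure a σ s T) ≤
      timeNorm a σ s T (fu f) + timeNorm a σ s T (fθ f) := fun f hf => by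
    have e1 := eLpNorm_forceMeasure (a := a) (σ := σ) (s := s) (T := T) (mfu f hf)
    have e2 := eLpNorm_forceMeasure (a := a) (σ := σ) (s := s) (T := T) (mfθ f hf)
    rw [Function.curry_uncurry] at e1 e2
    rw [← e1, ← e2, eLpNorm_one_eq_lintegral_enorm, eLpNorm_one_eq_lintegral_enorm,
      eLpNorm_one_eq_lintegral_enorm, ← lintegral_add_left (mfu f hf).enorm]
    refine lintegral_mono fun p => ?_
    change max ‖(f p).1‖ₑ ‖(f p).2‖ₑ ≤ _
    exact max_le le_self_add le_add_self
  have hball : ∀ f, StronglyMeasurable f → eLpNorm f 1 (forceMeasure a σ s T) ≤ D / 2 →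
      totalEnergy a σ s α β T (SU f) (SΘ f) ≤ 4 * D := fun f hf hfR => by
    have h1 := energy_duhamel_le (a := a) (σ := σ) (s := s) (γ := α) (T := T) hg (mfu f hf)
    have h2 := energy_duhamel_le (a := a) (σ := σ) (s := s) (γ := β) (T := T) hh (mfθ f hf)
    calc _ ≤ _ := add_le_add h1 h2
      _ ≤ 2 * (freqNorm a σ s g + D / 2) + 2 * (freqNorm a σ s h + D / 2) := by
          gcongr
          · exact (nfu f hf).trans hfR
          · exact (nfθ f hf).trans hfR
      _ = 2 * (freqNorm a σ s g + freqNorm a σ s h) + 2 * (D / 2 + D / 2) := by ring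
      _ = _ := by rw [ENNReal.add_halves]; ring
  -- forces of norm at most `D / 2` generate states of norm at most `4 D`, whose forces have norm at
  -- most `4 D / 8 = D / 2` again
  obtain ⟨f, hf, hfR, hfix⟩ := exists_ae_fixedPoint (μ := forceMeasure a σ s T) Φ (R := D / 2)
    (ENNReal.div_ne_top hDtop (by simp)) mΦ (fun f hf hfR => by
      have h1 := hball f hf hfR
      have h2 := hK.timeNorm_force_le_of_small hS hα hβ (mSU f hf) (mSΘ f hf) (h1.trans hC)
      refine (npair _ (mΦ f hf)).trans (h2.trans ?_)
      calc _ ≤ ENNReal.ofReal (1 / 8) * (4 * D) := by gcongr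
        _ = D / 2 := by
          rw [ENNReal.div_eq_inv_mul, ← mul_assoc]
          congr 1
          rw [show (4 : ℝ≥0∞) = ENNReal.ofReal 4 by simp, ← ENNReal.ofReal_mul (by norm_num),
            ← ENNReal.ofReal_ofNat 2, ← ENNReal.ofReal_inv_of_pos (by norm_num)]
          norm_num) (fun f f' hf hf' hfR hfR' => by
      have e := (hball f hf hfR).trans hC
      have e' := (hball f' hf' hfR').trans hC
      have h1 := hK.forceDiff_le_of_small hS hα hβ (mSU f hf) (mSU f' hf') (mSΘ f hf)
        (mSΘ f' hf') e e'
      have fin : D / 2 < ∞ := ENNReal.div_lt_top hDtop (by simp)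
      have h2 : energy a σ s α T (SU f - SU f') ≤ 2 * timeNorm a σ s T (fu f - fu f') :=
        hK.energy_duhamel_sub_le (mfu f hf) (mfu f' hf')
          (((nfu f hf).trans hfR).trans_lt fin) (((nfu f' hf').trans hfR').trans_lt fin)
      have h3 : energy a σ s β T (SΘ f - SΘ f') ≤ 2 * timeNorm a σ s T (fθ f - fθ f') :=
        hK.energy_duhamel_sub_le (mfθ f hf) (mfθ f' hf')
          (((nfθ f hf).trans hfR).trans_lt fin) (((nfθ f' hf').trans hfR').trans_lt fin)
      have h4 : timeNorm a σ s T (fu f - fu f') ≤ eLpNorm (f - f') 1 (forceMeasure a σ s T) :=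
        nfu (f - f') (hf.sub hf')
      have h5 : timeNorm a σ s T (fθ f - fθ f') ≤ eLpNorm (f - f') 1 (forceMeasure a σ s T) :=
        nfθ (f - f') (hf.sub hf')
      set x := eLpNorm (f - f') 1 (forceMeasure a σ s T)
      refine (npair (Φ f - Φ f') ((mΦ f hf).sub (mΦ f' hf'))).trans (le_trans h1 ?_)
      calc _ ≤ ENNReal.ofReal (1 / 8) * (2 * x + 2 * x) := by
            gcongr
            exact add_le_add (h2.trans (by gcongr)) (h3.trans (by gcongr))
        _ = (ENNReal.ofReal (1 / 8) * 4) * x := by ring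
        _ = 2⁻¹ * x := by
            congr 1
            rw [show (4 : ℝ≥0∞) = ENNReal.ofReal 4 by simp, ← ENNReal.ofReal_mul (by norm_num),
              ← ENNReal.ofReal_ofNat 2, ← ENNReal.ofReal_inv_of_pos (by norm_num)]
            norm_num)
  -- the state generated by the fixed point is defined for every `t` and solves the system exactly
  -- up to null sets of frequencies
  have hfix' := ae_ae_of_forceMeasure (P := fun t ξ => Φ f (t, ξ) = f (t, ξ)) hfix
  refine ⟨SU f, SΘ f, ⟨mSU f hf, mSΘ f hf, fun t ht => ?_, fun t ht => ?_⟩, hball f hf hfR⟩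
  · refine duhamel_congr_ae ht ?_
    filter_upwards [hfix'] with ξ hξ
    filter_upwards [hξ] with τ hτ
    exact (congrArg Prod.fst hτ).symm
  · refine duhamel_congr_ae ht ?_
    filter_upwards [hfix'] with ξ hξ
    filter_upwards [hξ] with τ hτ
    exact (congrArg Prod.snd hτ).symm

end

/-! ### Distributions with integrable Fourier transform -/

section

set_option linter.unusedSectionVars false

variable {F G : Type*} [NormedAddCommGroup F] [NormedSpace ℂ F] [CompleteSpace F]
  [NormedAddCommGroup G] [NormedSpace ℂ G] [CompleteSpace G]

theorem IsFunction.congr {f : 𝓢'(R3, F)} {h h' : R3 → F} (hf : IsFunction f h)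
    (e : h =ᵐ[volume] h') : IsFunction f h' := by
  refine ⟨hf.1.congr e, fun φ => ?_⟩
  have e' : (fun x => φ x • h x) =ᵐ[volume] fun x => φ x • h' x := by
    filter_upwards [e] with x hx
    rw [hx]
  exact ⟨(hf.2 φ).1.congr e', (hf.2 φ).2.trans (integral_congr_ae e')⟩

theorem IsFunction.unique {f f' : 𝓢'(R3, F)} {h : R3 → F} (hf : IsFunction f h)
    (hf' : IsFunction f' h) : f = f' := by
  ext φ
  rw [(hf.2 φ).2, (hf'.2 φ).2]

theorem HasFourier.congr {f : 𝓢'(R3, F)} {g g' : R3 → F} (hf : HasFourier f g)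
    (e : g =ᵐ[volume] g') : HasFourier f g' :=
  IsFunction.congr hf ((quasi_smul two_pi_ne).ae_eq_comp e)

/-- A tempered distribution is determined by its Fourier transform. -/
theorem HasFourier.unique {f f' : 𝓢'(R3, F)} {g g' : R3 → F} (hf : HasFourier f g)
    (hf' : HasFourier f' g') (e : g =ᵐ[volume] g') : f = f' := by
  have h := IsFunction.unique (hf.congr e) hf'
  simpa using congrArg (fun h => 𝓕⁻ h) h

theorem integrable_comp_two_pi_smul {g : R3 → F} (hg : Integrable g) :
    Integrable fun η : R3 => g ((2 * Real.pi) • η) := hg.comp_smul two_pi_ne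

theorem isFunction_of_integrable {g : R3 → F} (hg : Integrable g) :
    IsFunction (Lp.toTemperedDistribution hg.toL1) g := by
  refine ⟨hg.locallyIntegrable, fun φ => ⟨?_, ?_⟩⟩
  · exact hg.bdd_smul _ φ.continuous.aestronglyMeasurable
      (Filter.Eventually.of_forall φ.toBoundedContinuousFunction.norm_coe_le_norm)
  · rw [Lp.toTemperedDistribution_apply]
    refine integral_congr_ae ?_
    filter_upwards [hg.coeFn_toL1] with x hx
    rw [hx]

open Classical in
/-- The tempered distribution whose Fourier transform is the integrable function `g` (and `0` if `g`
is not integrable). -/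
def ofFourier (g : R3 → F) : 𝓢'(R3, F) :=
  if h : Integrable g
  then 𝓕⁻ (Lp.toTemperedDistribution (integrable_comp_two_pi_smul h).toL1) else 0

theorem hasFourier_ofFourier {g : R3 → F} (hg : Integrable g) : HasFourier (ofFourier g) g := by
  unfold HasFourier
  rw [ofFourier, dif_pos hg, FourierTransform.fourier_fourierInv_eq]
  exact isFunction_of_integrable (integrable_comp_two_pi_smul hg)

/-- The inverse Fourier transform of an integrable function, as a function. -/
def invFourier (g : R3 → F) : R3 → F := 𝓕⁻ fun η : R3 => g ((2 * Real.pi) • η)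

theorem continuous_invFourier {g : R3 → F} (hg : Integrable g) : Continuous (invFourier g) :=
  VectorFourier.fourierIntegral_continuous Real.continuous_fourierChar
    continuous_inner.neg (integrable_comp_two_pi_smul hg)

theorem norm_invFourier_le {g : R3 → F} (x : R3) :
    ‖invFourier g x‖ ≤ ∫ η : R3, ‖g ((2 * Real.pi) • η)‖ :=
  VectorFourier.norm_fourierIntegral_le_integral_norm _ _ _ _ _

/-- A distribution with integrable Fourier transform is a bounded continuous function. -/
theorem HasFourier.isFunction {f : 𝓢'(R3, F)} {g : R3 → F} (hf : HasFourier f g)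
    (hg : Integrable g) : IsFunction f (invFourier g) := by
  have hc := continuous_invFourier hg
  refine ⟨hc.locallyIntegrable, fun φ => ⟨?_, ?_⟩⟩
  · exact φ.integrable.smul_bdd _ hc.aestronglyMeasurable
      (Filter.Eventually.of_forall fun x => norm_invFourier_le x)
  · have h1 : f φ = 𝓕 f (𝓕⁻ φ) := by
      rw [TemperedDistribution.fourier_apply, FourierTransform.fourier_fourierInv_eq]
    rw [h1, (hf.2 _).2]
    have h2 := VectorFourier.integral_fourierIntegral_smul_eq_flip (L := -innerₗ R3)
      (μ := volume) (ν := volume) Real.continuous_fourierChar continuous_inner.neg φ.integrable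
      (integrable_comp_two_pi_smul hg)
    have h3 : (-innerₗ R3).flip = -innerₗ R3 := by
      ext x y
      simp [real_inner_comm]
    rw [h3] at h2
    rw [SchwartzMap.fourierInv_coe]
    exact h2

/-- Multipliers act as expected whenever the product is integrable; the junk value in the definition
then does not occur. -/
theorem HasFourier.fourierMultiplier {f : 𝓢'(R3, F)} {k : R3 → F} {m : R3 → F → G}
    (hf : HasFourier f k) (hm : Integrable fun ξ => m ξ (k ξ)) :
    HasFourier (fourierMultiplier m f) (fun ξ => m ξ (k ξ)) := by
  have h : ∃ g : 𝓢'(R3, G), ∃ k : R3 → F, HasFourier f k ∧ HasFourier g (fun ξ => m ξ (k ξ)) :=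
    ⟨_, k, hf, hasFourier_ofFourier hm⟩
  rw [Boussinesq.fourierMultiplier, dif_pos h]
  obtain ⟨k', h1, h2⟩ := h.choose_spec
  refine h2.congr ?_
  filter_upwards [hf.ae_eq h1] with ξ hξ
  rw [hξ]

theorem HasFourier.heat {f : 𝓢'(R3, F)} {k : R3 → F} {γ t : ℝ} (ht : 0 ≤ t)
    (hf : HasFourier f k) (hk : Integrable k) :
    Integrable (fun ξ => (heatSymbol γ t ξ : ℂ) • k ξ) ∧
      HasFourier (heat γ t f) (fun ξ => (heatSymbol γ t ξ : ℂ) • k ξ) := by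
  have hi : Integrable fun ξ => (heatSymbol γ t ξ : ℂ) • k ξ := by
    refine hk.mono ?_ (Filter.Eventually.of_forall fun ξ => ?_)
    · exact ((Complex.measurable_ofReal.comp ((measurable_heatSymbol γ).comp
        (measurable_prodMk_left (x := t)))).aestronglyMeasurable).smul hk.aestronglyMeasurable
    · rw [← enorm_le_iff_norm_le]
      exact enorm_heatSymbol_smul_le γ ht ξ _
  refine ⟨hi, ?_⟩
  unfold Boussinesq.heat
  have h2 := HasFourier.fourierMultiplier (m := fun ξ v =>
    (Real.exp (-t * ‖ξ‖ ^ (2 * γ)) : ℂ) • v) hf (by simpa [heatSymbol] using hi)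
  simpa [heatSymbol] using h2

theorem HasFourier.leray {f : 𝓢'(R3, C3)} {k : R3 → C3} (hf : HasFourier f k)
    (hk : Integrable k) :
    Integrable (fun ξ => leraySymbol ξ (k ξ)) ∧
      HasFourier (leray f) (fun ξ => leraySymbol ξ (k ξ)) := by
  have hi : Integrable fun ξ => leraySymbol ξ (k ξ) := by
    refine hk.mono ?_ (Filter.Eventually.of_forall fun ξ => norm_leraySymbol_le _ _)
    exact (measurable_leraySymbol.comp_aemeasurable
      (aemeasurable_id.prodMk hk.aemeasurable)).aestronglyMeasurable
  exact ⟨hi, HasFourier.fourierMultiplier (m := leraySymbol) hf hi⟩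

theorem basisVec_inner (ξ : R3) (j : Fin 3) : inner ℝ ξ (basisVec j) = ξ j := by
  simp [basisVec, EuclideanSpace.inner_single_right]

theorem HasFourier.lineDeriv {f : 𝓢'(R3, F)} {g : R3 → F} (hf : HasFourier f g) (j : Fin 3) :
    HasFourier (∂_{basisVec j} f) (fun ξ => (Complex.I * (ξ j : ℂ)) • g ξ) := by
  have hT : (fun ξ : R3 => ((inner ℝ ξ (basisVec j) : ℝ) : ℂ)).HasTemperateGrowth := by fun_prop
  have hj : ∀ η : R3, (Complex.I * (((2 * Real.pi) • η) j : ℂ)) • g ((2 * Real.pi) • η)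
      = (2 * Real.pi * Complex.I * (inner ℝ η (basisVec j) : ℝ)) • g ((2 * Real.pi) • η) := by
    intro η
    rw [basisVec_inner]
    congr 1
    simp only [PiLp.smul_apply, smul_eq_mul, Complex.ofReal_mul, Complex.ofReal_ofNat]
    ring
  refine ⟨?_, fun φ => ?_⟩
  · simp_rw [hj]
    exact hf.1.continuous_smul (by fun_prop)
  · obtain ⟨i1, e1⟩ := hf.2 (SchwartzMap.smulLeftCLM ℂ
      (fun ξ : R3 => ((inner ℝ ξ (basisVec j) : ℝ) : ℂ)) φ)
    have h2 : ∀ η : R3, φ η • (Complex.I * (((2 * Real.pi) • η) j : ℂ)) • g ((2 * Real.pi) • η) =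
        (2 * Real.pi * Complex.I) • (SchwartzMap.smulLeftCLM ℂ
          (fun ξ : R3 => ((inner ℝ ξ (basisVec j) : ℝ) : ℂ)) φ η • g ((2 * Real.pi) • η)) := by
      intro η
      rw [hj, SchwartzMap.smulLeftCLM_apply_apply hT, smul_smul, smul_smul, smul_eq_mul]
      congr 1
      ring
    simp_rw [h2]
    refine ⟨i1.smul _, ?_⟩
    rw [TemperedDistribution.fourier_lineDerivOp_eq, integral_smul, ← e1]
    rfl

/-- A fixed continuous linear map acts on the values of the Fourier transform. -/
theorem HasFourier.postcomp {f : 𝓢'(R3, F)} {g : R3 → F} (hf : HasFourier f g) (L : F →L[ℂ] G) :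
    HasFourier (PointwiseConvergenceCLM.postcomp 𝓢(R3, ℂ) L f) (fun ξ => L (g ξ)) := by
  refine ⟨fun x => ?_, fun φ => ?_⟩
  · obtain ⟨u, hu, hi⟩ := hf.1 x
    exact ⟨u, hu, L.integrable_comp hi⟩
  · obtain ⟨i1, e1⟩ := hf.2 φ
    have h2 : ∀ η : R3, φ η • L (g ((2 * Real.pi) • η)) = L (φ η • g ((2 * Real.pi) • η)) :=
      fun η => (L.map_smul _ _).symm
    simp_rw [h2]
    refine ⟨L.integrable_comp i1, ?_⟩
    rw [L.integral_comp_comm i1, ← e1]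
    rfl

theorem HasFourier.buoyancy {θ : 𝓢'(R3, ℂ)} {Θ : R3 → ℂ} (h : HasFourier θ Θ) :
    HasFourier (buoyancy θ) (fun ξ => Θ ξ • (EuclideanSpace.single 2 1 : C3)) :=
  h.postcomp _

/-- The divergence free condition in frequency. -/
theorem isDivFree_iff {u : 𝓢'(R3, C3)} {U : R3 → C3} (hu : HasFourier u U) :
    IsDivFree u ↔ ∀ᵐ ξ, dotC ξ (U ξ) = 0 := by
  have h1 : ∀ j : Fin 3, HasFourier (PointwiseConvergenceCLM.postcomp 𝓢(R3, ℂ)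
      (EuclideanSpace.proj j : C3 →L[ℂ] ℂ) (∂_{basisVec j} u))
      (fun ξ => Complex.I * (ξ j : ℂ) * U ξ j) := fun j => (hu.lineDeriv j).postcomp _
  set d : 𝓢'(R3, ℂ) := ∑ j, PointwiseConvergenceCLM.postcomp 𝓢(R3, ℂ)
      (EuclideanSpace.proj j : C3 →L[ℂ] ℂ) (∂_{basisVec j} u) with hd
  have h2 : HasFourier d (fun ξ => Complex.I * dotC ξ (U ξ)) := by
    have h3 := ((h1 0).add (h1 1)).add (h1 2)
    rw [hd, Fin.sum_univ_three]
    convert! h3 using 1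
    funext ξ
    simp only [dotC, Fin.sum_univ_three, Pi.add_apply]
    ring
  have h3 : ∀ φ, d φ = ∑ j, (∂_{basisVec j} u φ) j := fun φ => by
    rw [hd, Fin.sum_univ_three, Fin.sum_univ_three]
    rfl
  constructor
  · intro h
    have hd0 : d = 0 := by
      ext φ
      rw [h3, h φ]
      rfl
    rw [hd0] at h2
    filter_upwards [h2.ae_eq HasFourier.zero] with ξ hξ
    simpa using hξ
  · intro h φ
    have hd0 : d = 0 := h2.unique HasFourier.zero (by
      filter_upwards [h] with ξ hξ
      simp [hξ])
    rw [← h3, hd0]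
    rfl

end

/-! ### The transport term of distributions with integrable Fourier transform -/

section

set_option linter.unusedSectionVars false

variable {F : Type*} [NormedAddCommGroup F] [NormedSpace ℂ F] [CompleteSpace F]

theorem IsAdvection.unique {u : 𝓢'(R3, C3)} {w N N' : 𝓢'(R3, F)} (h : IsAdvection u w N)
    (h' : IsAdvection u w N') : N = N' := by
  obtain ⟨U, W, hU, hW, hN⟩ := h
  obtain ⟨U', W', hU', hW', hN'⟩ := h'
  refine IsFunction.unique (hN.congr ?_) hN'
  have h2 : ∀ᵐ x, ∀ j, W j x = W' j x := ae_all_iff.mpr fun j => (hW j).ae_eq (hW' j)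
  filter_upwards [hU.ae_eq hU', h2] with x h1 h2
  simp [h1, h2]

theorem IsAdvection.advection_eq {u : 𝓢'(R3, C3)} {w N : 𝓢'(R3, F)} (h : IsAdvection u w N) :
    advection u w = N := by
  have h' : ∃ N, IsAdvection u w N := ⟨N, h⟩
  rw [advection, dif_pos h']
  exact h'.choose_spec.unique h

/-- The inverse Fourier transform maps convolutions to products. -/
theorem fourierInv_convolution {f : R3 → ℂ} {g : R3 → F} (hf : Integrable f) (hg : Integrable g)
    (x : R3) : 𝓕⁻ (fun η => ∫ ζ, f (η - ζ) • g ζ) x = 𝓕⁻ f x • 𝓕⁻ g x := by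
  rw [Real.fourierInv_eq_fourier_neg, Real.fourierInv_eq_fourier_neg,
    Real.fourierInv_eq_fourier_neg]
  exact Real.fourier_bilin_convolution_eq (ContinuousLinearMap.lsmul ℂ ℂ).flip hg hf (-x)

theorem integrable_convolution_smul {f : R3 → ℂ} {g : R3 → F} (hf : Integrable f)
    (hg : Integrable g) : Integrable fun η => ∫ ζ, f (η - ζ) • g ζ :=
  hg.integrable_convolution (ContinuousLinearMap.lsmul ℂ ℂ).flip hf

theorem ae_integrable_convolution_smul {f : R3 → ℂ} {g : R3 → F} (hf : Integrable f)
    (hg : Integrable g) : ∀ᵐ η : R3, Integrable fun ζ => f (η - ζ) • g ζ :=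
  hg.ae_convolution_exists (ContinuousLinearMap.lsmul ℂ ℂ).flip hf

theorem sum_smul_eq_dotC (v : C3) (ξ : R3) (w : F) :
    ∑ j, v j • (Complex.I * (ξ j : ℂ)) • w = (Complex.I * dotC ξ v) • w := by
  simp only [smul_smul, ← Finset.sum_smul, dotC, Finset.mul_sum]
  congr 1
  exact Finset.sum_congr rfl fun j _ => by ring

theorem integral_comp_two_pi (k : R3 → F) : ∫ ζ : R3, k ((2 * Real.pi) • ζ) =
    ((((2 * Real.pi) ^ 3)⁻¹ : ℝ) : ℂ) • ∫ z, k z := by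
  rw [Measure.integral_comp_smul, finrank_euclideanSpace_fin, abs_of_nonneg (by positivity)]
  exact (Complex.coe_smul _ _).symm

/-- For divergence free `U`, `z·U(ξ-z) = ξ·U(ξ-z)`: the derivative moves onto the product. -/
theorem integral_dotC_sub_smul {U : R3 → C3} {W : R3 → F} (hdiv : ∀ᵐ ξ, dotC ξ (U ξ) = 0)
    (ξ : R3) : ((((2 * Real.pi) ^ 3)⁻¹ : ℝ) : ℂ) •
      ∫ z : R3, (Complex.I * dotC z (U (ξ - z))) • W z = convAdvection U W ξ := by
  unfold convAdvection
  congr 1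
  refine integral_congr_ae ?_
  filter_upwards [(Measure.measurePreserving_sub_left volume ξ).quasiMeasurePreserving.ae hdiv]
    with z hz
  rw [dotC_sub_left, sub_eq_zero] at hz
  rw [hz]

/-- A component of the Fourier transform of a vector field, in the scaling of `𝓕`. -/
def scaledCoord (U : R3 → C3) (j : Fin 3) (η : R3) : ℂ := U ((2 * Real.pi) • η) j

/-- The Fourier transform of `∂ⱼ w`, in the scaling of `𝓕`. -/
def scaledDeriv (W : R3 → F) (j : Fin 3) (η : R3) : F :=
  (Complex.I * (((2 * Real.pi) • η) j : ℂ)) • W ((2 * Real.pi) • η)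

theorem integrable_scaledCoord {U : R3 → C3} (hU : Integrable U) (j : Fin 3) :
    Integrable (scaledCoord U j) :=
  (EuclideanSpace.proj j : C3 →L[ℂ] ℂ).integrable_comp (integrable_comp_two_pi_smul hU)

/-- For divergence free `u` the two forms `u·∇w` and `∇·(u w)` of the transport term agree in
frequency. -/
theorem sum_convolution_ae_eq {U : R3 → C3} {W : R3 → F} (hU : Integrable U)
    (hW : ∀ j, Integrable (scaledDeriv W j)) (hdiv : ∀ᵐ ξ, dotC ξ (U ξ) = 0) :
    (fun η : R3 => ∑ j, ∫ ζ : R3, scaledCoord U j (η - ζ) • scaledDeriv W j ζ) =ᵐ[volume]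
      fun η => convAdvection U W ((2 * Real.pi) • η) := by
  have hae : ∀ᵐ η : R3, ∀ j, Integrable fun ζ : R3 =>
      scaledCoord U j (η - ζ) • scaledDeriv W j ζ :=
    ae_all_iff.mpr fun j => ae_integrable_convolution_smul (integrable_scaledCoord hU j) (hW j)
  filter_upwards [hae] with η hη
  rw [← integral_finsetSum _ fun j _ => hη j, ← integral_dotC_sub_smul hdiv,
    ← integral_comp_two_pi fun z => (Complex.I * dotC z (U ((2 * Real.pi) • η - z))) • W z]
  refine integral_congr_ae (Filter.Eventually.of_forall fun ζ => ?_)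
  simp only [scaledCoord, scaledDeriv, smul_sub]
  exact sum_smul_eq_dotC _ _ _

theorem integrable_fourierChar_smul {f : R3 → F} (hf : Integrable f) (x : R3) :
    Integrable fun v : R3 =>
      Complex.exp (((2 * Real.pi * inner ℝ v x : ℝ) : ℂ) * Complex.I) • f v := by
  have hc : Continuous fun v : R3 =>
      Complex.exp (((2 * Real.pi * inner ℝ v x : ℝ) : ℂ) * Complex.I) := by fun_prop
  refine hf.bdd_smul 1 hc.aestronglyMeasurable (Filter.Eventually.of_forall fun v => ?_)
  rw [Complex.norm_exp_ofReal_mul_I]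

theorem fourierInv_sum {ι : Type*} (t : Finset ι) {f : ι → R3 → F}
    (hf : ∀ i, Integrable (f i)) (x : R3) :
    𝓕⁻ (fun η => ∑ i ∈ t, f i η) x = ∑ i ∈ t, 𝓕⁻ (f i) x := by
  simp_rw [Real.fourierInv_eq', Finset.smul_sum]
  exact integral_finsetSum _ fun i _ => integrable_fourierChar_smul (hf i) x

theorem invFourier_apply {U : R3 → C3} (hU : Integrable U) (x : R3) (j : Fin 3) :
    invFourier U x j = 𝓕⁻ (scaledCoord U j) x := by
  unfold invFourier
  rw [Real.fourierInv_eq', Real.fourierInv_eq']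
  have hi := integrable_fourierChar_smul (integrable_comp_two_pi_smul hU) x
  exact ((EuclideanSpace.proj j : C3 →L[ℂ] ℂ).integral_comp_comm hi).symm

/-- The transport term `u·∇w` is defined, and its Fourier transform is `convAdvection U W`, when `u`
is divergence free with integrable transform and `∇w` has integrable transform. -/
theorem HasFourier.advection {u : 𝓢'(R3, C3)} {w : 𝓢'(R3, F)} {U : R3 → C3} {W : R3 → F}
    (hu : HasFourier u U) (hw : HasFourier w W) (hU : Integrable U)
    (hW : ∀ j : Fin 3, Integrable fun ξ : R3 => (Complex.I * (ξ j : ℂ)) • W ξ)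
    (hdiv : ∀ᵐ ξ, dotC ξ (U ξ) = 0) :
    Integrable (convAdvection U W) ∧ AdvectionDefined u w ∧
      HasFourier (advection u w) (convAdvection U W) := by
  have hWj : ∀ j, Integrable (scaledDeriv W j) := fun j => integrable_comp_two_pi_smul (hW j)
  have hUj := integrable_scaledCoord hU
  have hsum := sum_convolution_ae_eq hU hWj hdiv
  have hconv := fun j => integrable_convolution_smul (hUj j) (hWj j)
  have hint : Integrable (convAdvection U W) := by
    rw [← integrable_comp_smul_iff volume _ two_pi_ne]
    exact (integrable_finsetSum _ fun j _ => hconv j).congr hsum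
  have hN := hasFourier_ofFourier hint
  -- in physical space the convolution is the sum of pointwise products
  have hfun : invFourier (convAdvection U W) = fun x => ∑ j, invFourier U x j •
      invFourier (fun ξ : R3 => (Complex.I * (ξ j : ℂ)) • W ξ) x := by
    funext x
    have h1 : ∀ j, invFourier U x j • invFourier (fun ξ : R3 => (Complex.I * (ξ j : ℂ)) • W ξ) x =
        𝓕⁻ (fun η : R3 => ∫ ζ : R3, scaledCoord U j (η - ζ) • scaledDeriv W j ζ) x := fun j => by
      rw [invFourier_apply hU, fourierInv_convolution (hUj j) (hWj j)]
      rfl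
    simp_rw [h1]
    unfold invFourier
    rw [Real.fourierInv_eq_fourier_neg, Real.fourier_congr_ae hsum.symm,
      ← Real.fourierInv_eq_fourier_neg]
    exact fourierInv_sum _ hconv x
  have hadv : IsAdvection u w (ofFourier (convAdvection U W)) := by
    refine ⟨invFourier U, fun j => invFourier fun ξ : R3 => (Complex.I * (ξ j : ℂ)) • W ξ,
      hu.isFunction hU, fun j => (hw.lineDeriv j).isFunction (hW j), ?_⟩
    rw [← hfun]
    exact hN.isFunction hint
  refine ⟨hint, ⟨_, hadv, _, hN⟩, ?_⟩
  rw [hadv.advection_eq]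
  exact hN

end

/-! ### Duhamel's formula for distributions and in frequency -/

section

set_option linter.unusedSectionVars false

variable {F : Type*} [NormedAddCommGroup F] [NormedSpace ℂ F] [CompleteSpace F]

theorem HasFourier.neg {f : 𝓢'(R3, F)} {g : R3 → F} (hf : HasFourier f g) :
    HasFourier (-f) (-g) := by
  simpa using hf.smul (-1)

theorem HasFourier.sub {f f' : 𝓢'(R3, F)} {g g' : R3 → F} (hf : HasFourier f g)
    (hf' : HasFourier f' g') : HasFourier (f - f') (g - g') := by
  simpa [sub_eq_add_neg] using hf.add hf'.neg

/-- The pairing with a test function in terms of the unscaled Fourier transform. -/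
theorem HasFourier.apply_eq {f : 𝓢'(R3, F)} {g : R3 → F} (hf : HasFourier f g) (φ : 𝓢(R3, ℂ)) :
    f φ = ((((2 * Real.pi) ^ 3)⁻¹ : ℝ) : ℂ) •
      ∫ ξ : R3, (𝓕⁻ φ) ((2 * Real.pi)⁻¹ • ξ) • g ξ := by
  have h1 : f φ = 𝓕 f (𝓕⁻ φ) := by
    rw [TemperedDistribution.fourier_apply, FourierTransform.fourier_fourierInv_eq]
  rw [h1, (hf.2 _).2, ← integral_comp_two_pi]
  simp only [inv_smul_smul₀ two_pi_ne]

/-- Integrals in time of distributions are computed in frequency. -/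
theorem exists_hasFourier_integral {H : ℝ → 𝓢'(R3, F)} {h : ℝ → R3 → F} {t : ℝ} (ht : 0 ≤ t)
    (hi : Integrable (Function.uncurry h) ((volume.restrict (Ioc 0 t)).prod volume))
    (hH : ∀ᵐ τ ∂(volume.restrict (Ioc 0 t)), HasFourier (H τ) (h τ)) :
    ∃ D : 𝓢'(R3, F), HasFourier D (fun ξ => ∫ τ in Ioc 0 t, h τ ξ) ∧
      ∀ φ, IntervalIntegrable (fun τ => H τ φ) volume 0 t ∧ (∫ τ in (0 : ℝ)..t, H τ φ) = D φ := by
  have hD := hasFourier_ofFourier hi.integral_prod_right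
  refine ⟨_, hD, fun φ => ?_⟩
  set ψ : R3 → ℂ := fun ξ => (𝓕⁻ φ) ((2 * Real.pi)⁻¹ • ξ) with hψ
  have hψc : Continuous ψ := (𝓕⁻ φ).continuous.comp (continuous_const_smul _)
  have hi' : Integrable (fun p : ℝ × R3 => ψ p.2 • h p.1 p.2)
      ((volume.restrict (Ioc 0 t)).prod volume) :=
    hi.bdd_smul _ (hψc.comp continuous_snd).aestronglyMeasurable
      (Filter.Eventually.of_forall fun p =>
        (𝓕⁻ φ).toBoundedContinuousFunction.norm_coe_le_norm _)
  have he : (fun τ => ((((2 * Real.pi) ^ 3)⁻¹ : ℝ) : ℂ) • ∫ ξ, ψ ξ • h τ ξ)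
      =ᵐ[volume.restrict (Ioc 0 t)] fun τ => H τ φ := by
    filter_upwards [hH] with τ hτ
    rw [hτ.apply_eq φ]
  refine ⟨?_, ?_⟩
  · rw [intervalIntegrable_iff_integrableOn_Ioc_of_le ht]
    exact (hi'.integral_prod_left.smul _).congr he
  · rw [intervalIntegral.integral_of_le ht, ← integral_congr_ae he, integral_smul, hD.apply_eq φ,
      integral_integral_swap (f := fun τ ξ => ψ ξ • h τ ξ) hi']
    congr 1
    refine integral_congr_ae (Filter.Eventually.of_forall fun ξ => ?_)
    exact integral_smul _ _

variable {T γ t : ℝ} {G : ℝ → R3 → F}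

/-- The integral term of Duhamel's formula, as a distribution. -/
theorem exists_hasFourier_duhamel {J : ℝ → 𝓢'(R3, F)}
    (hG : StronglyMeasurable (Function.uncurry G))
    (hi : Integrable (Function.uncurry G) ((volume.restrict (Icc 0 T)).prod volume))
    (hJ : ∀ᵐ τ ∂(volume.restrict (Icc 0 T)), HasFourier (J τ) (G τ)) (ht : t ∈ Icc 0 T) :
    ∃ D : 𝓢'(R3, F),
      HasFourier D (fun ξ => ∫ τ in Ioc 0 t, (heatSymbol γ (t - τ) ξ : ℂ) • G τ ξ) ∧
      ∀ φ, IntervalIntegrable (fun τ => heat γ (t - τ) (J τ) φ) volume 0 t ∧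
        (∫ τ in (0 : ℝ)..t, heat γ (t - τ) (J τ) φ) = D φ := by
  have hle : volume.restrict (Ioc 0 t) ≤ volume.restrict (Icc 0 T) :=
    Measure.restrict_mono (Ioc_subset_Icc_of_le ht.2) le_rfl
  have hi' : Integrable (Function.uncurry G) ((volume.restrict (Ioc 0 t)).prod volume) :=
    hi.mono_measure (Measure.prod_mono hle le_rfl)
  refine exists_hasFourier_integral ht.1 (h := fun τ ξ => (heatSymbol γ (t - τ) ξ : ℂ) • G τ ξ)
    ?_ ?_
  · refine hi'.mono ?_ ?_
    · have : Measurable fun p : ℝ × R3 => (heatSymbol γ (t - p.1) p.2 : ℂ) :=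
        Complex.measurable_ofReal.comp ((measurable_heatSymbol γ).comp
          (by fun_prop : Measurable fun p : ℝ × R3 => (t - p.1, p.2)))
      exact this.aestronglyMeasurable.smul hG.aestronglyMeasurable
    · have hmem : ∀ᵐ p ∂(volume.restrict (Ioc 0 t)).prod (volume : Measure R3), p.1 ∈ Ioc 0 t :=
        Measure.quasiMeasurePreserving_fst.ae (ae_restrict_mem measurableSet_Ioc)
      filter_upwards [hmem] with p hp
      rw [← enorm_le_iff_norm_le]
      exact enorm_heatSymbol_smul_le γ (sub_nonneg.mpr hp.2) p.2 _
  · filter_upwards [ae_mono hle hJ, ae_restrict_mem measurableSet_Ioc, hi'.prod_right_ae]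
      with τ h1 h2 h3
    exact (HasFourier.heat (sub_nonneg.mpr h2.2) h1 h3).2

end

section

set_option linter.unusedSectionVars false

variable {a s σ K T ε M α β γ : ℝ} {F : Type*} [NormedAddCommGroup F] [NormedSpace ℂ F]
  [CompleteSpace F]

theorem WeightBounds.integrable_coord_smul (hK : WeightBounds a s σ K) {W : R3 → F}
    (hW : StronglyMeasurable W) (h : freqNorm a σ (s + 1) W < ∞) (j : Fin 3) :
    Integrable fun ξ : R3 => (Complex.I * (ξ j : ℂ)) • W ξ := by
  have hc : Continuous fun ξ : R3 => Complex.I * (ξ j : ℂ) := by fun_prop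
  refine hK.integrable (hc.aestronglyMeasurable.smul hW.aestronglyMeasurable)
    (lt_of_le_of_lt (lintegral_mono_ae ?_) h)
  filter_upwards [ae_ne_zero] with ξ hξ
  rw [weight_add _ _ _ _ hξ, Real.rpow_one, mul_comm ‖ξ‖,
    ENNReal.ofReal_mul (weight_nonneg _ _ _ _), mul_assoc, enorm_smul]
  gcongr
  rw [← ofReal_norm]
  refine ENNReal.ofReal_le_ofReal ?_
  rw [norm_mul, Complex.norm_I, one_mul, Complex.norm_real]
  exact PiLp.norm_apply_le ξ j

theorem YoungBound.ae_freqNorm_lt_top (hγ : YoungBound γ ε M) (hT : 0 ≤ T) {W : ℝ → R3 → F}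
    (hW : StronglyMeasurable (Function.uncurry W)) (h : energy a σ s γ T W < ∞) :
    ∀ᵐ t ∂(volume.restrict (Icc 0 T)), freqNorm a σ (s + 1) (W t) < ∞ :=
  ae_lt_top (measurable_freqNorm hW) ((timeNorm_add_one_le hT hγ.eps_nonneg hγ.const_nonneg hγ.le
    hW).trans_lt (ENNReal.mul_lt_top ENNReal.ofReal_lt_top h)).ne

/-- At almost every time the transport term of a divergence free state is defined, and its
Fourier transform is a convolution. -/
theorem WeightBounds.ae_hasFourier_advection (hK : WeightBounds a s σ K) (hT : 0 ≤ T)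
    (hγ : YoungBound γ ε M) {U : ℝ → R3 → C3} {W : ℝ → R3 → F} {u : ℝ → 𝓢'(R3, C3)}
    {w : ℝ → 𝓢'(R3, F)}
    (hU : StronglyMeasurable (Function.uncurry U)) (hW : StronglyMeasurable (Function.uncurry W))
    (eU : energy a σ s α T U < ∞) (eW : energy a σ s γ T W < ∞)
    (hu : ∀ t ∈ Icc 0 T, HasFourier (u t) (U t)) (hw : ∀ t ∈ Icc 0 T, HasFourier (w t) (W t))
    (hdiv : ∀ t ∈ Icc 0 T, ∀ᵐ ξ, dotC ξ (U t ξ) = 0) :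
    ∀ᵐ t ∂(volume.restrict (Icc 0 T)), Integrable (convAdvection (U t) (W t)) ∧
      AdvectionDefined (u t) (w t) ∧
      HasFourier (advection (u t) (w t)) (convAdvection (U t) (W t)) := by
  filter_upwards [hγ.ae_freqNorm_lt_top hT hW eW, ae_restrict_mem measurableSet_Icc] with t h1 ht
  exact (hu t ht).advection (hw t ht) (hK.integrable_of_energy hU eU ht)
    (hK.integrable_coord_smul (stronglyMeasurable_of_uncurry hW t) h1) (hdiv t ht)

/-- A state in frequency of finite energy, together with the distributions it represents. -/
structure Represents (a s σ α β T : ℝ) (u : ℝ → 𝓢'(R3, C3)) (θ : ℝ → 𝓢'(R3, ℂ))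
    (U : ℝ → R3 → C3) (Θ : ℝ → R3 → ℂ) : Prop where
  meas_u : StronglyMeasurable (Function.uncurry U)
  meas_θ : StronglyMeasurable (Function.uncurry Θ)
  energy_lt : totalEnergy a σ s α β T U Θ < ∞
  fourier_u : ∀ t ∈ Icc 0 T, HasFourier (u t) (U t)
  fourier_θ : ∀ t ∈ Icc 0 T, HasFourier (θ t) (Θ t)

variable {u : ℝ → 𝓢'(R3, C3)} {θ : ℝ → 𝓢'(R3, ℂ)} {U : ℝ → R3 → C3} {Θ : ℝ → R3 → ℂ}
  {u₀ : 𝓢'(R3, C3)} {θ₀ : 𝓢'(R3, ℂ)} {g : R3 → C3} {h : R3 → ℂ}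

/-- The integral terms of the mild formulation, as distributions with their Fourier transforms. -/
theorem Represents.duhamel_terms (hR : Represents a s σ α β T u θ U Θ) (hK : WeightBounds a s σ K)
    (hT : 0 ≤ T) (hα : YoungBound α ε M) (hβ : YoungBound β ε M)
    (hdiv : ∀ t ∈ Icc 0 T, ∀ᵐ ξ, dotC ξ (U t ξ) = 0)
    (hu₀ : HasFourier u₀ g) (hθ₀ : HasFourier θ₀ h) (hg : Integrable g) (hh : Integrable h) :
    (∀ᵐ t ∂(volume.restrict (Icc 0 T)), AdvectionDefined (u t) (u t)) ∧
    (∀ᵐ t ∂(volume.restrict (Icc 0 T)), AdvectionDefined (u t) (θ t)) ∧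
    ∀ t ∈ Icc 0 T, ∃ (D₁ D₂ : 𝓢'(R3, C3)) (D₃ : 𝓢'(R3, ℂ)),
      HasFourier (heat α t u₀ - D₁ + D₂)
        (duhamel α g (fun τ => forceU (U τ) (Θ τ)) t) ∧
      HasFourier (heat β t θ₀ - D₃) (duhamel β h (fun τ => forceΘ (U τ) (Θ τ)) t) ∧
      (∀ φ, IntervalIntegrable (fun τ => heat α (t - τ) (leray (advection (u τ) (u τ))) φ)
        volume 0 t ∧ ∫ τ in (0 : ℝ)..t, heat α (t - τ) (leray (advection (u τ) (u τ))) φ = D₁ φ) ∧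
      (∀ φ, IntervalIntegrable (fun τ => heat α (t - τ) (leray (buoyancy (θ τ))) φ)
        volume 0 t ∧ ∫ τ in (0 : ℝ)..t, heat α (t - τ) (leray (buoyancy (θ τ))) φ = D₂ φ) ∧
      (∀ φ, IntervalIntegrable (fun τ => heat β (t - τ) (advection (u τ) (θ τ)) φ)
        volume 0 t ∧ ∫ τ in (0 : ℝ)..t, heat β (t - τ) (advection (u τ) (θ τ)) φ = D₃ φ) := by
  obtain ⟨eU, eΘ⟩ := ENNReal.add_lt_top.mp hR.energy_lt
  have hU := hR.meas_u
  have hΘ := hR.meas_θ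
  have fin : ∀ {x y z : ℝ≥0∞} (c : ℝ), x ≤ ENNReal.ofReal c * (y * z) → y < ∞ → z < ∞ → x < ∞ :=
    fun c h1 h2 h3 => h1.trans_lt (ENNReal.mul_lt_top ENNReal.ofReal_lt_top
      (ENNReal.mul_lt_top h2 h3))
  have a1 := hK.ae_hasFourier_advection hT hα hU hU eU eU hR.fourier_u hR.fourier_u hdiv
  have a3 := hK.ae_hasFourier_advection hT hβ hU hΘ eU eΘ hR.fourier_u hR.fourier_θ hdiv
  have m1 := stronglyMeasurable_convAdvection hU hU
  have m3 := stronglyMeasurable_convAdvection hU hΘ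
  have m1' : StronglyMeasurable (Function.uncurry fun τ ξ =>
    leraySymbol ξ (convAdvection (U τ) (U τ) ξ)) := stronglyMeasurable_leraySymbol m1
  have m2' : StronglyMeasurable (Function.uncurry fun τ ξ =>
      leraySymbol ξ (Θ τ ξ • (EuclideanSpace.single 2 1 : C3))) :=
    stronglyMeasurable_leraySymbol (hΘ.smul_const _)
  have n1 : timeNorm a σ s T (fun τ ξ => leraySymbol ξ (convAdvection (U τ) (U τ) ξ)) < ∞ :=
    (timeNorm_mono fun t ξ => enorm_leraySymbol_le _ _).trans_lt
      (fin _ (hK.timeNorm_convAdvection_le hT hα hα hU hU) eU eU)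
  have n3 : timeNorm a σ s T (fun τ => convAdvection (U τ) (Θ τ)) < ∞ :=
    fin _ (hK.timeNorm_convAdvection_le hT hα hβ hU hΘ) eU eΘ
  have n2 : timeNorm a σ s T (fun τ ξ =>
      leraySymbol ξ (Θ τ ξ • (EuclideanSpace.single 2 1 : C3))) < ∞ := by
    refine (timeNorm_mono (g := Θ) fun t ξ => ?_).trans_lt
      ((lintegral_freqNorm_le_energy (γ := β)).trans_lt
        (ENNReal.mul_lt_top ENNReal.ofReal_lt_top eΘ))
    refine (enorm_leraySymbol_le _ _).trans_eq ?_
    rw [enorm_smul, norm_single_two, mul_one]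
  refine ⟨a1.mono fun t ht => ht.2.1, a3.mono fun t ht => ht.2.1, fun t ht => ?_⟩
  obtain ⟨D₁, d1, e1⟩ := exists_hasFourier_duhamel (γ := α)
    (J := fun τ => leray (advection (u τ) (u τ))) m1' (hK.integrable_uncurry m1' n1)
    (a1.mono fun τ hτ => (hτ.2.2.leray hτ.1).2) ht
  obtain ⟨D₂, d2, e2⟩ := exists_hasFourier_duhamel (γ := α)
    (J := fun τ => leray (buoyancy (θ τ))) m2' (hK.integrable_uncurry m2' n2) (by
      filter_upwards [ae_restrict_mem measurableSet_Icc] with τ hτ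
      exact ((hR.fourier_θ τ hτ).buoyancy.leray
        ((hK.integrable_of_energy hΘ eΘ hτ).smul_const _)).2) ht
  obtain ⟨D₃, d3, e3⟩ := exists_hasFourier_duhamel (γ := β)
    (J := fun τ => advection (u τ) (θ τ)) m3 (hK.integrable_uncurry m3 n3)
    (a3.mono fun τ hτ => hτ.2.2) ht
  refine ⟨D₁, D₂, D₃, ?_, ?_, e1, e2, e3⟩
  · refine (((hu₀.heat ht.1 hg).2.sub d1).add d2).congr ?_
    filter_upwards [hK.ae_integrable m1' n1, hK.ae_integrable m2' n2] with ξ i1 i2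
    have j1 := integrableOn_heatSymbol_smul (γ := α)
      (G := fun τ ξ => leraySymbol ξ (convAdvection (U τ) (U τ) ξ)) i1 ht
    have j2 := integrableOn_heatSymbol_smul (γ := α)
      (G := fun τ ξ => leraySymbol ξ (Θ τ ξ • (EuclideanSpace.single 2 1 : C3))) i2 ht
    simp only [Pi.add_apply, Pi.sub_apply, duhamel, forceU, neg_add_eq_sub, smul_sub]
    rw [integral_sub j2 j1]
    abel
  · refine ((hθ₀.heat ht.1 hh).2.sub d3).congr (Filter.Eventually.of_forall fun ξ => ?_)
    simp only [Pi.sub_apply, duhamel, forceΘ, smul_neg]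
    rw [integral_neg, sub_eq_add_neg]

/-- The Fourier transform of a mild solution solves the system in frequency. -/
theorem Represents.isFourierSolution_of_isMildSolution (hR : Represents a s σ α β T u θ U Θ)
    (hK : WeightBounds a s σ K)
    (hT : 0 ≤ T) (hα : YoungBound α ε M) (hβ : YoungBound β ε M)
    (hu₀ : HasFourier u₀ g) (hθ₀ : HasFourier θ₀ h) (hg : Integrable g) (hh : Integrable h)
    (hm : IsMildSolution α β T u₀ θ₀ u θ) : IsFourierSolution α β T g h U Θ := by
  have hdiv : ∀ t ∈ Icc 0 T, ∀ᵐ ξ, dotC ξ (U t ξ) = 0 := fun t ht =>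
    (isDivFree_iff (hR.fourier_u t ht)).mp (hm.divFree t ht)
  obtain ⟨-, -, h1⟩ := hR.duhamel_terms hK hT hα hβ hdiv hu₀ hθ₀ hg hh
  refine ⟨hR.meas_u, hR.meas_θ, fun t ht => ?_, fun t ht => ?_⟩
  · obtain ⟨D₁, D₂, D₃, f1, -, e1, e2, -⟩ := h1 t ht
    have : u t = heat α t u₀ - D₁ + D₂ := by
      ext φ
      rw [hm.duhamel_u t ht φ, (e1 φ).2, (e2 φ).2]
      rfl
    exact HasFourier.ae_eq (hR.fourier_u t ht) (this ▸ f1)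
  · obtain ⟨D₁, D₂, D₃, -, f3, -, -, e3⟩ := h1 t ht
    have : θ t = heat β t θ₀ - D₃ := by
      ext φ
      rw [hm.duhamel_θ t ht φ, (e3 φ).2]
      rfl
    exact HasFourier.ae_eq (hR.fourier_θ t ht) (this ▸ f3)

/-- Conversely, a solution in frequency with divergence free data represents a mild solution. -/
theorem Represents.isMildSolution (hR : Represents a s σ α β T u θ U Θ)
    (hK : WeightBounds a s σ K)
    (hT : 0 ≤ T) (hα : YoungBound α ε M) (hβ : YoungBound β ε M)
    (hu₀ : HasFourier u₀ g) (hθ₀ : HasFourier θ₀ h) (hg : Integrable g) (hh : Integrable h)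
    (hdiv₀ : ∀ᵐ ξ, dotC ξ (g ξ) = 0) (hsol : IsFourierSolution α β T g h U Θ) :
    IsMildSolution α β T u₀ θ₀ u θ := by
  -- the projected forces are divergence free, so the divergence free condition propagates
  have hdiv : ∀ t ∈ Icc 0 T, ∀ᵐ ξ, dotC ξ (U t ξ) = 0 := fun t ht => by
    filter_upwards [hsol.eq_u t ht, hdiv₀] with ξ h1 h2
    have h3 : ∀ (v : C3), dotC ξ v = innerSL ℂ (cvec ξ) v := fun v => dotC_eq_inner ξ v
    have h4 : ∀ τ, dotC ξ ((heatSymbol α (t - τ) ξ : ℂ) • forceU (U τ) (Θ τ) ξ) = 0 := fun τ => by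
      rw [dotC_smul, forceU, dotC_add, ← neg_one_smul ℂ, dotC_smul, dotC_leraySymbol,
        dotC_leraySymbol]
      simp
    rw [h1, duhamel, dotC_add, dotC_smul, h2, mul_zero, zero_add]
    by_cases hi : IntegrableOn
        (fun τ => (heatSymbol α (t - τ) ξ : ℂ) • forceU (U τ) (Θ τ) ξ) (Ioc 0 t)
    · rw [h3, ← ContinuousLinearMap.integral_comp_comm _ hi]
      simp_rw [← h3, h4, integral_zero]
    · rw [integral_undef hi]
      simp [dotC]
  obtain ⟨a1, a2, h1⟩ := hR.duhamel_terms hK hT hα hβ hdiv hu₀ hθ₀ hg hh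
  refine ⟨fun t ht => (isDivFree_iff (hR.fourier_u t ht)).mpr (hdiv t ht), a1, a2,
    ?_, ?_, ?_, ?_, ?_⟩
  · intro t ht φ
    obtain ⟨D₁, D₂, D₃, -, -, e1, -, -⟩ := h1 t ht
    exact (e1 φ).1
  · intro t ht φ
    obtain ⟨D₁, D₂, D₃, -, -, -, e2, -⟩ := h1 t ht
    exact (e2 φ).1
  · intro t ht φ
    obtain ⟨D₁, D₂, D₃, -, -, -, -, e3⟩ := h1 t ht
    exact (e3 φ).1
  · intro t ht φ
    obtain ⟨D₁, D₂, D₃, f1, -, e1, e2, -⟩ := h1 t ht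
    rw [(hR.fourier_u t ht).unique f1 (hsol.eq_u t ht), (e1 φ).2, (e2 φ).2]
    rfl
  · intro t ht φ
    obtain ⟨D₁, D₂, D₃, -, f3, -, -, e3⟩ := h1 t ht
    rw [(hR.fourier_θ t ht).unique f3 (hsol.eq_θ t ht), (e3 φ).2]
    rfl

end

/-! ### Regularity in time -/

section

set_option linter.unusedSectionVars false

variable {F : Type*} [NormedAddCommGroup F] [NormedSpace ℂ F] [CompleteSpace F]
  {a s r σ K T γ : ℝ}

open Classical in
/-- The distribution `ofFourier g` as an element of the Lei-Lin-Gevrey space (and `0` if its norm is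
infinite). -/
def toSpace (a σ r : ℝ) (g : R3 → F) : LeiLinGevrey F a σ r :=
  if h : xNorm a σ r (ofFourier g) < ∞ then ⟨ofFourier g, h⟩ else 0

theorem xNorm_ofFourier {g : R3 → F} (hg : Integrable g) :
    xNorm a σ r (ofFourier g) = freqNorm a σ r g := (hasFourier_ofFourier hg).xNorm_eq a σ r

theorem toDist_toSpace {g : R3 → F} (hg : Integrable g) (h : freqNorm a σ r g < ∞) :
    (toSpace a σ r g).toDist = ofFourier g := by
  rw [← xNorm_ofFourier hg] at h
  have h' : toSpace a σ r g = ⟨ofFourier g, h⟩ := dif_pos h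
  rw [h']
  rfl

theorem enorm_leiLinGevrey (f : LeiLinGevrey F a σ r) : ‖f‖ₑ = xNorm a σ r f.toDist := by
  rw [← ofReal_norm]
  exact ENNReal.ofReal_toReal (show xNorm a σ r f.toDist < ∞ from f.2).ne

theorem enorm_toSpace {g : R3 → F} (hg : Integrable g) (h : freqNorm a σ r g < ∞) :
    ‖toSpace a σ r g‖ₑ = freqNorm a σ r g := by
  rw [enorm_leiLinGevrey, toDist_toSpace hg h, xNorm_ofFourier hg]

/-- The distance in the Lei-Lin-Gevrey space is computed in frequency. -/
theorem edist_toSpace {g g' : R3 → F} (hg : Integrable g) (h : freqNorm a σ r g < ∞)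
    (hg' : Integrable g') (h' : freqNorm a σ r g' < ∞) :
    edist (toSpace a σ r g) (toSpace a σ r g') = freqNorm a σ r (g - g') := by
  rw [edist_eq_enorm_sub, enorm_leiLinGevrey]
  have h1 : (toSpace a σ r g - toSpace a σ r g').toDist = ofFourier g - ofFourier g' := by
    rw [← toDist_toSpace hg h, ← toDist_toSpace hg' h']
    rfl
  rw [h1, ((hasFourier_ofFourier hg).sub (hasFourier_ofFourier hg')).xNorm_eq]
  rfl

/-- At a fixed frequency, Duhamel's formula is continuous in time. -/
theorem continuousOn_duhamel {g : R3 → F} {G : ℝ → R3 → F} {ξ : R3}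
    (h : IntegrableOn (fun t => G t ξ) (Icc 0 T)) :
    ContinuousOn (fun t => duhamel γ g G t ξ) (Icc 0 T) := by
  have hc : Continuous fun t => (heatSymbol γ t ξ : ℂ) := by
    unfold heatSymbol
    fun_prop
  have hc' : Continuous fun t => (heatSymbol γ (-t) ξ : ℂ) := hc.comp continuous_neg
  have h1 : IntegrableOn (fun τ => (heatSymbol γ (-τ) ξ : ℂ) • G τ ξ) (Icc 0 T) :=
    h.continuousOn_smul hc'.continuousOn isCompact_Icc
  have h2 := intervalIntegral.continuousOn_primitive h1
  -- factoring out `e^{-t|ξ|^{2γ}}` turns the integral into a primitive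
  have h3 : ∀ t, duhamel γ g G t ξ = (heatSymbol γ t ξ : ℂ) • g ξ
      + (heatSymbol γ t ξ : ℂ) • ∫ τ in Ioc 0 t, (heatSymbol γ (-τ) ξ : ℂ) • G τ ξ := fun t => by
    rw [duhamel, ← integral_smul]
    congr 2
    funext τ
    rw [smul_smul, ← Complex.ofReal_mul, heatSymbol, heatSymbol, heatSymbol, ← Real.exp_add]
    congr 4
    ring
  simp_rw [h3]
  exact (hc.continuousOn.smul continuousOn_const).add (hc.continuousOn.smul h2)

/-- Duhamel's formula gives a continuous curve in `X^s`. -/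
theorem WeightBounds.tendsto_freqNorm_duhamel (hK : WeightBounds a s σ K) {g : R3 → F}
    {G : ℝ → R3 → F} (hg : StronglyMeasurable g) (hG : StronglyMeasurable (Function.uncurry G))
    (hgn : freqNorm a σ s g < ∞) (hGn : timeNorm a σ s T G < ∞) {t₀ : ℝ} (ht₀ : t₀ ∈ Icc 0 T) :
    Filter.Tendsto (fun t => freqNorm a σ s (duhamel γ g G t - duhamel γ g G t₀))
      (nhdsWithin t₀ (Icc 0 T)) (nhds 0) := by
  have hm := stronglyMeasurable_duhamel (γ := γ) hg hG
  -- dominated convergence in `ξ`, with a dominating function uniform in `t`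
  set B : R3 → ℝ≥0∞ := fun ξ => ‖g ξ‖ₑ + ∫⁻ τ in Icc 0 T, ‖G τ ξ‖ₑ with hB
  have hlim := tendsto_lintegral_filter_of_dominated_convergence (μ := volume)
    (l := nhdsWithin t₀ (Icc 0 T))
    (F := fun t ξ => ENNReal.ofReal (weight a σ s ξ) * ‖(duhamel γ g G t - duhamel γ g G t₀) ξ‖ₑ)
    (f := fun _ => 0)
    (fun ξ => 2 * (ENNReal.ofReal (weight a σ s ξ) * B ξ))
    (Filter.Eventually.of_forall fun t => measurable_weight_mul_enorm a σ s
      ((stronglyMeasurable_of_uncurry hm t).sub (stronglyMeasurable_of_uncurry hm t₀)))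
    (by
      filter_upwards [self_mem_nhdsWithin] with t ht
      refine Filter.Eventually.of_forall fun ξ => ?_
      rw [mul_left_comm]
      gcongr
      rw [two_mul]
      exact enorm_sub_le.trans (add_le_add (enorm_duhamel_le ht ξ) (enorm_duhamel_le ht₀ ξ)))
    (by
      rw [lintegral_const_mul' _ _ (by simp), lintegral_weight_mul_add hg hG]
      exact ENNReal.mul_ne_top (by simp) (ENNReal.add_lt_top.mpr ⟨hgn, hGn⟩).ne)
    (by
      filter_upwards [hK.ae_integrable hG hGn] with ξ hξ
      have h1 := (continuousOn_duhamel (γ := γ) (g := g) hξ) t₀ ht₀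
      have h2 : Filter.Tendsto (fun t => ‖(duhamel γ g G t - duhamel γ g G t₀) ξ‖ₑ)
          (nhdsWithin t₀ (Icc 0 T)) (nhds 0) := by
        have h3 := (h1.tendsto.sub_const (duhamel γ g G t₀ ξ)).enorm
        simpa using h3
      simpa using ENNReal.Tendsto.const_mul h2 (Or.inr ENNReal.ofReal_ne_top))
  simpa [freqNorm] using hlim

/-- A curve of finite energy, continuous in `X^s`, in terms of Fourier transforms. -/
structure IsContinuousCurve (a σ s γ T : ℝ) (V : ℝ → R3 → F) : Prop where
  meas : StronglyMeasurable (Function.uncurry V)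
  energy_lt : energy a σ s γ T V < ∞
  tendsto : ∀ t₀ ∈ Icc 0 T, Filter.Tendsto (fun t => freqNorm a σ s (V t - V t₀))
    (nhdsWithin t₀ (Icc 0 T)) (nhds 0)

variable {V : ℝ → R3 → F} {u : ℝ → 𝓢'(R3, F)}

theorem IsContinuousCurve.memC (hV : IsContinuousCurve a σ s γ T V) (hK : WeightBounds a s σ K)
    (hu : ∀ t ∈ Icc 0 T, HasFourier (u t) (V t)) : MemC a σ s T u := by
  have hi := fun t ht => hK.integrable_of_energy hV.meas hV.energy_lt (t := t) ht
  have hn := fun t (ht : t ∈ Icc 0 T) => (freqNorm_le_energy ht).trans_lt hV.energy_lt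
  refine ⟨fun t => toSpace a σ s (V t), fun t₀ ht₀ => ?_, fun t ht => ?_⟩
  · rw [ContinuousWithinAt, tendsto_iff_edist_tendsto_0]
    refine (hV.tendsto t₀ ht₀).congr' ?_
    filter_upwards [self_mem_nhdsWithin] with t ht
    rw [edist_toSpace (hi t ht) (hn t ht) (hi t₀ ht₀) (hn t₀ ht₀)]
  · rw [toDist_toSpace (hi t ht) (hn t ht)]
    exact (hasFourier_ofFourier (hi t ht)).unique (hu t ht) (Filter.EventuallyEq.refl _ _)

/-- Truncation of a function of the frequency to the ball of radius `n`. -/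
def truncate (n : ℕ) (g : R3 → F) : R3 → F := (Metric.closedBall 0 (n : ℝ)).indicator g

theorem freqNorm_truncate_le (hr : 0 ≤ r) (n : ℕ) (g : R3 → F) :
    freqNorm a σ (s + r) (truncate n g) ≤ ENNReal.ofReal ((n : ℝ) ^ r) * freqNorm a σ s g := by
  unfold freqNorm
  rw [← lintegral_const_mul' _ _ ENNReal.ofReal_ne_top]
  refine lintegral_mono_ae ?_
  filter_upwards [ae_ne_zero] with ξ hξ
  by_cases h : ξ ∈ Metric.closedBall (0 : R3) n
  · rw [truncate, indicator_of_mem h, weight_add _ _ _ _ hξ, ← mul_assoc,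
      ENNReal.ofReal_mul (by positivity)]
    have h1 : ‖ξ‖ ^ r ≤ (n : ℝ) ^ r :=
      Real.rpow_le_rpow (norm_nonneg _) (by simpa using h) hr
    exact mul_le_mul_left (mul_le_mul_left (ENNReal.ofReal_le_ofReal h1) _) _
  · rw [truncate, indicator_of_notMem h]
    simp

theorem tendsto_truncate {g : R3 → F} (hg : StronglyMeasurable g) (h : freqNorm a σ r g < ∞) :
    Filter.Tendsto (fun n => freqNorm a σ r (truncate n g - g)) Filter.atTop (nhds 0) := by
  have hlim := tendsto_lintegral_of_dominated_convergence (μ := volume)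
    (F := fun n ξ => ENNReal.ofReal (weight a σ r ξ) * ‖(truncate n g - g) ξ‖ₑ)
    (f := fun _ => 0) (fun ξ => ENNReal.ofReal (weight a σ r ξ) * ‖g ξ‖ₑ)
    (fun n => measurable_weight_mul_enorm a σ r
      ((hg.indicator Metric.isClosed_closedBall.measurableSet).sub hg))
    (fun n => Filter.Eventually.of_forall fun ξ => by
      refine mul_le_mul_right ?_ _
      by_cases hξ : ξ ∈ Metric.closedBall (0 : R3) n
      · simp [truncate, indicator_of_mem hξ]
      · simp [truncate, indicator_of_notMem hξ]) h.ne
    (Filter.Eventually.of_forall fun ξ => by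
      refine tendsto_const_nhds.congr' ?_
      obtain ⟨N, hN⟩ := exists_nat_ge ‖ξ‖
      filter_upwards [Filter.eventually_ge_atTop N] with n hn
      have hξ : ξ ∈ Metric.closedBall (0 : R3) n := by
        simpa using hN.trans (by exact_mod_cast hn)
      simp [truncate, indicator_of_mem hξ])
  simpa [freqNorm] using hlim

/-- Interpolation between the orders `s` and `s + 2γ`. -/
theorem freqNorm_interpolation {g : R3 → F} (hg : StronglyMeasurable g) {p : ℝ} (hp : 1 ≤ p) :
    freqNorm a σ (s + 2 * γ / p) g ≤
      freqNorm a σ (s + 2 * γ) g ^ (1 / p) * freqNorm a σ s g ^ (1 - 1 / p) := by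
  have hp0 : 0 < p := by linarith
  have h1 : 0 ≤ 1 / p := by positivity
  have h2 : 0 ≤ 1 - 1 / p := by rw [sub_nonneg, div_le_one hp0]; exact hp
  refine le_trans (lintegral_mono_ae ?_) (ENNReal.lintegral_mul_norm_pow_le
    (measurable_weight_mul_enorm a σ (s + 2 * γ) hg).aemeasurable
    (measurable_weight_mul_enorm a σ s hg).aemeasurable h1 h2 (by ring))
  filter_upwards [ae_ne_zero] with ξ hξ
  have hn := norm_pos_iff.mpr hξ
  have hw := weight_pos a σ s hξ
  rw [ENNReal.mul_rpow_of_nonneg _ _ h1, ENNReal.mul_rpow_of_nonneg _ _ h2,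
    mul_mul_mul_comm, ← ENNReal.rpow_add_of_nonneg _ _ h1 h2, add_sub_cancel, ENNReal.rpow_one,
    ENNReal.ofReal_rpow_of_nonneg (weight_nonneg _ _ _ _) h1,
    ENNReal.ofReal_rpow_of_nonneg (weight_nonneg _ _ _ _) h2,
    ← ENNReal.ofReal_mul (by have := weight_nonneg a σ (s + 2 * γ) ξ; positivity)]
  refine le_of_eq ?_
  congr 2
  rw [weight_add _ _ _ _ hξ, weight_add _ _ _ _ hξ, Real.mul_rpow (by positivity) hw.le, mul_assoc,
    ← Real.rpow_add hw, add_sub_cancel, Real.rpow_one, ← Real.rpow_mul hn.le]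
  congr 2
  ring

/-- The case `p = 1` is membership in `L¹([0,T]; X^{s+2γ})`. Strong measurability in time comes from
the truncations, which are continuous in time with values in the space of higher order. -/
theorem IsContinuousCurve.memLpTime (hV : IsContinuousCurve a σ s γ T V)
    (hK : WeightBounds a s σ K) (hγ : 0 ≤ γ)
    (hu : ∀ t ∈ Icc 0 T, HasFourier (u t) (V t)) {p : ℝ} (hp : 1 ≤ p) :
    MemLpTime a σ (s + 2 * γ / p) p T u := by
  have hp0 : 0 < p := by linarith
  have hr : 0 ≤ 2 * γ / p := by positivity
  have hm := stronglyMeasurable_of_uncurry hV.meas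
  have hi := fun t ht => hK.integrable_of_energy hV.meas hV.energy_lt (t := t) ht
  have hn := fun t (ht : t ∈ Icc 0 T) => (freqNorm_le_energy ht).trans_lt hV.energy_lt
  have hfin : ∀ᵐ t ∂(volume.restrict (Icc 0 T)), freqNorm a σ (s + 2 * γ) (V t) < ∞ :=
    ae_lt_top (measurable_freqNorm hV.meas) (timeNorm_le_energy.trans_lt hV.energy_lt).ne
  have hfin' : ∀ᵐ t ∂(volume.restrict (Icc 0 T)), freqNorm a σ (s + 2 * γ / p) (V t) < ∞ := by
    filter_upwards [hfin, ae_restrict_mem measurableSet_Icc] with t h1 ht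
    refine (freqNorm_interpolation (hm t) hp).trans_lt (ENNReal.mul_lt_top ?_ ?_)
    · exact ENNReal.rpow_lt_top_of_nonneg (by positivity) h1.ne
    · exact ENNReal.rpow_lt_top_of_nonneg (by rw [sub_nonneg, div_le_one hp0]; exact hp)
        (hn t ht).ne
  have htr : ∀ n, ∀ t ∈ Icc 0 T, Integrable (truncate n (V t)) := fun n t ht =>
    (hi t ht).indicator Metric.isClosed_closedBall.measurableSet
  have htn : ∀ n, ∀ t ∈ Icc 0 T, freqNorm a σ (s + 2 * γ / p) (truncate n (V t)) < ∞ :=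
    fun n t ht => (freqNorm_truncate_le hr n _).trans_lt
      (ENNReal.mul_lt_top ENNReal.ofReal_lt_top (hn t ht))
  have hmeas : AEStronglyMeasurable (fun t => toSpace a σ (s + 2 * γ / p) (V t))
      (volume.restrict (Icc 0 T)) := by
    refine aestronglyMeasurable_of_tendsto_ae Filter.atTop
      (f := fun n t => toSpace a σ (s + 2 * γ / p) (truncate n (V t))) (fun n => ?_) ?_
    · refine ContinuousOn.aestronglyMeasurable (fun t₀ ht₀ => ?_) measurableSet_Icc
      rw [ContinuousWithinAt, tendsto_iff_edist_tendsto_0]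
      have h1 : Filter.Tendsto (fun t => ENNReal.ofReal ((n : ℝ) ^ (2 * γ / p)) *
          freqNorm a σ s (V t - V t₀)) (nhdsWithin t₀ (Icc 0 T)) (nhds 0) := by
        simpa using ENNReal.Tendsto.const_mul (hV.tendsto t₀ ht₀) (Or.inr ENNReal.ofReal_ne_top)
      refine tendsto_of_tendsto_of_tendsto_of_le_of_le' tendsto_const_nhds h1
        (Filter.Eventually.of_forall fun t => zero_le) ?_
      filter_upwards [self_mem_nhdsWithin] with t ht
      rw [edist_toSpace (htr n t ht) (htn n t ht) (htr n t₀ ht₀) (htn n t₀ ht₀)]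
      have h2 : truncate n (V t) - truncate n (V t₀) = truncate n (V t - V t₀) :=
        (indicator_sub' _ _ _).symm
      rw [h2]
      exact freqNorm_truncate_le hr n _
    · filter_upwards [hfin', ae_restrict_mem measurableSet_Icc] with t h1 ht
      rw [tendsto_iff_edist_tendsto_0]
      refine (tendsto_truncate (hm t) h1).congr fun n => ?_
      rw [edist_toSpace (htr n t ht) (htn n t ht) (hi t ht) h1]
  refine ⟨fun t => toSpace a σ (s + 2 * γ / p) (V t), ⟨hmeas, ?_⟩, ?_⟩
  · rw [eLpNorm_lt_top_iff_lintegral_rpow_enorm_lt_top (by simpa using hp0) (by simp),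
      ENNReal.toReal_ofReal hp0.le]
    set A := energy a σ s γ T V with hA
    have hq : 0 ≤ 1 - 1 / p := by rw [sub_nonneg, div_le_one hp0]; exact hp
    have hle : ∀ᵐ t ∂(volume.restrict (Icc 0 T)), ‖toSpace a σ (s + 2 * γ / p) (V t)‖ₑ ^ p ≤
        freqNorm a σ (s + 2 * γ) (V t) * (A ^ (1 - 1 / p)) ^ p := by
      filter_upwards [hfin', ae_restrict_mem measurableSet_Icc] with t h1 ht
      rw [enorm_toSpace (hi t ht) h1]
      calc _ ≤ (freqNorm a σ (s + 2 * γ) (V t) ^ (1 / p) * A ^ (1 - 1 / p)) ^ p := by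
            gcongr
            refine (freqNorm_interpolation (hm t) hp).trans ?_
            gcongr
            exact freqNorm_le_energy ht
        _ = _ := by
            rw [ENNReal.mul_rpow_of_nonneg _ _ hp0.le, ← ENNReal.rpow_mul,
              one_div_mul_cancel hp0.ne', ENNReal.rpow_one]
    refine (lintegral_mono_ae hle).trans_lt ?_
    rw [lintegral_mul_const _ (measurable_freqNorm hV.meas)]
    refine ENNReal.mul_lt_top (timeNorm_le_energy.trans_lt hV.energy_lt) ?_
    exact ENNReal.rpow_lt_top_of_nonneg hp0.le
      (ENNReal.rpow_lt_top_of_nonneg hq hV.energy_lt.ne).ne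
  · filter_upwards [hfin', ae_restrict_mem measurableSet_Icc] with t h1 ht
    rw [toDist_toSpace (hi t ht) h1]
    exact (hasFourier_ofFourier (hi t ht)).unique (hu t ht) (Filter.EventuallyEq.refl _ _)

/-- The Fourier transform of an element of `X^s`, chosen strongly measurable. -/
theorem WeightBounds.exists_fourier (hK : WeightBounds a s σ K) {f : 𝓢'(R3, F)}
    (hf : xNorm a σ s f < ∞) :
    ∃ g : R3 → F, StronglyMeasurable g ∧ Integrable g ∧ HasFourier f g ∧
      freqNorm a σ s g = xNorm a σ s f := by
  obtain ⟨g, hg⟩ := exists_hasFourier hf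
  obtain ⟨g', hm, he⟩ := hg.aestronglyMeasurable
  have hg' := hg.congr he
  have hn : freqNorm a σ s g' = xNorm a σ s f := (hg'.xNorm_eq a σ s).symm
  exact ⟨g', hm, hK.integrable hm.aestronglyMeasurable (hn ▸ hf), hg', hn⟩

/-- The averages over balls of radius `ρ` of a curve continuous in `L¹` are continuous in time and
measurable in frequency, hence jointly measurable. -/
theorem stronglyMeasurable_average {G : ℝ → R3 → F}
    (hm : ∀ t, StronglyMeasurable (G t)) (hi : ∀ t, Integrable (G t))
    (hc : ∀ t₀, Filter.Tendsto (fun t => ∫⁻ ξ, ‖G t ξ - G t₀ ξ‖ₑ) (nhds t₀) (nhds 0)) (ρ : ℝ) :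
    StronglyMeasurable fun p : ℝ × R3 => ⨍ η in Metric.closedBall p.2 ρ, G p.1 η := by
  have hAe : (fun p : ℝ × R3 => ⨍ η in Metric.closedBall p.2 ρ, G p.1 η) =
      Function.uncurry fun t ξ => (volume.real (Metric.closedBall (0 : R3) ρ))⁻¹ •
        ∫ η in Metric.closedBall ξ ρ, G t η := by
    funext p
    simp only [setAverage_eq, measureReal_def, Measure.addHaar_closedBall_center,
      Function.uncurry_def]
  rw [hAe]
  refine stronglyMeasurable_uncurry_of_continuous_of_stronglyMeasurable (fun ξ => ?_) fun t => ?_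
  · refine Continuous.const_smul (continuous_iff_continuousAt.mpr fun t₀ => ?_) _
    rw [ContinuousAt, tendsto_iff_edist_tendsto_0]
    refine tendsto_of_tendsto_of_tendsto_of_le_of_le tendsto_const_nhds (hc t₀)
      (fun t => zero_le) fun t => ?_
    rw [edist_eq_enorm_sub, ← integral_sub (hi t).integrableOn (hi t₀).integrableOn]
    exact (enorm_integral_le_lintegral_enorm _).trans (setLIntegral_le_lintegral _ _)
  · refine StronglyMeasurable.const_smul ?_ _
    have h2 : ∀ ξ, ∫ η in Metric.closedBall ξ ρ, G t η =
        ∫ η, {q : R3 × R3 | dist q.2 q.1 ≤ ρ}.indicator (fun q => G t q.2) (ξ, η) := by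
      intro ξ
      rw [← integral_indicator measurableSet_closedBall]
      rfl
    simp_rw [h2]
    exact StronglyMeasurable.integral_prod_right'
      (((hm t).comp_measurable measurable_snd).indicator
        (measurableSet_le (by fun_prop) measurable_const))

/-- A curve of integrable functions that is continuous in `L¹` has a jointly measurable version: the
averages over small balls are jointly measurable, and converge almost everywhere. -/
theorem exists_stronglyMeasurable_uncurry {G : ℝ → R3 → F} (hm : ∀ t, StronglyMeasurable (G t))
    (hi : ∀ t, Integrable (G t))
    (hc : ∀ t₀, Filter.Tendsto (fun t => ∫⁻ ξ, ‖G t ξ - G t₀ ξ‖ₑ) (nhds t₀) (nhds 0)) :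
    ∃ V : ℝ → R3 → F, StronglyMeasurable (Function.uncurry V) ∧ ∀ t, G t =ᵐ[volume] V t := by
  set ρ : ℕ → ℝ := fun n => 1 / ((n : ℝ) + 1) with hρ
  obtain ⟨A, hA⟩ : ∃ A : ℕ → ℝ × R3 → F,
      ∀ n p, A n p = ⨍ η in Metric.closedBall p.2 (ρ n), G p.1 η := ⟨_, fun _ _ => rfl⟩
  have hAm : ∀ n, StronglyMeasurable (A n) := fun n => by
    rw [funext (hA n)]
    exact stronglyMeasurable_average hm hi hc (ρ n)
  have hlim := StronglyMeasurable.limUnder (l := Filter.atTop) hAm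
  refine ⟨fun t ξ => Filter.atTop.limUnder fun n => A n (t, ξ), hlim, fun t => ?_⟩
  have hρ0 : Filter.Tendsto ρ Filter.atTop (nhdsWithin 0 (Ioi 0)) := by
    rw [tendsto_nhdsWithin_iff]
    refine ⟨tendsto_one_div_add_atTop_nhds_zero_nat, Filter.Eventually.of_forall fun n => ?_⟩
    rw [hρ, mem_Ioi]
    positivity
  filter_upwards [IsUnifLocDoublingMeasure.ae_tendsto_average volume
    (hi t).locallyIntegrable 1] with ξ hξ
  simp_rw [hA]
  refine (Filter.Tendsto.limUnder_eq (hξ (fun _ => ξ) ρ hρ0 ?_)).symm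
  refine Filter.Eventually.of_forall fun n => Metric.mem_closedBall_self ?_
  rw [hρ]
  positivity

/-- A curve continuous in `X^s` has a jointly measurable Fourier transform. -/
theorem WeightBounds.exists_jointly_measurable (hK : WeightBounds a s σ K) (hT : 0 ≤ T)
    (hu : MemC a σ s T u) :
    ∃ V : ℝ → R3 → F, StronglyMeasurable (Function.uncurry V) ∧
      ∀ t ∈ Icc 0 T, HasFourier (u t) (V t) := by
  obtain ⟨v, hv, hvu⟩ := hu
  have hex : ∀ f : LeiLinGevrey F a σ s, ∃ g : R3 → F, StronglyMeasurable g ∧ Integrable g ∧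
      HasFourier f.toDist g ∧ freqNorm a σ s g = xNorm a σ s f.toDist := fun f =>
    hK.exists_fourier (show xNorm a σ s f.toDist < ∞ from f.2)
  choose g hgm hgi hgf hgn using hex
  -- `v` is extended to the real line as a continuous curve
  obtain ⟨v', hv'c, hv't⟩ : ∃ v' : ℝ → LeiLinGevrey F a σ s, Continuous v' ∧
      ∀ t ∈ Icc 0 T, v' t = v t :=
    ⟨fun t => v (projIcc 0 T hT t), (continuousOn_iff_continuous_domRestrict.mp hv).comp
      continuous_projIcc, fun t ht => by simp [projIcc_of_mem hT ht]⟩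
  have hc : ∀ t₀, Filter.Tendsto (fun t => ∫⁻ ξ, ‖g (v' t) ξ - g (v' t₀) ξ‖ₑ) (nhds t₀)
      (nhds 0) := fun t₀ => by
    have h1 : Filter.Tendsto (fun t => ENNReal.ofReal K * edist (v' t) (v' t₀)) (nhds t₀)
        (nhds 0) := by
      simpa using ENNReal.Tendsto.const_mul
        (tendsto_iff_edist_tendsto_0.mp (hv'c.tendsto t₀)) (Or.inr ENNReal.ofReal_ne_top)
    refine tendsto_of_tendsto_of_tendsto_of_le_of_le tendsto_const_nhds h1
      (fun t => zero_le) fun t => ?_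
    have h2 : freqNorm a σ s (g (v' t) - g (v' t₀)) = edist (v' t) (v' t₀) := by
      rw [edist_eq_enorm_sub, enorm_leiLinGevrey]
      exact (((hgf _).sub (hgf _)).xNorm_eq a σ s).symm
    exact h2 ▸ hK.lintegral_enorm_le (g (v' t) - g (v' t₀))
  have hf : ∀ t ∈ Icc 0 T, HasFourier (u t) (g (v' t)) := fun t ht => by
    rw [← hvu t ht, ← hv't t ht]
    exact hgf _
  obtain ⟨V, hVm, hV⟩ := exists_stronglyMeasurable_uncurry
    (fun t => hgm (v' t)) (fun t => hgi (v' t)) hc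
  exact ⟨V, hVm, fun t ht => (hf t ht).congr (hV t)⟩

end

/-! ### Real solutions -/

section

set_option linter.unusedSectionVars false

variable {F : Type*} [NormedAddCommGroup F] [NormedSpace ℂ F] [CompleteSpace F]
  {a s r σ K T γ α β : ℝ}

/-- A conjugation is a real linear isometry, so it commutes with integrals. -/
theorem map_integral_of_conj (c : F →ₗᵢ⋆[ℂ] F) {X : Type*} [MeasurableSpace X] {μ : Measure X}
    (f : X → F) : ∫ x, c (f x) ∂μ = c (∫ x, f x ∂μ) := by
  let L : F →ₗᵢ[ℝ] F :=
    { toFun := c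
      map_add' := c.map_add
      map_smul' := fun r x => by
        rw [← Complex.coe_smul, c.map_smulₛₗ, Complex.conj_ofReal, Complex.coe_smul]
        rfl
      norm_map' := c.norm_map }
  exact L.integral_comp_comm f

/-- The Fourier transform of the conjugate of a function with Fourier transform `g`, where `c` is
the conjugation of the values. -/
def reflect (c : F →ₗᵢ⋆[ℂ] F) (g : R3 → F) (ξ : R3) : F := c (g (-ξ))

theorem quasi_neg : Measure.QuasiMeasurePreserving (fun ξ : R3 => -ξ) volume volume :=
  (Measure.measurePreserving_neg volume).quasiMeasurePreserving

theorem reflect_congr (c : F →ₗᵢ⋆[ℂ] F) {g g' : R3 → F} (h : g =ᵐ[volume] g') :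
    reflect c g =ᵐ[volume] reflect c g' := by
  filter_upwards [quasi_neg.ae h] with ξ hξ
  rw [reflect, reflect, hξ]

theorem Integrable.reflect (c : F →ₗᵢ⋆[ℂ] F) {g : R3 → F} (hg : Integrable g) :
    Integrable (reflect c g) := by
  refine hg.comp_neg.mono (c.continuous.comp_aestronglyMeasurable
    hg.comp_neg.aestronglyMeasurable) (Filter.Eventually.of_forall fun ξ => ?_)
  rw [Boussinesq.reflect, c.norm_map]

theorem stronglyMeasurable_reflect (c : F →ₗᵢ⋆[ℂ] F) {V : ℝ → R3 → F}
    (hV : StronglyMeasurable (Function.uncurry V)) :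
    StronglyMeasurable (Function.uncurry fun t => reflect c (V t)) :=
  c.continuous.comp_stronglyMeasurable
    (hV.comp_measurable (g := fun p : ℝ × R3 => (p.1, -p.2)) (by fun_prop))

theorem freqNorm_reflect (c : F →ₗᵢ⋆[ℂ] F) (g : R3 → F) :
    freqNorm a σ r (reflect c g) = freqNorm a σ r g := by
  unfold freqNorm
  rw [← lintegral_neg_eq_self (μ := volume) fun ξ => ENNReal.ofReal (weight a σ r ξ) * ‖g ξ‖ₑ]
  refine lintegral_congr fun ξ => ?_
  congr 1
  · simp [weight]
  · rw [reflect, ← ofReal_norm, c.norm_map, ofReal_norm]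

theorem energy_reflect (c : F →ₗᵢ⋆[ℂ] F) (V : ℝ → R3 → F) :
    energy a σ s γ T (fun t => reflect c (V t)) = energy a σ s γ T V := by
  simp only [energy, timeNorm, freqNorm_reflect]

theorem duhamel_reflect (c : F →ₗᵢ⋆[ℂ] F) (g : R3 → F) (G : ℝ → R3 → F) (t : ℝ) :
    duhamel γ (reflect c g) (fun τ => reflect c (G τ)) t = reflect c (duhamel γ g G t) := by
  have hs : ∀ (τ : ℝ) (ξ : R3) (v : F),
      (heatSymbol γ τ ξ : ℂ) • c v = c ((heatSymbol γ τ (-ξ) : ℂ) • v) := fun τ ξ v => by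
    rw [c.map_smulₛₗ, Complex.conj_ofReal, heatSymbol, heatSymbol, norm_neg]
  funext ξ
  simp only [duhamel, reflect, hs, map_integral_of_conj, map_add]

theorem duhamel_congr_data {g g' : R3 → F} (h : g =ᵐ[volume] g') (G : ℝ → R3 → F) (t : ℝ) :
    duhamel γ g G t =ᵐ[volume] duhamel γ g' G t := by
  filter_upwards [h] with ξ hξ
  rw [duhamel, duhamel, hξ]

/-- Conjugation of the components of a complex vector. -/
def conjC3 : C3 →ₗᵢ⋆[ℂ] C3 where
  toFun v := WithLp.toLp 2 fun j => (starRingEnd ℂ) (v j)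
  map_add' v w := by ext j; simp
  map_smul' z v := by ext j; simp
  norm_map' v := by simp [EuclideanSpace.norm_eq]

theorem conjC3_apply (v : C3) (j : Fin 3) : conjC3 v j = (starRingEnd ℂ) (v j) := rfl

/-- Conjugation of complex numbers. -/
def conjC : ℂ →ₗᵢ⋆[ℂ] ℂ := (starₗᵢ ℂ : ℂ ≃ₗᵢ⋆[ℂ] ℂ).toLinearIsometry

theorem conjC_apply (z : ℂ) : conjC z = (starRingEnd ℂ) z := rfl

theorem dotC_conjC3 (ξ : R3) (v : C3) : dotC ξ (conjC3 v) = -(starRingEnd ℂ) (dotC (-ξ) v) := by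
  simp [dotC, conjC3_apply]

theorem convAdvection_reflect (c : F →ₗᵢ⋆[ℂ] F) (U : R3 → C3) (W : R3 → F) :
    convAdvection (reflect conjC3 U) (reflect c W) = reflect c (convAdvection U W) := by
  funext ξ
  unfold reflect convAdvection
  rw [c.map_smulₛₗ, Complex.conj_ofReal, ← map_integral_of_conj,
    ← integral_neg_eq_self (μ := volume)
      fun η => c ((Complex.I * dotC (-ξ) (U (-ξ - η))) • W η)]
  congr 1
  refine integral_congr_ae (Filter.Eventually.of_forall fun η => ?_)
  dsimp only
  -- the signs from `conj i = -i` and from `-ξ` cancel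
  rw [dotC_conjC3, c.map_smulₛₗ, map_mul, Complex.conj_I, mul_neg, neg_mul, neg_sub, neg_sub_neg]

theorem leraySymbol_conjC3 (ξ : R3) (v : C3) :
    leraySymbol ξ (conjC3 v) = conjC3 (leraySymbol (-ξ) v) := by
  ext j
  simp [leraySymbol, conjC3_apply, dotC_conjC3, cvec, neg_div]

theorem forceU_reflect (U : R3 → C3) (Θ : R3 → ℂ) :
    forceU (reflect conjC3 U) (reflect conjC Θ) = reflect conjC3 (forceU U Θ) := by
  have h1 : ∀ z : ℂ, conjC z • (EuclideanSpace.single 2 1 : C3) =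
      conjC3 (z • EuclideanSpace.single 2 1) := fun z => by
    rw [conjC3.map_smulₛₗ, conjC_apply]
    congr 1
    ext j
    rw [conjC3_apply]
    fin_cases j <;> simp
  funext ξ
  simp only [forceU, convAdvection_reflect, reflect, h1, leraySymbol_conjC3, map_add, map_neg]

theorem forceΘ_reflect (U : R3 → C3) (Θ : R3 → ℂ) :
    forceΘ (reflect conjC3 U) (reflect conjC Θ) = reflect conjC (forceΘ U Θ) := by
  funext ξ
  simp only [forceΘ, convAdvection_reflect, reflect, map_neg]

variable {g : R3 → C3} {h : R3 → ℂ} {U : ℝ → R3 → C3} {Θ : ℝ → R3 → ℂ}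

/-- The system commutes with complex conjugation. -/
theorem IsFourierSolution.reflect (hsol : IsFourierSolution α β T g h U Θ)
    (hg : g =ᵐ[volume] reflect conjC3 g) (hh : h =ᵐ[volume] reflect conjC h) :
    IsFourierSolution α β T g h (fun t => reflect conjC3 (U t)) (fun t => reflect conjC (Θ t)) where
  meas_u := stronglyMeasurable_reflect _ hsol.meas_u
  meas_θ := stronglyMeasurable_reflect _ hsol.meas_θ
  eq_u t ht := by
    simp only [forceU_reflect]
    refine (reflect_congr _ (hsol.eq_u t ht)).trans ?_
    rw [← duhamel_reflect]
    exact duhamel_congr_data hg.symm _ _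
  eq_θ t ht := by
    simp only [forceΘ_reflect]
    refine (reflect_congr _ (hsol.eq_θ t ht)).trans ?_
    rw [← duhamel_reflect]
    exact duhamel_congr_data hh.symm _ _

/-- Conjugation of a test function. -/
def conjTest (φ : 𝓢(R3, ℂ)) : 𝓢(R3, ℂ) :=
  φ.postcompCLM (Complex.conjCLE : ℂ →L[ℝ] ℂ)

theorem conjTest_apply (φ : 𝓢(R3, ℂ)) (x : R3) : conjTest φ x = (starRingEnd ℂ) (φ x) := rfl

theorem fourierInv_conjTest (φ : 𝓢(R3, ℂ)) (x : R3) :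
    (𝓕⁻ (conjTest φ)) x = (starRingEnd ℂ) ((𝓕⁻ φ) (-x)) := by
  simp only [SchwartzMap.fourierInv_coe, Real.fourierInv_eq']
  rw [← integral_conj]
  refine integral_congr_ae (Filter.Eventually.of_forall fun v => ?_)
  simp only [conjTest_apply, smul_eq_mul, map_mul, ← Complex.exp_conj, Complex.conj_ofReal,
    Complex.conj_I, inner_neg_right, mul_neg, Complex.ofReal_neg, neg_mul, neg_neg, map_neg]

/-- The distribution with Fourier transform `reflect c g` is the conjugate of the one with Fourier
transform `g`. -/
theorem HasFourier.apply_reflect (c : F →ₗᵢ⋆[ℂ] F) {f f' : 𝓢'(R3, F)} {g : R3 → F}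
    (hf : HasFourier f g) (hf' : HasFourier f' (reflect c g)) (φ : 𝓢(R3, ℂ)) :
    f' φ = c (f (conjTest φ)) := by
  rw [hf.apply_eq, hf'.apply_eq, c.map_smulₛₗ, Complex.conj_ofReal, ← map_integral_of_conj,
    ← integral_neg_eq_self (μ := volume) fun ξ => c (_ • g ξ)]
  congr 1
  refine integral_congr_ae (Filter.Eventually.of_forall fun ξ => ?_)
  simp only [reflect, c.map_smulₛₗ, fourierInv_conjTest, Complex.conj_conj, smul_neg, neg_neg]

/-- A distribution is real, for the conjugation `c` of its values, iff its Fourier transform is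
invariant under `reflect c`. -/
theorem HasFourier.forall_real_iff (c : F →ₗᵢ⋆[ℂ] F) {f : 𝓢'(R3, F)} {g : R3 → F}
    (hf : HasFourier f g) (hg : Integrable g) :
    (∀ φ : 𝓢(R3, ℂ), (∀ x, (φ x).im = 0) → c (f φ) = f φ) ↔ g =ᵐ[volume] reflect c g := by
  have hf' := hasFourier_ofFourier (Integrable.reflect c hg)
  have key := hf.apply_reflect c hf'
  constructor
  · intro hreal
    refine hf.ae_eq (g' := Boussinesq.reflect c g) ?_
    convert hf'
    ext φ
    rw [key]
    -- a test function is split into its real and imaginary parts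
    obtain ⟨φ₁, φ₂, h1, h2, rfl⟩ : ∃ φ₁ φ₂ : 𝓢(R3, ℂ), (∀ x, (φ₁ x).im = 0) ∧
        (∀ x, (φ₂ x).im = 0) ∧ φ = φ₁ + Complex.I • φ₂ := by
      refine ⟨(2⁻¹ : ℂ) • (φ + conjTest φ), (-(Complex.I / 2)) • (φ - conjTest φ), fun x => ?_,
        fun x => ?_, ?_⟩
      · simp [conjTest_apply]
      · simp [conjTest_apply]
      · ext x
        simp only [add_apply, smul_apply, sub_apply, smul_eq_mul]
        linear_combination ((1 / 2) * (φ x - conjTest φ x)) * Complex.I_mul_I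
    have h3 : conjTest (φ₁ + Complex.I • φ₂) = φ₁ - Complex.I • φ₂ := by
      ext x
      simp [conjTest_apply, Complex.conj_eq_iff_im.mpr (h1 x), Complex.conj_eq_iff_im.mpr (h2 x),
        sub_eq_add_neg]
    rw [h3, map_sub, map_add, map_smul, map_sub, c.map_smulₛₗ, hreal _ h1, hreal _ h2,
      Complex.conj_I, neg_smul, sub_neg_eq_add]
  · intro h φ hφ
    have h1 : conjTest φ = φ := by
      ext x
      exact Complex.conj_eq_iff_im.mpr (hφ x)
    have h2 := key φ
    rw [h1, ← hf.unique hf' h] at h2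
    exact h2.symm

theorem HasFourier.isRealScalar_iff {f : 𝓢'(R3, ℂ)} {g : R3 → ℂ} (hf : HasFourier f g)
    (hg : Integrable g) : IsRealScalar f ↔ g =ᵐ[volume] reflect conjC g := by
  rw [← hf.forall_real_iff conjC hg]
  simp only [IsRealScalar, conjC_apply, Complex.conj_eq_iff_im]

theorem HasFourier.isRealVector_iff {f : 𝓢'(R3, C3)} {g : R3 → C3} (hf : HasFourier f g)
    (hg : Integrable g) : IsRealVector f ↔ g =ᵐ[volume] reflect conjC3 g := by
  rw [← hf.forall_real_iff conjC3 hg]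
  have h : ∀ v : C3, conjC3 v = v ↔ ∀ j, (v j).im = 0 := fun v => by
    rw [← (WithLp.ofLp_injective 2).eq_iff, funext_iff]
    exact forall_congr' fun j => Complex.conj_eq_iff_im
  simp only [IsRealVector, h]

end

/-! ### Choice of the constants and conclusion -/

/-- Young's inequality without smallness, valid down to the critical exponent. -/
theorem youngBound_one {γ : ℝ} (hγ : 1 / 2 ≤ γ) : YoungBound γ 1 1 where
  eps_nonneg := zero_le_one
  const_nonneg := zero_le_one
  le y hy := by
    rcases le_total y 1 with h | h
    · have := Real.rpow_nonneg hy.le (2 * γ)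
      linarith
    · have := Real.rpow_le_rpow_of_exponent_le h (show 1 ≤ 2 * γ by linarith)
      rw [Real.rpow_one] at this
      linarith

/-- Above the critical exponent the constant in front of the order `s + 2γ` can be made small. -/
theorem exists_youngBound {γ ε : ℝ} (hγ : 1 / 2 < γ) (hε : 0 < ε) :
    ∃ R : ℝ, ∀ M, R ≤ M → YoungBound γ ε M := by
  have h := (tendsto_rpow_atTop (show 0 < 2 * γ - 1 by linarith)).eventually_ge_atTop ε⁻¹
  obtain ⟨R, hR⟩ := Filter.eventually_atTop.mp h
  refine ⟨max R 0, fun M hM => ⟨hε.le, (le_max_right _ _).trans hM, fun y hy => ?_⟩⟩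
  have hM0 : 0 ≤ M := (le_max_right _ _).trans hM
  have hp := Real.rpow_nonneg hy.le (2 * γ)
  rcases le_total y R with h1 | h1
  · have : y ≤ M := h1.trans ((le_max_left _ _).trans hM)
    have := mul_nonneg hε.le hp
    linarith
  · have h2 : y ^ (2 * γ) = y ^ (2 * γ - 1) * y := by
      rw [← Real.rpow_add_one hy.ne']
      congr 1
      ring
    have h3 : 1 ≤ ε * y ^ (2 * γ - 1) := by
      have := mul_le_mul_of_nonneg_left (hR y h1) hε.le
      rwa [mul_inv_cancel₀ hε.ne'] at this
    rw [h2, ← mul_assoc]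
    nlinarith

theorem exists_small_time {K ε M C : ℝ} (hK : 1 ≤ K) (hM : 1 ≤ M) (hC : 0 < C)
    (h : 2 * K * ε * C ≤ 1 / 64) : ∃ T : ℝ, 0 < T ∧ Small K ε M T C := by
  have hKMC : 0 < K * M * C := by positivity
  have hT : 0 < min (1 / 16) (1 / (128 * (K * M * C))) := lt_min (by norm_num) (by positivity)
  refine ⟨_, hT, hT.le, min_le_left _ _, ?_⟩
  have h1 := mul_le_mul_of_nonneg_left (min_le_right (1 / 16) (1 / (128 * (K * M * C))))
    hKMC.le
  have h2 : K * M * C * (1 / (128 * (K * M * C))) = 1 / 128 := by field_simp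
  rw [h2] at h1
  nlinarith

/-- The constants for data of size `D`: in the critical case the ball is fixed and the data are
small, otherwise the ball is adapted to the data and the time is short. -/
theorem exists_small {K α β D : ℝ} (hK : 1 ≤ K) (hα : 1 / 2 ≤ α) (hβ : 1 / 2 ≤ β) (hD : 0 ≤ D)
    (hcrit : (α = 1 / 2 ∨ β = 1 / 2) → D < 1 / (512 * K)) :
    ∃ ε M T C : ℝ, 0 < T ∧ 4 * D < C ∧ Small K ε M T C ∧ YoungBound α ε M ∧ YoungBound β ε M := by
  have hK0 : 0 < K := by linarith
  by_cases hc : α = 1 / 2 ∨ β = 1 / 2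
  · have hC : 0 < 1 / (128 * K) := by positivity
    have h1 : 2 * K * 1 * (1 / (128 * K)) ≤ 1 / 64 := by
      apply le_of_eq
      field_simp
      norm_num
    obtain ⟨T, hT, hS⟩ := exists_small_time hK le_rfl hC h1
    refine ⟨1, 1, T, _, hT, ?_, hS, youngBound_one hα, youngBound_one hβ⟩
    have h2 : 1 / (128 * K) = 4 * (1 / (512 * K)) := by
      field_simp
      norm_num
    rw [h2]
    linarith [hcrit hc]
  · push Not at hc
    set C : ℝ := 4 * D + 1 with hCdef
    have hC : 0 < C := by positivity
    have hε : 0 < 1 / (128 * K * C) := by positivity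
    obtain ⟨R, hR⟩ := exists_youngBound (lt_of_le_of_ne hα hc.1.symm) hε
    obtain ⟨R', hR'⟩ := exists_youngBound (lt_of_le_of_ne hβ hc.2.symm) hε
    have h1 : 2 * K * (1 / (128 * K * C)) * C ≤ 1 / 64 := by
      apply le_of_eq
      field_simp
      norm_num
    obtain ⟨T, hT, hS⟩ := exists_small_time (M := max 1 (max R R')) hK (le_max_left _ _) hC h1
    exact ⟨_, _, T, C, hT, by linarith, hS,
      hR _ ((le_max_left _ _).trans (le_max_right _ _)),
      hR' _ ((le_max_right _ _).trans (le_max_right _ _))⟩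

section

variable {a s σ K ε M C T α β : ℝ} {u : ℝ → 𝓢'(R3, C3)} {θ : ℝ → 𝓢'(R3, ℂ)}
  {U U' : ℝ → R3 → C3} {Θ Θ' : ℝ → R3 → ℂ} {g : R3 → C3} {h : R3 → ℂ}

/-- The norm of a pair of distributions is the energy of its Fourier transforms. -/
theorem solutionNorm_eq (hu : ∀ t ∈ Icc 0 T, HasFourier (u t) (U t))
    (hθ : ∀ t ∈ Icc 0 T, HasFourier (θ t) (Θ t)) :
    solutionNorm a σ s α β T u θ = totalEnergy a σ s α β T U Θ := by
  have h1 : ∀ {F : Type} [NormedAddCommGroup F] [NormedSpace ℂ F] [CompleteSpace F]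
      {v : ℝ → 𝓢'(R3, F)} {V : ℝ → R3 → F} (γ : ℝ), (∀ t ∈ Icc 0 T, HasFourier (v t) (V t)) →
      supNorm a σ s T v + oneNorm a σ (s + 2 * γ) T v = energy a σ s γ T V := by
    intro F _ _ _ v V γ hv
    unfold supNorm oneNorm energy timeNorm
    congr 1
    · exact iSup_congr fun t => iSup_congr fun ht => (hv t ht).xNorm_eq a σ s
    · exact setLIntegral_congr_fun measurableSet_Icc fun t ht => (hv t ht).xNorm_eq a σ _
  rw [solutionNorm, totalEnergy, ← h1 α hu, ← h1 β hθ, add_assoc, add_assoc]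

/-- A solution in frequency is a pair of curves of finite energy, continuous in `X^s`. -/
theorem WeightBounds.isContinuousCurve (hK : WeightBounds a s σ K) (hS : Small K ε M T C)
    (hα : YoungBound α ε M) (hβ : YoungBound β ε M) (hg : StronglyMeasurable g)
    (hh : StronglyMeasurable h) (hgn : freqNorm a σ s g < ∞) (hhn : freqNorm a σ s h < ∞)
    (sol : IsFourierSolution α β T g h U Θ)
    (e : totalEnergy a σ s α β T U Θ ≤ ENNReal.ofReal C) :
    IsContinuousCurve a σ s α T U ∧ IsContinuousCurve a σ s β T Θ := by
  have hfin := e.trans_lt ENNReal.ofReal_lt_top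
  obtain ⟨eu, eθ⟩ := ENNReal.add_lt_top.mp hfin
  obtain ⟨fu, fθ⟩ := ENNReal.add_lt_top.mp
    ((hK.timeNorm_force_le_of_small hS hα hβ sol.meas_u sol.meas_θ e).trans_lt
      (ENNReal.mul_lt_top ENNReal.ofReal_lt_top hfin))
  refine ⟨⟨sol.meas_u, eu, fun t₀ ht₀ => ?_⟩, ⟨sol.meas_θ, eθ, fun t₀ ht₀ => ?_⟩⟩
  · refine (hK.tendsto_freqNorm_duhamel (γ := α) hg
      (stronglyMeasurable_forceU sol.meas_u sol.meas_θ) hgn fu ht₀).congr' ?_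
    filter_upwards [self_mem_nhdsWithin] with t ht
    exact freqNorm_congr ((sol.eq_u t ht).sub (sol.eq_u t₀ ht₀)).symm
  · refine (hK.tendsto_freqNorm_duhamel (γ := β) hh
      (stronglyMeasurable_forceΘ sol.meas_u sol.meas_θ) hhn fθ ht₀).congr' ?_
    filter_upwards [self_mem_nhdsWithin] with t ht
    exact freqNorm_congr ((sol.eq_θ t ht).sub (sol.eq_θ t₀ ht₀)).symm

/-- A mild solution in the solution space gives a solution in frequency. -/
theorem WeightBounds.exists_isFourierSolution (hK : WeightBounds a s σ K) (hT : 0 ≤ T)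
    (hα : YoungBound α ε M) (hβ : YoungBound β ε M) {u₀ : 𝓢'(R3, C3)} {θ₀ : 𝓢'(R3, ℂ)}
    (hu₀ : HasFourier u₀ g) (hθ₀ : HasFourier θ₀ h) (hg : Integrable g) (hh : Integrable h)
    (hmem : MemSolutionSpace a σ s α β T u θ) (hm : IsMildSolution α β T u₀ θ₀ u θ)
    (hlt : solutionNorm a σ s α β T u θ < ∞) :
    ∃ (U : ℝ → R3 → C3) (Θ : ℝ → R3 → ℂ), Represents a s σ α β T u θ U Θ ∧
      IsFourierSolution α β T g h U Θ := by
  obtain ⟨V, hVm, hV⟩ := hK.exists_jointly_measurable hT hmem.1.1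
  obtain ⟨Ψ, hΨm, hΨ⟩ := hK.exists_jointly_measurable hT hmem.2.1
  have hR : Represents a s σ α β T u θ V Ψ :=
    ⟨hVm, hΨm, by rwa [← solutionNorm_eq hV hΨ], hV, hΨ⟩
  exact ⟨V, Ψ, hR, hR.isFourierSolution_of_isMildSolution hK hT hα hβ hu₀ hθ₀ hg hh hm⟩

end

end Boussinesq

end

theorem theorem1p2 (a s σ : ℝ)
    (h : (0 < a ∧ (-1 ≤ s ∧ s < 0) ∧ 1 < σ) ∨ (0 ≤ a ∧ s = 0 ∧ 1 ≤ σ)) :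
    ∃ C₂ δ : ℝ, 0 < C₂ ∧ 0 < δ ∧
      ∀ α β : ℝ, 1 / 2 ≤ α → 1 / 2 ≤ β →
      ∀ (u₀ : 𝓢'(Boussinesq.R3, Boussinesq.C3)) (θ₀ : 𝓢'(Boussinesq.R3, ℂ)),
        Boussinesq.xNorm a σ s u₀ < ∞ → Boussinesq.xNorm a σ s θ₀ < ∞ →
        Boussinesq.IsDivFree u₀ →
        ((α = 1 / 2 ∨ β = 1 / 2) →
          Boussinesq.xNorm a σ s u₀ + Boussinesq.xNorm a σ s θ₀ < ENNReal.ofReal δ) →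
        ∃ T C₁ : ℝ, 0 < T ∧ 0 < C₁ ∧
          ∃ (u : ℝ → 𝓢'(Boussinesq.R3, Boussinesq.C3)) (θ : ℝ → 𝓢'(Boussinesq.R3, ℂ)),
            -- existence in the solution space, in the ball of radius `C₁`
            Boussinesq.MemSolutionSpace a σ s α β T u θ ∧
            Boussinesq.IsMildSolution α β T u₀ θ₀ u θ ∧
            Boussinesq.solutionNorm a σ s α β T u θ < ENNReal.ofReal C₁ ∧
            -- uniqueness in the same class
            (∀ (v : ℝ → 𝓢'(Boussinesq.R3, Boussinesq.C3)) (ψ : ℝ → 𝓢'(Boussinesq.R3, ℂ)),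
              Boussinesq.MemSolutionSpace a σ s α β T v ψ →
              Boussinesq.IsMildSolution α β T u₀ θ₀ v ψ →
              Boussinesq.solutionNorm a σ s α β T v ψ < ENNReal.ofReal C₁ →
              ∀ t ∈ Set.Icc 0 T, v t = u t ∧ ψ t = θ t) ∧
            -- bound by the data
            Boussinesq.solutionNorm a σ s α β T u θ ≤ ENNReal.ofReal C₂ *
              (Boussinesq.xNorm a σ s u₀ + Boussinesq.xNorm a σ s θ₀) ∧
            -- `L^p` regularity in time
            (∀ p : ℝ, 1 ≤ p →
              Boussinesq.MemLpTime a σ (s + 2 * α / p) p T u ∧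
              Boussinesq.MemLpTime a σ (s + 2 * β / p) p T θ) ∧
            -- real data have a real solution
            (Boussinesq.IsRealVector u₀ → Boussinesq.IsRealScalar θ₀ →
              ∀ t ∈ Set.Icc 0 T, Boussinesq.IsRealVector (u t) ∧
                Boussinesq.IsRealScalar (θ t)) := by
  obtain ⟨K, hK1, hK2, hK3⟩ := Boussinesq.Admissible.exists_weight_le h
  have hK : Boussinesq.WeightBounds a s σ K := ⟨hK1, hK2, hK3⟩
  have hK0 : 0 < K := by linarith
  -- `4` is the constant of `exists_fourierSolution`, `1 / (512 K)` the threshold of `exists_small`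
  refine ⟨4, 1 / (512 * K), by norm_num, by positivity, ?_⟩
  intro α β hα hβ u₀ θ₀ hu₀ hθ₀ hdiv hcrit
  obtain ⟨g, hgm, hgi, hug, hgn⟩ := hK.exists_fourier hu₀
  obtain ⟨k, hkm, hki, hθk, hkn⟩ := hK.exists_fourier hθ₀
  rw [← hgn] at hu₀
  rw [← hkn] at hθ₀
  rw [← hgn, ← hkn] at hcrit ⊢
  set D := Boussinesq.freqNorm a σ s g + Boussinesq.freqNorm a σ s k with hD
  have hDt : D ≠ ∞ := (ENNReal.add_lt_top.mpr ⟨hu₀, hθ₀⟩).ne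
  obtain ⟨ε, M, T, C, hT, hDC, hS, yα, yβ⟩ := Boussinesq.exists_small (D := D.toReal) hK1 hα hβ
    ENNReal.toReal_nonneg fun hc => by
      have := (ENNReal.toReal_lt_toReal hDt ENNReal.ofReal_ne_top).mpr (hcrit hc)
      rwa [ENNReal.toReal_ofReal (by positivity)] at this
  have hC : 0 < C := (by positivity : (0 : ℝ) ≤ 4 * D.toReal).trans_lt hDC
  have h4D : 4 * D < ENNReal.ofReal C := by
    rw [← ENNReal.ofReal_toReal hDt, ← ENNReal.ofReal_ofNat 4, ← ENNReal.ofReal_mul (by norm_num)]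
    exact (ENNReal.ofReal_lt_ofReal_iff hC).mpr hDC
  obtain ⟨U, Θ, sol, hen⟩ := hK.exists_fourierSolution hS yα yβ hgm hkm h4D.le
  have hUC := hen.trans h4D.le
  have hlt := hUC.trans_lt ENNReal.ofReal_lt_top
  have hUi := fun t ht => hK.integrable_of_energy sol.meas_u (ENNReal.add_lt_top.mp hlt).1
    (t := t) ht
  have hΘi := fun t ht => hK.integrable_of_energy sol.meas_θ (ENNReal.add_lt_top.mp hlt).2
    (t := t) ht
  have hR : Boussinesq.Represents a s σ α β T (fun t => Boussinesq.ofFourier (U t))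
      (fun t => Boussinesq.ofFourier (Θ t)) U Θ :=
    ⟨sol.meas_u, sol.meas_θ, hlt, fun t ht => Boussinesq.hasFourier_ofFourier (hUi t ht),
      fun t ht => Boussinesq.hasFourier_ofFourier (hΘi t ht)⟩
  obtain ⟨cu, cθ⟩ := hK.isContinuousCurve hS yα yβ hgm hkm hu₀ hθ₀ sol hUC
  have hLp : ∀ p : ℝ, 1 ≤ p →
      Boussinesq.MemLpTime a σ (s + 2 * α / p) p T (fun t => Boussinesq.ofFourier (U t)) ∧
      Boussinesq.MemLpTime a σ (s + 2 * β / p) p T (fun t => Boussinesq.ofFourier (Θ t)) :=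
    fun p hp => ⟨cu.memLpTime hK (by linarith) hR.fourier_u hp,
      cθ.memLpTime hK (by linarith) hR.fourier_θ hp⟩
  have hnorm := Boussinesq.solutionNorm_eq (a := a) (σ := σ) (s := s) (α := α) (β := β)
    hR.fourier_u hR.fourier_θ
  refine ⟨T, C, hT, hC, _, _, ?_, ?_, ?_, ?_, ?_, hLp, ?_⟩
  · have h1 := hLp 1 le_rfl
    rw [div_one, div_one] at h1
    exact ⟨⟨cu.memC hK hR.fourier_u, h1.1⟩, ⟨cθ.memC hK hR.fourier_θ, h1.2⟩⟩
  · exact hR.isMildSolution hK hT.le yα yβ hug hθk hgi hki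
      ((Boussinesq.isDivFree_iff hug).mp hdiv) sol
  · rw [hnorm]
    exact hen.trans_lt h4D
  · intro v ψ hmem hmild hvC t ht
    obtain ⟨V, Ψ, hR', sol'⟩ := hK.exists_isFourierSolution hT.le yα yβ hug hθk hgi hki hmem hmild
      (hvC.trans ENNReal.ofReal_lt_top)
    rw [Boussinesq.solutionNorm_eq hR'.fourier_u hR'.fourier_θ] at hvC
    obtain ⟨e1, e2⟩ := hK.fourierSolution_unique hS yα yβ sol' sol hvC.le hUC t ht
    exact ⟨(hR'.fourier_u t ht).unique (hR.fourier_u t ht) e1,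
      (hR'.fourier_θ t ht).unique (hR.fourier_θ t ht) e2⟩
  · rw [hnorm, ENNReal.ofReal_ofNat]
    exact hen
  · intro hru hrθ t ht
    -- the conjugate of the solution solves the same system in the same ball
    have sol' := sol.reflect ((hug.isRealVector_iff hgi).mp hru) ((hθk.isRealScalar_iff hki).mp hrθ)
    have hUC' : Boussinesq.totalEnergy a σ s α β T
        (fun t => Boussinesq.reflect Boussinesq.conjC3 (U t))
        (fun t => Boussinesq.reflect Boussinesq.conjC (Θ t)) ≤ ENNReal.ofReal C := by
      rwa [Boussinesq.totalEnergy, Boussinesq.energy_reflect, Boussinesq.energy_reflect]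
    obtain ⟨e1, e2⟩ := hK.fourierSolution_unique hS yα yβ sol sol' hUC hUC' t ht
    exact ⟨((hR.fourier_u t ht).isRealVector_iff (hUi t ht)).mpr e1,
      ((hR.fourier_θ t ht).isRealScalar_iff (hΘi t ht)).mpr e2⟩
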